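/- **Theorem (abstract multiparameter variation/oscillation theorem).** *Notation.* $\mathbb R_+=(0,\infty)$, $\mathbb Z_+=\{1,2,\dots\}$, $[k]=\{1,\dots,k\}$. For vectors, $x\preceq y$ (resp. $x\prec y$) means $x_i\le y_i$ (resp. $x_i<y_i$) for every coordinate $i$. For numbers $a_s\in\mathbb C$ and a set $\mathbb I$ contained in $\mathbb R^k_+$ or in $\mathbb Z^r$, $$V^2(a_s:s\in\mathbb I)=\sup\Big\{\Big(\sum_{j=1}^J|a_{I_j}-a_{I_{j-1}}|^2\Big)^{1/2}: J\in\mathbb Z_+,\ I_0,\dots,I_J\in\mathbb I,\ I_0\prec I_1\prec\dots\prec I_J\Big\},$$ and for an infinite sequence $I=(I_0\prec I_1\prec\cdots)$ in $\mathbb R^k_+$ $$O^2_I(a_s:s\in\mathbb R_+^k)=\Big(\sum_{j\ge1}\ \sup_{I_{j-1}\preceq s\prec I_j}|a_s-a_{I_{j-1}}|^2\Big)^{1/2}.$$ For $h\in\mathbb R^k_+$ let $\Delta_h^{\{j\}}a_s=a_{s+h_je_j}-a_s$, let $\Delta_h^K$ be the composition of the $\Delta_h^{\{j\}}$, $j\in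 K$, for $K\subseteq[k]$, and let $\Delta^\emptyset_ha_s=a_s$. Write $p'$ for the exponent conjugate to $p$. The functions $\mathcal H_sf$ are given by fixed representatives, so that $\mathcal H_sf(x)$ makes sense; the $L^p$ norm of a possibly non-measurable function with values in $[0,\infty]$ is the infimum of the norms of its measurable a.e. majorants; the supremum defining $\mathcal H_*$ below is the essential supremum. *Hypotheses.* Let $(X,\mathcal B(X),\mu)$ be a $\sigma$-finite measure space, $1\le p_0<p_1\le2$, $k,r,L\in\mathbb Z_+$, $\varepsilon\in(0,\frac12)$, and let $\{\mathcal H_s:s\in\mathbb R_+^k\}$ be linear operators defined on $L^{p_0}(X)+L^2(X)$, with values in the measurable functions. Assume the following. * **(C1)** The maximal operator $\mathcal H_*f=\sup_{s\in\mathbb R_+^k}\sup_{|g|\le|f|}|\mathcal H_sg|$ is bounded on $L^{p_1}(X)$. * **(C2)** For ${\bf g}\in\mathbb Z^r$ there are cubes $Q_{\bf g}=\{s:\ell_{\bf g}\preceq s\preceq(1+2^L)\ell_{\bf g}\}$ with $\ell_{\bf g}\in\mathbb R_+^k$ and points $s({\bf g})\in Q_{\bf g}$ such that, uniformly in $f\in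 L^{p_1}(X)$, $$\|V^2(\mathcal H_sf:s\in\mathbb R^k_+)\|_{L^{p_1}}\lesssim\|V^2(\mathcal H_{s({\bf g})}f:{\bf g}\in\mathbb Z^r)\|_{L^{p_1}}+\Big\|\Big(\sum_{{\bf g}\in\mathbb Z^r}V^2(\mathcal H_sf:s\in Q_{\bf g})^2\Big)^{1/2}\Big\|_{L^{p_1}}.$$ * **(C3)** For $f\in L^{p_1}(X)$ and ${\bf g}\in\mathbb Z^r$ the map $s\mapsto\mathcal H_sf(x)$ is continuous on $Q_{\bf g}$ for $\mu$-a.e. $x$. * **(C4)** There are operators $\{\mathcal S_{\bf g}:{\bf g}\in\mathbb Z^r\}$, linear on $L^p(X)$ for every $p\in(p_0,2]$ and commuting with every $\mathcal H_s$ on $L^{p_1}(X)$, such that $\sum_{\bf g}\mathcal S_{\bf g}=\mathrm{Id}$ in the strong operator topology on $L^2(X)$ (along some sequence of finite sets exhausting $\mathbb Z^r$); $$\Big\|\Big(\sum_{{\bf g}\in\mathbb Z^r}|\mathcal S_{\bf g}f|^2\Big)^{1/2}\Big\|_{L^p}\lesssim_p\|f\|_{L^p},\qquad f\in L^p(X),\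 p\in(p_0,2];\tag{LP}$$ and, for some numbers $c_{\bf h}>0$, all ${\bf h}\in\mathbb Z^r$, all choices of $s_{\bf g}\in Q_{\bf g}$ and all $f\in L^2(X)$, $$\Big\|\Big(\sum_{{\bf g}\in\mathbb Z^r}|\mathcal H_{s_{\bf g}}\mathcal S_{{\bf g}+{\bf h}}f|^2\Big)^{1/2}\Big\|_{L^2}\le c_{\bf h}\|f\|_{L^2},\qquad\sum_{{\bf h}\in\mathbb Z^r}c_{\bf h}^{(\frac12-\varepsilon)\frac{p_1-p_0}{2-p_0}}<\infty.$$ * **(C5)** For every $K\subseteq[k]$ (including $K=\emptyset$), $p\in\{p_0,2\}$, ${\bf g}\in\mathbb Z^r$ and $h\in\mathbb R^k_+$ with $s,s+h\in Q_{\bf g}$, uniformly, $\ \|\Delta_h^K\mathcal H_s\|_{L^p\to L^p}\lesssim\prod_{i\in K}\frac{h_i}{s_i}$. *Conclusion.* For all $f\in L^{p_1}(X)$, $$\|V^2(\mathcal H_sf:s\in\mathbb R_+^k)\|_{L^{p_1}}\lesssim\|f\|_{L^{p_1}},\qquad\sup_{I}\|O^2_I(\mathcal H_sf:s\in\mathbb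 R_+^k)\|_{L^{p_1}}\lesssim\|f\|_{L^{p_1}},$$ where $I$ runs over all sequences $I_0\prec I_1\prec\cdots$ in $\mathbb R_+^k$, and the implicit constants depend only on $p_0,p_1,k,r,L,\varepsilon$, on the implicit constants of the hypotheses and on (an upper bound for) the sum of the powers of $c_{\bf h}$. *Dual part.* Suppose in addition that (C2) and (C3) hold with $p_1$ replaced by every $p\in[p_1,p_1']$ (with the same $Q_{\bf g}$, $s({\bf g})$), that (C1) and (C5) hold with the adjoint operators $\mathcal H_s^*$ in place of $\mathcal H_s$, and that (LP) also holds for $p\in[2,p_0')$, the $\mathcal S_{\bf g}$ being linear on these $L^p(X)$. Here $\mathcal H_s^*$ is linear on $L^{p_0}(X)+L^2(X)$, and $\mathcal H_s$ is understood to act linearly on $L^p(X)$ for $p\in[p_1,p_1']$ as the operator determined by $\int(\mathcal H_sf)\overline g\,d\mu=\int f\,\overline{\mathcal H_s^*g}\,d\mu$ for $g\in L^{p_1}(X)\cap L^{p_1'}(X)$. Then for every $p\in[p_1,p_1']$ both inequalities of the conclusion hold with $p_1$ replaced by $p$, the constant now depending also on $p$ and on the constants of the dual hypotheses. -/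

import Mathlib

open MeasureTheory Filter Topology
open scoped ENNReal NNReal ComplexConjugate

noncomputable section

namespace MultiparamVariation

/-! ### Index sets, differences, variations, oscillations -/

/-- The index set `ℝ₊ᵏ = (0, ∞)ᵏ`. -/
def posOrthant (k : ℕ) : Set (Fin k → ℝ) := {s | ∀ i, 0 < s i}

/-- The point `s + ∑_{i ∈ U} hᵢ eᵢ`. -/
def shiftOn {k : ℕ} (U : Finset (Fin k)) (h s : Fin k → ℝ) : Fin k → ℝ :=
  fun i => if i ∈ U then s i + h i else s i

/-- The multiparameter difference `Δ_h^K a_s`, written out by inclusion-exclusion. The lemmas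
`multiDiff_empty` and `multiDiff_insert` say that it is the composition of the one-parameter
differences `Δ_h^{j} a_s = a_{s + h_j e_j} - a_s` over `j ∈ K`. -/
def multiDiff {k : ℕ} (K : Finset (Fin k)) (h : Fin k → ℝ) (a : (Fin k → ℝ) → ℂ)
    (s : Fin k → ℝ) : ℂ :=
  ∑ U ∈ K.powerset, (-1 : ℂ) ^ (K.card - U.card) * a (shiftOn U h s)

theorem multiDiff_empty {k : ℕ} (h : Fin k → ℝ) (a : (Fin k → ℝ) → ℂ) (s : Fin k → ℝ) :
    multiDiff ∅ h a s = a s := by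
  have hs : shiftOn ∅ h s = s := by
    funext i
    simp [shiftOn]
  simp [multiDiff, hs]

theorem multiDiff_insert {k : ℕ} (K : Finset (Fin k)) (j : Fin k) (hj : j ∉ K) (h : Fin k → ℝ)
    (a : (Fin k → ℝ) → ℂ) (s : Fin k → ℝ) :
    multiDiff (insert j K) h a s =
      multiDiff K h a (Function.update s j (s j + h j)) - multiDiff K h a s := by
  unfold multiDiff
  rw [Finset.sum_powerset_insert hj, add_comm, sub_eq_add_neg, ← Finset.sum_neg_distrib]
  congr 1
  · refine Finset.sum_congr rfl fun U hU => ?_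
    have hUK := Finset.mem_powerset.mp hU
    have hjU : j ∉ U := fun hh => hj (hUK hh)
    rw [Finset.card_insert_of_notMem hj, Finset.card_insert_of_notMem hjU, Nat.add_sub_add_right]
    congr 2
    funext i
    by_cases hij : i = j
    · subst hij; simp [shiftOn, hjU]
    · simp [shiftOn, hij]
  · refine Finset.sum_congr rfl fun U hU => ?_
    have hUK := Finset.mem_powerset.mp hU
    have hc := Finset.card_le_card hUK
    rw [Finset.card_insert_of_notMem hj, Nat.sub_add_comm hc, pow_succ]
    ring

/-- The `m`-parameter `ρ`-variation `V^ρ(a_s : s ∈ 𝕀)`: the supremum over all finite sequences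
`I_0 ≺ I_1 ≺ ⋯ ≺ I_J` in `𝕀`, where `s ≺ t` (`StrongLT`) means `s_i < t_i` for every `i`.
It is used for index sets in `ℝ^k` and in `ℤ^r`. Only the terms `I 0, …, I J` matter. -/
def variation {m : ℕ} {R : Type*} [LT R] (ρ : ℝ) (𝕀 : Set (Fin m → R)) (a : (Fin m → R) → ℂ) :
    ℝ≥0∞ :=
  ⨆ (J : ℕ) (I : ℕ → Fin m → R) (_ : ∀ j ≤ J, I j ∈ 𝕀) (_ : ∀ j < J, StrongLT (I j) (I (j + 1))),
    (∑ j ∈ Finset.range J, ‖a (I (j + 1)) - a (I j)‖ₑ ^ ρ) ^ (1 / ρ)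

/-- The `k`-parameter `ρ`-oscillation `O_I^ρ(a_s : s ∈ 𝕁)` along the sequence `I`. The `j`-th
summand is the supremum over the box `∏_i [I_{j,i}, I_{j+1,i})`, intersected with `𝕁`. -/
def multiOscillation {k : ℕ} (ρ : ℝ) (I : ℕ → Fin k → ℝ) (𝕁 : Set (Fin k → ℝ))
    (a : (Fin k → ℝ) → ℂ) : ℝ≥0∞ :=
  (∑' j : ℕ, ⨆ s ∈ {s | I j ≤ s ∧ StrongLT s (I (j + 1))} ∩ 𝕁, ‖a s - a (I j)‖ₑ ^ ρ) ^ (1 / ρ)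

section Operators

variable {X : Type*} [MeasurableSpace X]

/-- The `L^p` norm of a `[0, ∞]`-valued function, taken as the infimum of the norms of its
measurable a.e. majorants. For a measurable function it is the usual norm; it spares measurability
assumptions on suprema over uncountable families. -/
def outerLpNorm (F : X → ℝ≥0∞) (p : ℝ≥0∞) (μ : Measure X) : ℝ≥0∞ :=
  ⨅ (G : X → ℝ≥0∞) (_ : Measurable G) (_ : F ≤ᵐ[μ] G), eLpNorm G p μ

/-- The square function `(∑_v |F_v|²)^{1/2}`. -/
def squareFn {ι : Type*} (F : ι → X → ℂ) (x : X) : ℝ≥0∞ :=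
  (∑' v, ‖F v x‖ₑ ^ (2 : ℝ)) ^ (1 / 2 : ℝ)

/-- The functions of class `L^p(X)`. -/
def LpFun (p : ℝ≥0∞) (μ : Measure X) : Set (X → ℂ) := {f | MemLp f p μ}

/-- The functions of class `L^p(X) + L^q(X)`. -/
def SumLpFun (p q : ℝ≥0∞) (μ : Measure X) : Set (X → ℂ) :=
  {f | ∃ f₁ f₂, MemLp f₁ p μ ∧ MemLp f₂ q μ ∧ f = f₁ + f₂}

/-- `T` is a linear operator, defined on the functions in `D`, with values in the measurable
functions. As usual, functions are identified when they agree almost everywhere; `T f` is one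
representative of the class, so that `T f x` makes sense. -/
structure IsLinearOperator (D : Set (X → ℂ)) (μ : Measure X) (T : (X → ℂ) → X → ℂ) : Prop where
  aestronglyMeasurable : ∀ f ∈ D, AEStronglyMeasurable (T f) μ
  congr : ∀ f ∈ D, ∀ g ∈ D, f =ᵐ[μ] g → T f =ᵐ[μ] T g
  add : ∀ f ∈ D, ∀ g ∈ D, T (f + g) =ᵐ[μ] T f + T g
  smul : ∀ (z : ℂ), ∀ f ∈ D, T (z • f) =ᵐ[μ] z • T f

variable {k r : ℕ}

/-- `G` is (a representative of) the maximal function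
`H_* f = sup_{s ∈ ℝ₊ᵏ} sup_{|g| ≤ |f|} |H_s g|`, the supremum of this family of a.e. classes being
taken in the lattice of measurable functions modulo null sets (the essential supremum). -/
structure IsMaximalFunction (μ : Measure X) (H : (Fin k → ℝ) → (X → ℂ) → X → ℂ) (f : X → ℂ)
    (G : X → ℝ≥0∞) : Prop where
  aemeasurable : AEMeasurable G μ
  le : ∀ s ∈ posOrthant k, ∀ g : X → ℂ, AEStronglyMeasurable g μ → (∀ᵐ x ∂μ, ‖g x‖ ≤ ‖f x‖) →
    ∀ᵐ x ∂μ, ‖H s g x‖ₑ ≤ G x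
  least : ∀ G' : X → ℝ≥0∞, AEMeasurable G' μ →
    (∀ s ∈ posOrthant k, ∀ g : X → ℂ, AEStronglyMeasurable g μ → (∀ᵐ x ∂μ, ‖g x‖ ≤ ‖f x‖) →
      ∀ᵐ x ∂μ, ‖H s g x‖ₑ ≤ G' x) → G ≤ᵐ[μ] G'

/-- Maximal estimate: `H_*` is bounded on `L^p` with constant `A`. -/
def MaximalEstimate (μ : Measure X) (H : (Fin k → ℝ) → (X → ℂ) → X → ℂ) (p : ℝ≥0∞)
    (A : ℝ≥0) : Prop :=
  ∀ f, MemLp f p μ → ∃ G, IsMaximalFunction μ H f G ∧ eLpNorm G p μ ≤ A * eLpNorm f p μ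

/-- The cube `{s : left ⪯ s ⪯ (1 + 2^L) ⊙ left}`. -/
def cube (L : ℕ) (left : Fin k → ℝ) : Set (Fin k → ℝ) := Set.Icc left ((1 + 2 ^ L : ℝ) • left)

/-- Splitting into long and short variations on `L^p`, with constant `A`, for the cubes with lower
left corners `left g` and the points `pt g`. -/
def SplittingEstimate (μ : Measure X) (H : (Fin k → ℝ) → (X → ℂ) → X → ℂ) (L : ℕ)
    (left pt : (Fin r → ℤ) → Fin k → ℝ) (p : ℝ≥0∞) (A : ℝ≥0) : Prop :=
  ∀ f, MemLp f p μ →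
    outerLpNorm (fun x => variation 2 (posOrthant k) fun s => H s f x) p μ ≤
      A * (outerLpNorm (fun x => variation 2 Set.univ fun g => H (pt g) f x) p μ +
        outerLpNorm (fun x =>
          (∑' g, (variation 2 (cube L (left g)) fun s => H s f x) ^ (2 : ℝ)) ^ (1 / 2 : ℝ)) p μ)

/-- Continuity on the cubes, for functions in `L^p`. -/
def ContinuityCondition (μ : Measure X) (H : (Fin k → ℝ) → (X → ℂ) → X → ℂ) (L : ℕ)
    (left : (Fin r → ℤ) → Fin k → ℝ) (p : ℝ≥0∞) : Prop :=
  ∀ f, MemLp f p μ → ∀ g, ∀ᵐ x ∂μ, ContinuousOn (fun s => H s f x) (cube L (left g))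

/-- The operators `S_g` are linear on `L^p` and satisfy the Littlewood-Paley inequality there. -/
structure LittlewoodPaleyEstimate (μ : Measure X) (S : (Fin r → ℤ) → (X → ℂ) → X → ℂ)
    (p : ℝ≥0∞) (A : ℝ≥0) : Prop where
  linear : ∀ g, IsLinearOperator (LpFun p μ) μ (S g)
  bound : ∀ f, MemLp f p μ → eLpNorm (squareFn fun g => S g f) p μ ≤ A * eLpNorm f p μ

/-- Littlewood-Paley decomposition. -/
structure LittlewoodPaley (μ : Measure X) (H : (Fin k → ℝ) → (X → ℂ) → X → ℂ)
    (S : (Fin r → ℤ) → (X → ℂ) → X → ℂ) (L : ℕ) (left : (Fin r → ℤ) → Fin k → ℝ)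
    (c : (Fin r → ℤ) → ℝ) (p₀ p₁ : ℝ≥0∞) (ε : ℝ) (A : ℝ≥0∞ → ℝ≥0) (B : ℝ≥0) : Prop where
  /-- `S_g` is linear on `L^p`, with the Littlewood-Paley inequality, for every `p ∈ (p₀, 2]`. -/
  square : ∀ p ∈ Set.Ioc p₀ 2, LittlewoodPaleyEstimate μ S p (A p)
  /-- `S_g` commutes with `H_s`. -/
  comm : ∀ g, ∀ s ∈ posOrthant k, ∀ f, MemLp f p₁ μ → S g (H s f) =ᵐ[μ] H s (S g f)
  /-- `∑_g S_g = Id` in the strong operator topology on `L²`, the sum being taken along some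
  sequence of finite sets that exhausts `ℤ^r`. -/
  resolution : ∃ E : ℕ → Finset (Fin r → ℤ), Tendsto E atTop atTop ∧
    ∀ f, MemLp f 2 μ →
      Tendsto (fun n => eLpNorm (fun x => ∑ g ∈ E n, S g f x - f x) 2 μ) atTop (𝓝 0)
  /-- Off-diagonal square function estimate. -/
  offDiag : ∀ (h : Fin r → ℤ) (t : (Fin r → ℤ) → Fin k → ℝ), (∀ g, t g ∈ cube L (left g)) →
    ∀ f, MemLp f 2 μ →
      eLpNorm (squareFn fun g => H (t g) (S (g + h) f)) 2 μ ≤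
        ENNReal.ofReal (c h) * eLpNorm f 2 μ
  pos : ∀ h, 0 < c h
  summable : ∑' h, ENNReal.ofReal
    (c h ^ ((1 / 2 - ε) * ((p₁.toReal - p₀.toReal) / (2 - p₀.toReal)))) ≤ B

/-- Cancellation condition on `L^p`, with constant `A`. -/
def CancellationCondition (μ : Measure X) (H : (Fin k → ℝ) → (X → ℂ) → X → ℂ) (L : ℕ)
    (left : (Fin r → ℤ) → Fin k → ℝ) (p : ℝ≥0∞) (A : ℝ≥0) : Prop :=
  ∀ (K : Finset (Fin k)) (g : Fin r → ℤ) (s h : Fin k → ℝ), h ∈ posOrthant k →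
    s ∈ cube L (left g) → s + h ∈ cube L (left g) → ∀ f, MemLp f p μ →
      eLpNorm (fun x => multiDiff K h (fun u => H u f x) s) p μ ≤
        A * ENNReal.ofReal (∏ i ∈ K, h i / s i) * eLpNorm f p μ

/-- The hypotheses of the theorem. -/
structure Hypotheses (μ : Measure X) (H : (Fin k → ℝ) → (X → ℂ) → X → ℂ)
    (S : (Fin r → ℤ) → (X → ℂ) → X → ℂ) (L : ℕ) (left pt : (Fin r → ℤ) → Fin k → ℝ)
    (c : (Fin r → ℤ) → ℝ) (p₀ p₁ : ℝ≥0∞) (ε : ℝ) (A₁ A₅ B : ℝ≥0) (A₂ A₄ : ℝ≥0∞ → ℝ≥0) :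
    Prop where
  linear : ∀ s ∈ posOrthant k, IsLinearOperator (SumLpFun p₀ 2 μ) μ (H s)
  maximal : MaximalEstimate μ H p₁ A₁
  left_pos : ∀ g, left g ∈ posOrthant k
  pt_mem : ∀ g, pt g ∈ cube L (left g)
  splitting : SplittingEstimate μ H L left pt p₁ (A₂ p₁)
  continuity : ContinuityCondition μ H L left p₁
  littlewoodPaley : LittlewoodPaley μ H S L left c p₀ p₁ ε A₄ B
  cancellation : ∀ p, p = p₀ ∨ p = 2 → CancellationCondition μ H L left p A₅

/-- The dual hypotheses; `H'` is the family of the adjoint operators `H_s^*`.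
The fields `extension` and `adjoint` fix the meaning of `H_s f` for `f ∈ L^p`, `p ∈ [p₁, p₁']`, and
of `H_s^*`: the operator `H_s` acts on these spaces and
`∫ (H_s f) ḡ = ∫ f (conj (H_s^* g))` for `f ∈ L^p` and `g ∈ L^{p₁} ∩ L^{p₁'}`. -/
structure DualHypotheses (μ : Measure X) (H H' : (Fin k → ℝ) → (X → ℂ) → X → ℂ)
    (S : (Fin r → ℤ) → (X → ℂ) → X → ℂ) (L : ℕ) (left pt : (Fin r → ℤ) → Fin k → ℝ)
    (p₀ p₁ : ℝ≥0∞) (A₁ A₅ : ℝ≥0) (A₂ A₄ : ℝ≥0∞ → ℝ≥0) : Prop where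
  extension : ∀ p ∈ Set.Icc p₁ p₁.conjExponent, ∀ s ∈ posOrthant k,
    IsLinearOperator (LpFun p μ) μ (H s) ∧ ∀ f, MemLp f p μ → MemLp (H s f) p μ
  linear_adjoint : ∀ s ∈ posOrthant k, IsLinearOperator (SumLpFun p₀ 2 μ) μ (H' s)
  adjoint : ∀ p ∈ Set.Icc p₁ p₁.conjExponent, ∀ s ∈ posOrthant k, ∀ f g : X → ℂ, MemLp f p μ →
    MemLp g p₁ μ → MemLp g p₁.conjExponent μ →
      ∫ x, H s f x * conj (g x) ∂μ = ∫ x, f x * conj (H' s g x) ∂μ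
  splitting : ∀ p ∈ Set.Icc p₁ p₁.conjExponent, SplittingEstimate μ H L left pt p (A₂ p)
  continuity : ∀ p ∈ Set.Icc p₁ p₁.conjExponent, ContinuityCondition μ H L left p
  maximal : MaximalEstimate μ H' p₁ A₁
  cancellation : ∀ p, p = p₀ ∨ p = 2 → CancellationCondition μ H' L left p A₅
  square : ∀ p ∈ Set.Ico 2 p₀.conjExponent, LittlewoodPaleyEstimate μ S p (A₄ p)

/-- The variation inequality and the oscillation inequality on `L^p`, with constant `C`. -/
structure VariationOscillationBound (μ : Measure X) (H : (Fin k → ℝ) → (X → ℂ) → X → ℂ)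
    (p : ℝ≥0∞) (C : ℝ≥0) : Prop where
  variation_le : ∀ f, MemLp f p μ →
    outerLpNorm (fun x => variation 2 (posOrthant k) fun s => H s f x) p μ ≤ C * eLpNorm f p μ
  oscillation_le : ∀ f, MemLp f p μ →
    ⨆ (I : ℕ → Fin k → ℝ) (_ : ∀ j, I j ∈ posOrthant k) (_ : ∀ j, StrongLT (I j) (I (j + 1))),
      outerLpNorm (fun x => multiOscillation 2 I (posOrthant k) fun s => H s f x) p μ ≤
        C * eLpNorm f p μ

end Operators

end MultiparamVariation

end

open MultiparamVariation

/-!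
The oscillation is at most three times the variation (`multiOscillation_le_variation`), so the
splitting estimate reduces both inequalities to a long variation along the points `pt g` and to
short variations over the cubes. The long variation is at most twice the square function of the
`H_{pt g} f` (`variation_univ_le`). On a cube, `H_s f` is continuous in `s` and hence the sum of its
mixed dyadic block increments over the scales `n ∈ ℕᵏ`; a scale has `∏ᵢ 2^{nᵢ}` blocks, and along a
chain each of them enters at most two nonzero differences, so that the short variation is dominated
by the square functions of the block increments, summed over `n` (`variation_cube_le`). By the
cancellation condition the increments of one scale, and likewise the `H_{pt g}` taken as a single
block, form a *block family*: combinations `∑ᵤ σᵤ H_{tᵤ}` with norm at most `A / N` on `L^{p₀}` and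
on `L²`, where `N` is the number of blocks (`IsBlockFamily`). It is therefore enough to bound the
square function of a block family on `L^p` by a constant times `N^{-η}`, `η > 0`
(`HasBlockDecay`); the sum over the scales is then a geometric series
(`HasBlockDecay.variationOscillationBound`).

For this decay, `f` is resolved as `∑ₕ S_{g+h} f` under the operators of index `g`.
* On `L²` the piece of index `h` has norm at most a constant times `c_h`, times `N^{1/2}`, by the
  off-diagonal estimate, and at most a constant times `N^{-1}`, times `N^{1/2}`, by the size of the
  operators. A geometric mean decays in `h` and in `N` simultaneously (`eLpNorm_two_comb_le`).
* On some `L^q` with `p₀ < q ≤ 2` all pieces are bounded uniformly. Complex interpolation between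
  the diagonal bound on `L^{p₀}(ℓ^{p₀})` and the maximal inequality, which is a bound on
  `L^{p₁}(ℓ^∞)`, gives a bound on `L^q(ℓ²)` (`eLpNorm_applyVec_le_of_maximal`), and the
  Littlewood–Paley inequality on `L^q` controls the input.
* Interpolation between the two (`eLpNorm_toVec_le_tsum`) leaves the factor
  `c_h^{(1/2 - ε) θ}` with `θ ≥ (p₁ - p₀) / (2 - p₀)`, which is summable over `h`, and `N^{-ε θ}`.

This proves the decay on `L² ∩ L^p` for `p₁ ≤ p ≤ 2`, and the maximal inequality extends it to `L^p`
(`hasBlockDecay_of_le_two`). For `2 ≤ p ≤ p₁'` the scheme is the same with `q'` in place of `q`: the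
vector-valued bound is proved for the adjoint operators on `L^q(ℓ²)`, one block at a time, and
dualized by the converse of Hölder's inequality (`eLpNorm_le_of_enorm_pairing_le`). The sum over the
blocks costs `N^{1/2}`, and the interpolated bound of a single block is smaller by `N^{-p₀/2}`
(`hasBlockDecay_of_two_le`).
-/

noncomputable section

namespace MultiparamVariation

/-! ### Variation and oscillation -/

theorem enorm_sub_sq_le (a b : ℂ) :
    ‖a - b‖ₑ ^ (2 : ℝ) ≤ 2 * ‖a‖ₑ ^ (2 : ℝ) + 2 * ‖b‖ₑ ^ (2 : ℝ) := by
  calc ‖a - b‖ₑ ^ (2 : ℝ) ≤ (‖a‖ₑ + ‖b‖ₑ) ^ (2 : ℝ) := by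
        gcongr; exact enorm_sub_le
    _ ≤ (2 : ℝ≥0∞) ^ ((2 : ℝ) - 1) * (‖a‖ₑ ^ (2 : ℝ) + ‖b‖ₑ ^ (2 : ℝ)) :=
        ENNReal.rpow_add_le_mul_rpow_add_rpow _ _ (by norm_num)
    _ = _ := by
        rw [show (2 : ℝ) - 1 = 1 by norm_num, ENNReal.rpow_one, mul_add]

/-- Along a monotone chain the values of `G` are met in consecutive runs, so that every value
enters at most two of the nonzero increments. -/
theorem sum_enorm_sub_sq_le_tsum {Q : Type*} [PartialOrder Q] (G : Q → ℂ) (y : ℕ → Q) (J : ℕ)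
    (hy : ∀ j < J, y j ≤ y (j + 1)) :
    ∑ j ∈ Finset.range J, ‖G (y (j + 1)) - G (y j)‖ₑ ^ (2 : ℝ) ≤ 4 * ∑' q, ‖G q‖ₑ ^ (2 : ℝ) := by
  classical
  set S := (Finset.range J).filter fun j => y j ≠ y (j + 1) with hS
  have hmono : ∀ i j, i ≤ j → j ≤ J → y i ≤ y j := by
    intro i j hij
    induction j, hij using Nat.le_induction with
    | base => exact fun _ => le_rfl
    | succ n hn ih => exact fun h => (ih (by omega)).trans (hy n (by omega))
  have hlt : ∀ i ∈ S, y i < y (i + 1) := by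
    intro i hi
    rw [hS, Finset.mem_filter, Finset.mem_range] at hi
    exact lt_of_le_of_ne (hy i hi.1) hi.2
  have hSJ : ∀ i ∈ S, i < J := fun i hi => by
    rw [hS, Finset.mem_filter, Finset.mem_range] at hi
    exact hi.1
  have hinj : Set.InjOn y S := by
    intro i hi j hj hij
    by_contra hne
    rcases lt_or_gt_of_ne hne with h | h
    · exact absurd hij ((hlt i hi).trans_le (hmono _ _ h (hSJ j hj).le)).ne
    · exact absurd hij ((hlt j hj).trans_le (hmono _ _ h (hSJ i hi).le)).ne'
  have hinj' : Set.InjOn (fun j => y (j + 1)) S := by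
    intro i hi j hj hij
    by_contra hne
    rcases lt_or_gt_of_ne hne with h | h
    · exact absurd hij ((hmono _ _ h (hSJ j hj).le).trans_lt (hlt j hj)).ne
    · exact absurd hij ((hmono _ _ h (hSJ i hi).le).trans_lt (hlt i hi)).ne'
  have h1 : ∀ z : ℕ → Q, Set.InjOn z S →
      ∑ j ∈ S, ‖G (z j)‖ₑ ^ (2 : ℝ) ≤ ∑' q, ‖G q‖ₑ ^ (2 : ℝ) := by
    intro z hz
    rw [← Finset.sum_image (f := fun q => ‖G q‖ₑ ^ (2 : ℝ)) hz]
    exact ENNReal.sum_le_tsum _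
  calc ∑ j ∈ Finset.range J, ‖G (y (j + 1)) - G (y j)‖ₑ ^ (2 : ℝ)
      = ∑ j ∈ S, ‖G (y (j + 1)) - G (y j)‖ₑ ^ (2 : ℝ) := by
        symm
        refine Finset.sum_subset (Finset.filter_subset _ _) fun j hj hjS => ?_
        have : y j = y (j + 1) := by
          by_contra h
          exact hjS (Finset.mem_filter.2 ⟨hj, h⟩)
        rw [← this]
        simp
    _ ≤ ∑ j ∈ S, (2 * ‖G (y (j + 1))‖ₑ ^ (2 : ℝ) + 2 * ‖G (y j)‖ₑ ^ (2 : ℝ)) :=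
        Finset.sum_le_sum fun j _ => enorm_sub_sq_le _ _
    _ = 2 * ∑ j ∈ S, ‖G (y (j + 1))‖ₑ ^ (2 : ℝ) + 2 * ∑ j ∈ S, ‖G (y j)‖ₑ ^ (2 : ℝ) := by
        rw [Finset.sum_add_distrib, Finset.mul_sum, Finset.mul_sum]
    _ ≤ 2 * ∑' q, ‖G q‖ₑ ^ (2 : ℝ) + 2 * ∑' q, ‖G q‖ₑ ^ (2 : ℝ) := by
        gcongr
        · exact h1 _ hinj'
        · exact h1 _ hinj
    _ = 4 * ∑' q, ‖G q‖ₑ ^ (2 : ℝ) := by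
        rw [← add_mul]; norm_num

theorem four_rpow_half : (4 : ℝ≥0∞) ^ (1 / 2 : ℝ) = 2 := by
  rw [show (4 : ℝ≥0∞) = 2 ^ (2 : ℝ) by norm_num, ← ENNReal.rpow_mul]
  norm_num

/-- The variation over `ℤ^r` is dominated by the square function. -/
theorem variation_univ_le {r : ℕ} (hr : 0 < r) (a : (Fin r → ℤ) → ℂ) :
    variation 2 Set.univ a ≤ 2 * (∑' g, ‖a g‖ₑ ^ (2 : ℝ)) ^ (1 / 2 : ℝ) := by
  have : Nonempty (Fin r) := ⟨⟨0, hr⟩⟩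
  refine iSup_le fun J => iSup_le fun I => iSup_le fun _ => iSup_le fun hI => ?_
  rw [← four_rpow_half, ← ENNReal.mul_rpow_of_nonneg _ _ (by norm_num : (0 : ℝ) ≤ 1 / 2)]
  refine ENNReal.rpow_le_rpow ?_ (by norm_num)
  exact sum_enorm_sub_sq_le_tsum a I J fun j hj => (hI j hj).le

/-- A bound of the sums for all choices of points is a bound of the sum of the suprema. -/
theorem sum_iSup_le_of_forall {ι : Type*} {β : ι → Type*} [∀ j, Nonempty (β j)]
    (f : ∀ j, β j → ℝ≥0∞) (S : Finset ι) (M : ℝ≥0∞)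
    (h : ∀ s : ∀ j, β j, ∑ j ∈ S, f j (s j) ≤ M) : ∑ j ∈ S, ⨆ s, f j s ≤ M := by
  classical
  suffices H : ∀ c, (∀ s : ∀ j, β j, c + ∑ j ∈ S, f j (s j) ≤ M) →
      c + ∑ j ∈ S, ⨆ s, f j s ≤ M by
    simpa using H 0 (by simpa using h)
  clear h
  induction S using Finset.induction_on with
  | empty => intro c h; simpa using h fun j => Classical.arbitrary _
  | insert j S hj ih =>
    intro c h
    rw [Finset.sum_insert hj, ← add_assoc, ENNReal.add_iSup, ENNReal.iSup_add]
    refine iSup_le fun t => ih _ fun s => ?_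
    have := h (Function.update s j t)
    rw [Finset.sum_insert hj, Function.update_self, ← add_assoc] at this
    convert this using 2
    refine Finset.sum_congr rfl fun i hi => ?_
    rw [Function.update_of_ne]
    rintro rfl
    exact hj hi

theorem sum_sq_le_variation_sq {k : ℕ} (𝕀 : Set (Fin k → ℝ)) (a : (Fin k → ℝ) → ℂ)
    (I : ℕ → Fin k → ℝ) (hI : ∀ j, I j ∈ 𝕀) (hI' : ∀ j, StrongLT (I j) (I (j + 1))) (n : ℕ) :
    ∑ j ∈ Finset.range n, ‖a (I (j + 1)) - a (I j)‖ₑ ^ (2 : ℝ) ≤ variation 2 𝕀 a ^ (2 : ℝ) := by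
  have h : (∑ j ∈ Finset.range n, ‖a (I (j + 1)) - a (I j)‖ₑ ^ (2 : ℝ)) ^ (1 / 2 : ℝ)
      ≤ variation 2 𝕀 a :=
    le_iSup_of_le n <| le_iSup_of_le I <| le_iSup_of_le (fun j _ => hI j) <|
      le_iSup_of_le (fun j _ => hI' j) le_rfl
  calc _ = ((∑ j ∈ Finset.range n, ‖a (I (j + 1)) - a (I j)‖ₑ ^ (2 : ℝ)) ^ (1 / 2 : ℝ)) ^ (2 : ℝ) := by
        rw [← ENNReal.rpow_mul]; norm_num
    _ ≤ _ := ENNReal.rpow_le_rpow h (by norm_num)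

/-- The oscillation is dominated by the variation. A point `s` of the `j`-th box need not satisfy
`I j ≺ s`, but it satisfies `s ≺ I (j + 1)`, and the points `s` of the boxes of a fixed parity form,
together with the right endpoints of these boxes, one chain. -/
theorem multiOscillation_le_variation {k : ℕ} (I : ℕ → Fin k → ℝ)
    (hI : ∀ j, I j ∈ posOrthant k) (hI' : ∀ j, StrongLT (I j) (I (j + 1)))
    (a : (Fin k → ℝ) → ℂ) :
    multiOscillation 2 I (posOrthant k) a ≤ 3 * variation 2 (posOrthant k) a := by
  set V := variation 2 (posOrthant k) a with hV
  let box : ℕ → Set (Fin k → ℝ) := fun j => {s | I j ≤ s ∧ StrongLT s (I (j + 1))} ∩ posOrthant k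
  have hne : ∀ j, Nonempty (box j) := fun j => ⟨⟨I j, ⟨le_rfl, hI' j⟩, hI j⟩⟩
  have key : ∀ s : ∀ j, box j, ∀ n, ∀ e : ℕ,
      ∑ j ∈ (Finset.range n).filter (fun j => j % 2 = e),
        ‖a (s j) - a (I (j + 1))‖ₑ ^ (2 : ℝ) ≤ V ^ (2 : ℝ) := by
    intro s n e
    let Z : ℕ → Fin k → ℝ := fun j => if j % 2 = e then s j else I j
    have hZ : ∀ j, Z j ∈ posOrthant k := by
      intro j
      by_cases h : j % 2 = e
      · simpa only [Z, h, if_true] using (s j).2.2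
      · simpa only [Z, h, if_false] using hI j
    have hsI : ∀ j i, I j i ≤ (s j : Fin k → ℝ) i := fun j => (s j).2.1.1
    have hZ' : ∀ j, StrongLT (Z j) (Z (j + 1)) := by
      intro j i
      have h1 := hI' j i
      have h2 := (s j).2.1.2 i
      have h3 := hsI (j + 1) i
      by_cases h : j % 2 = e
      · have h' : ¬ (j + 1) % 2 = e := by omega
        simpa only [Z, h, h', if_true, if_false] using h2
      · by_cases h' : (j + 1) % 2 = e
        · simp only [Z, h, h', if_true, if_false]
          exact h1.trans_le h3
        · simpa only [Z, h, h', if_false] using h1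
    refine le_trans ?_ (sum_sq_le_variation_sq (posOrthant k) a Z hZ hZ' n)
    refine le_trans (le_of_eq ?_)
      (Finset.sum_le_sum_of_subset (Finset.filter_subset (fun j : ℕ => j % 2 = e) _))
    refine Finset.sum_congr rfl fun j hj => ?_
    have h : j % 2 = e := (Finset.mem_filter.1 hj).2
    have h' : ¬ (j + 1) % 2 = e := by omega
    simp only [Z, h, h', if_true, if_false]
    rw [← enorm_neg]
    simp
  have key2 : ∀ n, ∑ j ∈ Finset.range n, ⨆ s : box j, ‖a s - a (I (j + 1))‖ₑ ^ (2 : ℝ)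
      ≤ 2 * V ^ (2 : ℝ) := by
    intro n
    refine sum_iSup_le_of_forall (fun j (s : box j) => ‖a s - a (I (j + 1))‖ₑ ^ (2 : ℝ)) _ _ ?_
    intro s
    rw [two_mul]
    have := add_le_add (key s n 0) (key s n 1)
    refine le_trans (le_of_eq ?_) this
    rw [← Finset.sum_filter_add_sum_filter_not (Finset.range n) (fun j : ℕ => j % 2 = 0)]
    congr 1
    refine Finset.sum_congr ?_ fun _ _ => rfl
    ext j
    simp
  have hterm : ∀ j, (⨆ s ∈ box j, ‖a s - a (I j)‖ₑ ^ (2 : ℝ)) ≤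
      2 * (⨆ s : box j, ‖a s - a (I (j + 1))‖ₑ ^ (2 : ℝ)) +
        2 * ‖a (I (j + 1)) - a (I j)‖ₑ ^ (2 : ℝ) := by
    intro j
    refine iSup_le fun s => iSup_le fun hs => ?_
    have h0 := enorm_sub_sq_le (a s - a (I (j + 1))) (a (I j) - a (I (j + 1)))
    rw [sub_sub_sub_cancel_right] at h0
    refine h0.trans ?_
    have h1 : ‖a (I j) - a (I (j + 1))‖ₑ = ‖a (I (j + 1)) - a (I j)‖ₑ := by
      rw [← enorm_neg]; simp
    rw [h1]
    gcongr
    exact le_iSup (fun s : box j => ‖a s - a (I (j + 1))‖ₑ ^ (2 : ℝ)) ⟨s, hs⟩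
  have hsum : ∑' j, (⨆ s ∈ box j, ‖a s - a (I j)‖ₑ ^ (2 : ℝ)) ≤ (3 * V) ^ (2 : ℝ) := by
    refine ENNReal.tsum_le_of_sum_range_le fun n => ?_
    calc ∑ j ∈ Finset.range n, (⨆ s ∈ box j, ‖a s - a (I j)‖ₑ ^ (2 : ℝ))
        ≤ ∑ j ∈ Finset.range n, (2 * (⨆ s : box j, ‖a s - a (I (j + 1))‖ₑ ^ (2 : ℝ)) +
        2 * ‖a (I (j + 1)) - a (I j)‖ₑ ^ (2 : ℝ)) := Finset.sum_le_sum fun j _ => hterm j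
      _ ≤ 2 * (2 * V ^ (2 : ℝ)) + 2 * V ^ (2 : ℝ) := by
        rw [Finset.sum_add_distrib, ← Finset.mul_sum, ← Finset.mul_sum]
        gcongr
        · exact key2 n
        · exact sum_sq_le_variation_sq (posOrthant k) a I hI hI' n
      _ = 6 * V ^ (2 : ℝ) := by ring
      _ ≤ 9 * V ^ (2 : ℝ) := by gcongr; norm_num
      _ = (3 * V) ^ (2 : ℝ) := by
        rw [ENNReal.mul_rpow_of_nonneg _ _ (by norm_num)]
        norm_num
  calc _ ≤ ((3 * V) ^ (2 : ℝ)) ^ (1 / 2 : ℝ) := ENNReal.rpow_le_rpow hsum (by norm_num)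
    _ = 3 * V := by rw [← ENNReal.rpow_mul]; norm_num

/-- Minkowski's inequality in `ℓ²` for finitely many summands. -/
theorem Lp_finsetSum_le {ι κ : Type*} (s : Finset ι) (t : Finset κ) (x : ι → κ → ℝ≥0∞) :
    (∑ j ∈ t, (∑ n ∈ s, x n j) ^ (2 : ℝ)) ^ (1 / 2 : ℝ) ≤
      ∑ n ∈ s, (∑ j ∈ t, x n j ^ (2 : ℝ)) ^ (1 / 2 : ℝ) := by
  classical
  induction s using Finset.induction_on with
  | empty => simp
  | insert n s hn ih =>
    simp only [Finset.sum_insert hn]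
    exact (ENNReal.Lp_add_le t _ _ (by norm_num)).trans (by gcongr)

/-! ### Dyadic decomposition on a cube -/

/-- Telescoping in `ℕᵏ`: the mixed backward differences of `b` over the box `[0, N]ᵏ` add up to the
value of `b` at the upper corner. -/
theorem sum_piFinset_mixed_diff {k : ℕ} (b : (Fin k → ℕ) → ℂ) (N : ℕ) :
    ∑ n ∈ Fintype.piFinset (fun _ : Fin k => Finset.range (N + 1)),
      ∑ U ∈ (Finset.univ.filter fun i => n i ≠ 0).powerset,
        (-1 : ℂ) ^ ((Finset.univ.filter fun i => n i ≠ 0).card - U.card) *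
          b (fun i => if n i ≠ 0 ∧ i ∉ U then n i - 1 else n i) = b fun _ => N := by
  set box := Fintype.piFinset (fun _ : Fin k => Finset.range (N + 1)) with hbox
  let δ : ℕ → ℕ → ℂ := fun n m => if n = m then 1 else 0
  let d : ℕ → ℕ → ℂ := fun n m => if n = 0 then δ n m else δ n m - δ (n - 1) m
  have hb : ∀ n ∈ box, b n = ∑ m ∈ box, b m * ∏ i, δ (n i) (m i) := by
    intro n hn
    rw [Finset.sum_eq_single n]
    · simp [δ]
    · intro m _ hmn
      obtain ⟨i, hi⟩ := Function.ne_iff.1 hmn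
      rw [Finset.prod_eq_zero (Finset.mem_univ i), mul_zero]
      simp [δ, Ne.symm hi]
    · exact fun h => absurd hn h
  have hd : ∀ m N, ∑ n ∈ Finset.range (N + 1), d n m = δ N m := by
    intro m N
    induction N with
    | zero => simp [d]
    | succ N ih =>
      rw [Finset.sum_range_succ, ih]
      simp [d]
  -- The mixed difference of a product of point masses is the product of their differences.
  have hprod : ∀ n m : Fin k → ℕ,
      ∑ U ∈ (Finset.univ.filter fun i => n i ≠ 0).powerset,
        (-1 : ℂ) ^ ((Finset.univ.filter fun i => n i ≠ 0).card - U.card) *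
          ∏ i, δ (if n i ≠ 0 ∧ i ∉ U then n i - 1 else n i) (m i) = ∏ i, d (n i) (m i) := by
    intro n m
    set K := Finset.univ.filter fun i => n i ≠ 0 with hK
    have hmem : ∀ i, i ∈ K ↔ n i ≠ 0 := fun i => by simp [hK]
    have h1 : ∏ i, d (n i) (m i) =
        (∏ i ∈ K, (δ (n i) (m i) + -δ (n i - 1) (m i))) * ∏ i ∈ Kᶜ, δ (n i) (m i) := by
      rw [← Finset.prod_mul_prod_compl K]
      congr 1
      · refine Finset.prod_congr rfl fun i hi => ?_
        simp only [d, if_neg ((hmem i).1 hi), sub_eq_add_neg]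
      · refine Finset.prod_congr rfl fun i hi => ?_
        have : n i = 0 := by
          by_contra h
          exact (Finset.mem_compl.1 hi) ((hmem i).2 h)
        simp only [d, if_pos this]
    rw [h1, Finset.prod_add, Finset.sum_mul]
    refine Finset.sum_congr rfl fun U hU => ?_
    have hUK := Finset.mem_powerset.1 hU
    rw [← Finset.prod_mul_prod_compl K, ← Finset.prod_sdiff hUK, ← Finset.card_sdiff_of_subset hUK,
      ← Finset.prod_const]
    have e1 : ∏ i ∈ U, δ (if n i ≠ 0 ∧ i ∉ U then n i - 1 else n i) (m i) =
        ∏ i ∈ U, δ (n i) (m i) :=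
      Finset.prod_congr rfl fun i hi => by simp [hi]
    have e2 : ∏ i ∈ K \ U, δ (if n i ≠ 0 ∧ i ∉ U then n i - 1 else n i) (m i) =
        ∏ i ∈ K \ U, δ (n i - 1) (m i) :=
      Finset.prod_congr rfl fun i hi => by
        have := Finset.mem_sdiff.1 hi
        simp [this.2, (hmem i).1 this.1]
    have e3 : ∏ i ∈ Kᶜ, δ (if n i ≠ 0 ∧ i ∉ U then n i - 1 else n i) (m i) =
        ∏ i ∈ Kᶜ, δ (n i) (m i) :=
      Finset.prod_congr rfl fun i hi => by
        have : ¬ n i ≠ 0 := fun h => (Finset.mem_compl.1 hi) ((hmem i).2 h)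
        simp [this]
    have e4 : ∏ i ∈ K \ U, -δ (n i - 1) (m i) =
        (∏ _i ∈ K \ U, (-1 : ℂ)) * ∏ i ∈ K \ U, δ (n i - 1) (m i) := by
      rw [← Finset.prod_mul_distrib]
      exact Finset.prod_congr rfl fun i _ => by ring
    rw [e1, e2, e3, e4]
    ring
  have hmem : ∀ n ∈ box, ∀ U : Finset (Fin k),
      (fun i => if n i ≠ 0 ∧ i ∉ U then n i - 1 else n i) ∈ box := by
    intro n hn U
    rw [hbox, Fintype.mem_piFinset] at hn ⊢
    intro i
    have := Finset.mem_range.1 (hn i)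
    rw [Finset.mem_range]
    split_ifs <;> omega
  calc _ = ∑ n ∈ box, ∑ m ∈ box, b m * ∏ i, d (n i) (m i) := by
        refine Finset.sum_congr rfl fun n hn => ?_
        simp_rw [← hprod n, Finset.mul_sum]
        rw [Finset.sum_comm]
        refine Finset.sum_congr rfl fun U _ => ?_
        rw [hb _ (hmem n hn U), Finset.mul_sum]
        exact Finset.sum_congr rfl fun m _ => by ring
    _ = ∑ m ∈ box, b m * ∏ i, δ N (m i) := by
        rw [Finset.sum_comm]
        refine Finset.sum_congr rfl fun m _ => ?_
        rw [← Finset.mul_sum, hbox,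
          Finset.sum_prod_piFinset (Finset.range (N + 1)) fun i n => d n (m i)]
        simp_rw [hd]
    _ = b fun _ => N := (hb (fun _ => N) (by simp [hbox, Fintype.mem_piFinset])).symm

section DyadicBlocks

variable {k : ℕ}

/-- The set of the coordinates in which a block of scale `n` is an increment. -/
def activeSet (n : Fin k → ℕ) : Finset (Fin k) := Finset.univ.filter fun i => n i ≠ 0

/-- The point with the coordinates `ℓᵢ (1 + 2^L qᵢ / 2^{nᵢ})` of the cube with corner `ℓ`. -/
def dyadicPoint (L : ℕ) (left : Fin k → ℝ) (n q : Fin k → ℕ) : Fin k → ℝ :=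
  fun i => left i * (1 + 2 ^ L * (q i / 2 ^ n i))

/-- The lower corner of the block of scale `n` with index `q`. -/
def blockBase (L : ℕ) (left : Fin k → ℝ) (n q : Fin k → ℕ) : Fin k → ℝ :=
  fun i => left i * (1 + 2 ^ L * (2 * (q i / 2 : ℕ) / 2 ^ n i))

/-- The side lengths of the block of scale `n` with index `q`. A length in an active coordinate is
zero when the index there is even: the approximations of the scales `nᵢ - 1` and `nᵢ` from below then
agree, and the increment vanishes. -/
def blockStep (L : ℕ) (left : Fin k → ℝ) (n q : Fin k → ℕ) : Fin k → ℝ :=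
  fun i => left i * 2 ^ L / 2 ^ n i * (if n i = 0 then 1 else (q i % 2 : ℕ))

/-- The block increment `Δ a` of scale `n` with index `q`. -/
def blockDiff (L : ℕ) (left : Fin k → ℝ) (n q : Fin k → ℕ) (a : (Fin k → ℝ) → ℂ) : ℂ :=
  multiDiff (activeSet n) (blockStep L left n q) a (blockBase L left n q)

/-- The index, at scale `n`, of the half-open dyadic interval `(q 2^{-n}, (q + 1) 2^{-n}]` that
contains the `i`-th coordinate of `t`, rescaled from the cube to `[0, 1]`; the left endpoint `0`
has index `0`. -/
def dyadicIndex (L : ℕ) (left t : Fin k → ℝ) (n : Fin k → ℕ) : Fin k → ℕ :=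
  fun i => ⌈2 ^ n i * ((t i - left i) / (2 ^ L * left i))⌉₊ - 1

theorem ceil_sub_one_div_two (x : ℝ) : (⌈2 * x⌉₊ - 1) / 2 = ⌈x⌉₊ - 1 := by
  have h1 : ⌈2 * x⌉₊ ≤ 2 * ⌈x⌉₊ := by
    rw [Nat.ceil_le]
    push_cast
    linarith [Nat.le_ceil x]
  have h2 : ⌈x⌉₊ ≤ (⌈2 * x⌉₊ + 1) / 2 := by
    rw [Nat.ceil_le]
    have h3 := Nat.le_ceil (2 * x)
    have h4 : ⌈2 * x⌉₊ ≤ 2 * ((⌈2 * x⌉₊ + 1) / 2) := by omega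
    have h5 : ((⌈2 * x⌉₊ : ℕ) : ℝ) ≤ 2 * (((⌈2 * x⌉₊ + 1) / 2 : ℕ) : ℝ) := by exact_mod_cast h4
    linarith
  omega

theorem dyadicIndex_half (L : ℕ) (left t : Fin k → ℝ) (n n' : Fin k → ℕ) (i : Fin k)
    (h : n i ≠ 0) (h' : n' i = n i - 1) :
    dyadicIndex L left t n' i = dyadicIndex L left t n i / 2 := by
  obtain ⟨j, hj⟩ := Nat.exists_eq_succ_of_ne_zero h
  unfold dyadicIndex
  rw [h', hj, Nat.succ_sub_one, Nat.succ_eq_add_one, pow_succ, mul_comm ((2 : ℝ) ^ j) 2, mul_assoc,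
    ceil_sub_one_div_two]

theorem rescaled_mem_Icc {L : ℕ} {left t : Fin k → ℝ} (hl : left ∈ posOrthant k)
    (ht : t ∈ cube L left) (i : Fin k) :
    (t i - left i) / (2 ^ L * left i) ∈ Set.Icc (0 : ℝ) 1 := by
  have h0 := hl i
  have h1 : left i ≤ t i := ht.1 i
  have h2 : t i ≤ (1 + 2 ^ L) * left i := ht.2 i
  refine ⟨div_nonneg (by linarith) (by positivity), ?_⟩
  rw [div_le_one (by positivity)]
  linarith

theorem dyadicIndex_lt {L : ℕ} {left t : Fin k → ℝ} (hl : left ∈ posOrthant k)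
    (ht : t ∈ cube L left) (n : Fin k → ℕ) (i : Fin k) : dyadicIndex L left t n i < 2 ^ n i := by
  have h := rescaled_mem_Icc hl ht i
  have h1 : ⌈(2 : ℝ) ^ n i * ((t i - left i) / (2 ^ L * left i))⌉₊ ≤ 2 ^ n i := by
    rw [Nat.ceil_le]
    push_cast
    exact mul_le_of_le_one_right (by positivity) h.2
  have : 0 < 2 ^ n i := by positivity
  unfold dyadicIndex
  omega

theorem dyadicIndex_mono {L : ℕ} {left t t' : Fin k → ℝ} (hl : left ∈ posOrthant k)
    (h : t ≤ t') (n : Fin k → ℕ) (i : Fin k) :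
    dyadicIndex L left t n i ≤ dyadicIndex L left t' n i := by
  have h0 := hl i
  have h1 := h i
  unfold dyadicIndex
  gcongr

theorem dyadicPoint_mem_cube {L : ℕ} {left : Fin k → ℝ} (hl : left ∈ posOrthant k)
    (n q : Fin k → ℕ) (hq : ∀ i, q i ≤ 2 ^ n i) : dyadicPoint L left n q ∈ cube L left := by
  have h1 : ∀ i, ((q i : ℝ) / 2 ^ n i) ≤ 1 := fun i => by
    rw [div_le_one (by positivity)]
    exact_mod_cast hq i
  refine ⟨fun i => ?_, fun i => ?_⟩
  · have := hl i
    have h2 : 0 ≤ left i * (2 ^ L * ((q i : ℝ) / 2 ^ n i)) := by positivity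
    simp only [dyadicPoint]
    linarith
  · have := hl i
    have h2 : left i * (2 ^ L * ((q i : ℝ) / 2 ^ n i)) ≤ left i * (2 ^ L * 1) := by
      gcongr
      exact h1 i
    simp only [dyadicPoint, Pi.smul_apply, smul_eq_mul]
    linarith

theorem tendsto_dyadicPoint {L : ℕ} {left t : Fin k → ℝ} (hl : left ∈ posOrthant k)
    (ht : t ∈ cube L left) :
    Tendsto (fun N : ℕ => dyadicPoint L left (fun _ => N) (dyadicIndex L left t fun _ => N))
      atTop (𝓝 t) := by
  rw [tendsto_pi_nhds]
  intro i
  have hli := hl i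
  set x := (t i - left i) / (2 ^ L * left i) with hx
  have hx0 : 0 ≤ x := (rescaled_mem_Icc hl ht i).1
  have hlim : Tendsto (fun N : ℕ => ((⌈(2 : ℝ) ^ N * x⌉₊ - 1 : ℕ) : ℝ) / 2 ^ N) atTop (𝓝 x) := by
    have hinv : Tendsto (fun N : ℕ => x - (1 / 2 : ℝ) ^ N) atTop (𝓝 x) := by
      simpa using tendsto_const_nhds.sub
        (tendsto_pow_atTop_nhds_zero_of_lt_one (by norm_num : (0 : ℝ) ≤ 1 / 2) (by norm_num))
    refine tendsto_of_tendsto_of_tendsto_of_le_of_le hinv tendsto_const_nhds ?_ ?_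
    · intro N
      have h1 := Nat.le_ceil ((2 : ℝ) ^ N * x)
      have h2 : ((⌈(2 : ℝ) ^ N * x⌉₊ : ℕ) : ℝ) ≤ ((⌈(2 : ℝ) ^ N * x⌉₊ - 1 : ℕ) : ℝ) + 1 := by
        exact_mod_cast (by omega : ⌈(2 : ℝ) ^ N * x⌉₊ ≤ ⌈(2 : ℝ) ^ N * x⌉₊ - 1 + 1)
      have h3 : (0 : ℝ) < 2 ^ N := by positivity
      change x - (1 / 2 : ℝ) ^ N ≤ _
      rw [le_div_iff₀ h3, sub_mul, ← mul_pow]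
      norm_num
      linarith
    · intro N
      have h3 : (0 : ℝ) < 2 ^ N := by positivity
      change _ / _ ≤ x
      rw [div_le_iff₀ h3]
      rcases Nat.eq_zero_or_pos ⌈(2 : ℝ) ^ N * x⌉₊ with h | h
      · rw [h]; simp; positivity
      · have h4 := Nat.ceil_lt_add_one (by positivity : 0 ≤ (2 : ℝ) ^ N * x)
        rw [Nat.cast_sub (by omega)]
        push_cast
        linarith
  have h4 : t i = left i * (1 + 2 ^ L * x) := by
    rw [hx]
    field_simp
    ring
  rw [h4]
  exact (((hlim.const_mul _).const_add _).const_mul _)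

/-- The value at a dyadic approximation of `t` is the sum of the block increments around `t`. -/
theorem sum_blockDiff (L : ℕ) (left : Fin k → ℝ) (hl : left ∈ posOrthant k) (t : Fin k → ℝ)
    (ht : t ∈ cube L left) (a : (Fin k → ℝ) → ℂ) (N : ℕ) :
    ∑ n ∈ Fintype.piFinset (fun _ : Fin k => Finset.range (N + 1)),
      blockDiff L left n (dyadicIndex L left t n) a =
        a (dyadicPoint L left (fun _ => N) (dyadicIndex L left t fun _ => N)) := by
  rw [← sum_piFinset_mixed_diff (fun n => a (dyadicPoint L left n (dyadicIndex L left t n))) N]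
  refine Finset.sum_congr rfl fun n _ => ?_
  unfold blockDiff multiDiff activeSet
  refine Finset.sum_congr rfl fun U hU => ?_
  have hUK := Finset.mem_powerset.1 hU
  congr 2
  funext i
  by_cases hi : n i = 0
  · have hU' : i ∉ U := fun h => by simpa [hi] using hUK h
    have hq := dyadicIndex_lt hl ht n i
    rw [hi, pow_zero, Nat.lt_one_iff] at hq
    have hq' : dyadicIndex L left t (fun j => if n j ≠ 0 ∧ j ∉ U then n j - 1 else n j) i = 0 := by
      refine Eq.trans ?_ hq
      simp [dyadicIndex, hi]
    simp [shiftOn, hU', blockBase, dyadicPoint, hq, hq']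
  · by_cases hiU : i ∈ U
    · have hq' : dyadicIndex L left t (fun j => if n j ≠ 0 ∧ j ∉ U then n j - 1 else n j) i =
          dyadicIndex L left t n i := by
        simp only [dyadicIndex, hiU, not_true_eq_false, and_false, if_false]
      simp only [shiftOn, hiU, if_true, blockBase, blockStep, hi, if_false, dyadicPoint, hq',
        not_true_eq_false, and_false]
      have h2 : ((2 * (dyadicIndex L left t n i / 2) + dyadicIndex L left t n i % 2 : ℕ) : ℝ) =
          dyadicIndex L left t n i := by
        exact_mod_cast Nat.div_add_mod _ _
      rw [← h2]
      push_cast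
      ring
    · have hq' := dyadicIndex_half L left t n (fun j => if n j ≠ 0 ∧ j ∉ U then n j - 1 else n j) i
        hi (by simp [hi, hiU])
      simp only [shiftOn, hiU, if_false, blockBase, dyadicPoint, hq']
      obtain ⟨j, hj⟩ := Nat.exists_eq_succ_of_ne_zero hi
      simp only [hj, pow_succ, ne_eq, not_false_eq_true, and_self, if_true, Nat.succ_ne_zero,
        Nat.succ_sub_one]
      field_simp

/-- The short variation over one cube is dominated by the square functions of the block increments,
summed over all scales. -/
theorem variation_cube_le {L : ℕ} {left : Fin k → ℝ} (hl : left ∈ posOrthant k)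
    (a : (Fin k → ℝ) → ℂ) (ha : ContinuousOn a (cube L left)) :
    variation 2 (cube L left) a ≤
      2 * ∑' n : Fin k → ℕ, (∑ q : ∀ i, Fin (2 ^ n i),
        ‖blockDiff L left n (fun i => q i) a‖ₑ ^ (2 : ℝ)) ^ (1 / 2 : ℝ) := by
  refine iSup_le fun J => iSup_le fun I => iSup_le fun hI => iSup_le fun hI' => ?_
  let b : ℕ → (Fin k → ℝ) → ℂ := fun N t =>
    a (dyadicPoint L left (fun _ => N) (dyadicIndex L left t fun _ => N))
  have hb : ∀ j ≤ J, Tendsto (fun N => b N (I j)) atTop (𝓝 (a (I j))) := by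
    intro j hj
    refine (ha (I j) (hI j hj)).tendsto.comp ?_
    refine tendsto_nhdsWithin_iff.2 ⟨tendsto_dyadicPoint hl (hI j hj),
      Eventually.of_forall fun N => ?_⟩
    exact dyadicPoint_mem_cube hl _ _ fun i => (dyadicIndex_lt hl (hI j hj) _ i).le
  have hlim : Tendsto (fun N => (∑ j ∈ Finset.range J,
      ‖b N (I (j + 1)) - b N (I j)‖ₑ ^ (2 : ℝ)) ^ (1 / 2 : ℝ)) atTop
      (𝓝 ((∑ j ∈ Finset.range J, ‖a (I (j + 1)) - a (I j)‖ₑ ^ (2 : ℝ)) ^ (1 / 2 : ℝ))) := by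
    refine (ENNReal.continuous_rpow_const.tendsto _).comp ?_
    refine tendsto_finsetSum _ fun j hj => ?_
    have hj' := Finset.mem_range.1 hj
    refine (ENNReal.continuous_rpow_const.tendsto _).comp ?_
    exact (continuous_enorm.tendsto _).comp ((hb (j + 1) hj').sub (hb j hj'.le))
  -- For a fixed `N` only finitely many scales occur, and at each scale the indices `dyadicIndex` of
  -- the points of the chain are monotone.
  refine le_of_tendsto' hlim fun N => ?_
  set box := Fintype.piFinset (fun _ : Fin k => Finset.range (N + 1)) with hbox
  let D : (Fin k → ℕ) → (Fin k → ℝ) → ℂ := fun n t => blockDiff L left n (dyadicIndex L left t n) a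
  have hbD : ∀ j ≤ J, b N (I j) = ∑ n ∈ box, D n (I j) := fun j hj =>
    (sum_blockDiff L left hl (I j) (hI j hj) a N).symm
  have hscale : ∀ n, (∑ j ∈ Finset.range J, ‖D n (I (j + 1)) - D n (I j)‖ₑ ^ (2 : ℝ)) ^ (1 / 2 : ℝ) ≤
      2 * (∑ q : ∀ i, Fin (2 ^ n i),
        ‖blockDiff L left n (fun i => q i) a‖ₑ ^ (2 : ℝ)) ^ (1 / 2 : ℝ) := by
    intro n
    let y : ℕ → ∀ i, Fin (2 ^ n i) := fun j i =>
      ⟨dyadicIndex L left (I (min j J)) n i, dyadicIndex_lt hl (hI _ (min_le_right _ _)) n i⟩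
    have h := sum_enorm_sub_sq_le_tsum
      (fun q : ∀ i, Fin (2 ^ n i) => blockDiff L left n (fun i => q i) a) y J ?_
    · rw [← four_rpow_half, ← ENNReal.mul_rpow_of_nonneg _ _ (by norm_num : (0 : ℝ) ≤ 1 / 2)]
      refine ENNReal.rpow_le_rpow ?_ (by norm_num)
      rw [tsum_fintype] at h
      refine le_trans (le_of_eq (Finset.sum_congr rfl fun j hj => ?_)) h
      have hj' := Finset.mem_range.1 hj
      simp only [y, D, min_eq_left hj'.le, min_eq_left (Nat.succ_le_of_lt hj')]
    · intro j hj i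
      refine dyadicIndex_mono hl ?_ n i
      rw [min_eq_left hj.le, min_eq_left (Nat.succ_le_of_lt hj)]
      exact fun i => (hI' j hj i).le
  calc (∑ j ∈ Finset.range J, ‖b N (I (j + 1)) - b N (I j)‖ₑ ^ (2 : ℝ)) ^ (1 / 2 : ℝ)
      ≤ (∑ j ∈ Finset.range J, (∑ n ∈ box, ‖D n (I (j + 1)) - D n (I j)‖ₑ) ^ (2 : ℝ)) ^
          (1 / 2 : ℝ) := by
        gcongr with j hj
        have hj' := Finset.mem_range.1 hj
        rw [hbD _ hj', hbD _ hj'.le, ← Finset.sum_sub_distrib]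
        exact enorm_sum_le _ _
    _ ≤ ∑ n ∈ box, (∑ j ∈ Finset.range J, ‖D n (I (j + 1)) - D n (I j)‖ₑ ^ (2 : ℝ)) ^
          (1 / 2 : ℝ) :=
        Lp_finsetSum_le _ _ _
    _ ≤ ∑ n ∈ box, 2 * (∑ q : ∀ i, Fin (2 ^ n i),
        ‖blockDiff L left n (fun i => q i) a‖ₑ ^ (2 : ℝ)) ^ (1 / 2 : ℝ) :=
        Finset.sum_le_sum fun n _ => hscale n
    _ ≤ _ := by
        rw [← Finset.mul_sum]
        gcongr
        exact ENNReal.sum_le_tsum _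

end DyadicBlocks

/-! ### Complex interpolation on simple functions -/

section Interpolation

variable {X : Type*}

/-- The vector-valued function with the components `F a`. -/
def toVec {A : Type*} (F : A → X → ℂ) (x : X) : EuclideanSpace ℂ A := WithLp.toLp 2 fun a => F a x

@[simp] theorem toVec_apply {A : Type*} (F : A → X → ℂ) (x : X) (a : A) : toVec F x a = F a x := rfl

theorem enorm_euclidean {A : Type*} [Fintype A] (v : EuclideanSpace ℂ A) :
    ‖v‖ₑ = (∑ a, ‖v a‖ₑ ^ (2 : ℝ)) ^ (1 / 2 : ℝ) := by
  rw [← ofReal_norm, EuclideanSpace.norm_eq, Real.sqrt_eq_rpow,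
    ← ENNReal.ofReal_rpow_of_nonneg (by positivity) (by norm_num),
    ENNReal.ofReal_sum_of_nonneg (fun _ _ => by positivity)]
  congr 1
  refine Finset.sum_congr rfl fun a _ => ?_
  rw [← ofReal_norm, ENNReal.ofReal_rpow_of_nonneg (norm_nonneg _) (by norm_num)]
  norm_num

theorem enorm_toVec {A : Type*} [Fintype A] (F : A → X → ℂ) (x : X) :
    ‖toVec F x‖ₑ = squareFn F x := by
  rw [enorm_euclidean, squareFn, tsum_fintype]
  rfl

variable [MeasurableSpace X] {μ : Measure X}

/-- `T` is a bounded linear operator on `L²(X)`. -/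
structure IsL2Operator (μ : Measure X) (T : (X → ℂ) → X → ℂ) : Prop where
  linear : IsLinearOperator (LpFun 2 μ) μ T
  bound : ∃ C : ℝ≥0, ∀ f, MemLp f 2 μ → eLpNorm (T f) 2 μ ≤ C * eLpNorm f 2 μ

namespace IsL2Operator

variable {T : (X → ℂ) → X → ℂ}

theorem memLp (hT : IsL2Operator μ T) (f : X → ℂ) (hf : MemLp f 2 μ) : MemLp (T f) 2 μ := by
  obtain ⟨C, hC⟩ := hT.bound
  exact ⟨hT.linear.aestronglyMeasurable f hf,
    (hC f hf).trans_lt (ENNReal.mul_lt_top ENNReal.coe_lt_top hf.2)⟩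

theorem map_zero (hT : IsL2Operator μ T) : T 0 =ᵐ[μ] 0 := by
  have := hT.linear.smul 0 0 (show MemLp (0 : X → ℂ) 2 μ from MemLp.zero)
  simpa using this

theorem map_sum (hT : IsL2Operator μ T) {ι : Type*} (s : Finset ι) (f : ι → X → ℂ)
    (hf : ∀ i ∈ s, MemLp (f i) 2 μ) : T (∑ i ∈ s, f i) =ᵐ[μ] ∑ i ∈ s, T (f i) := by
  classical
  induction s using Finset.induction_on with
  | empty => simpa using hT.map_zero
  | insert i s hi ih =>
    rw [Finset.sum_insert hi, Finset.sum_insert hi]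
    have h1 : ∀ j ∈ s, MemLp (f j) 2 μ := fun j hj => hf j (Finset.mem_insert_of_mem hj)
    have h2 : MemLp (∑ j ∈ s, f j) 2 μ := memLp_finsetSum' s h1
    refine (hT.linear.add _ (hf i (Finset.mem_insert_self _ _)) _ h2).trans ?_
    filter_upwards [ih h1] with x hx
    simp only [Pi.add_apply, hx]

theorem map_sub (hT : IsL2Operator μ T) {f g : X → ℂ} (hf : MemLp f 2 μ) (hg : MemLp g 2 μ) :
    T (f - g) =ᵐ[μ] T f - T g := by
  have h1 := hT.linear.add f hf ((-1 : ℂ) • g) (hg.const_smul _)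
  have h2 := hT.linear.smul (-1) g hg
  rw [show f - g = f + (-1 : ℂ) • g by simp [sub_eq_add_neg]]
  filter_upwards [h1, h2] with x hx1 hx2
  rw [hx1, Pi.add_apply, hx2]
  simp [sub_eq_add_neg]

theorem map_sum_smul (hT : IsL2Operator μ T) {ι : Type*} (s : Finset ι) (c : ι → ℂ)
    (f : ι → X → ℂ) (hf : ∀ i ∈ s, MemLp (f i) 2 μ) :
    T (∑ i ∈ s, c i • f i) =ᵐ[μ] ∑ i ∈ s, c i • T (f i) := by
  refine (hT.map_sum s _ fun i hi => (hf i hi).const_smul _).trans ?_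
  have h : ∀ᵐ x ∂μ, ∀ i ∈ s, T (c i • f i) x = (c i • T (f i)) x :=
    (ae_ball_iff s.countable_toSet).2 fun i hi => hT.linear.smul _ _ (hf i hi)
  filter_upwards [h] with x hx
  rw [Finset.sum_apply, Finset.sum_apply]
  exact Finset.sum_congr rfl hx

end IsL2Operator

theorem aestronglyMeasurable_toVec {A : Type*} [Fintype A] {F : A → X → ℂ}
    (hF : ∀ a, AEStronglyMeasurable (F a) μ) : AEStronglyMeasurable (toVec F) μ := by
  have h : AEMeasurable (fun x => fun a => F a x) μ :=
    aemeasurable_pi_lambda _ fun a => (hF a).aemeasurable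
  exact ((PiLp.continuous_toLp 2 _).measurable.comp_aemeasurable h).aestronglyMeasurable

theorem memLp_toVec {A : Type*} [Fintype A] {F : A → X → ℂ} {p : ℝ≥0∞}
    (hF : ∀ a, MemLp (F a) p μ) : MemLp (toVec F) p μ := by
  classical
  have h : MemLp (fun x => ∑ a, ‖F a x‖) p μ := memLp_finsetSum _ fun a _ => (hF a).norm
  refine h.of_le (aestronglyMeasurable_toVec fun a => (hF a).aestronglyMeasurable)
    (Eventually.of_forall fun x => ?_)
  have h1 : toVec F x = ∑ a, EuclideanSpace.single a (F a x) := by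
    ext b
    simp [Pi.single_apply]
  rw [h1, Real.norm_of_nonneg (by positivity)]
  refine (norm_sum_le _ _).trans (le_of_eq ?_)
  simp

/-- The vector `v` with its components and its norm raised to complex powers. For
`2 α = β = 1` it is `v`. If `Re α = 1 / p`, then its `ℓ^p` norm is at most `‖v‖ ^ Re β`, so that `α`
governs the exponent of the sequence space and `β` the one of the Lebesgue space. -/
def powVec {A : Type*} [Fintype A] (α β : ℂ) (v : EuclideanSpace ℂ A) (a : A) : ℂ :=
  if v a = 0 then 0 else v a / ‖v a‖ * (‖v a‖ : ℂ) ^ (2 * α) * (‖v‖ : ℂ) ^ (β - 2 * α)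

section powVec

variable {A : Type*} [Fintype A]

theorem norm_pos_of_apply_ne_zero {v : EuclideanSpace ℂ A} {a : A} (h : v a ≠ 0) : 0 < ‖v‖ :=
  norm_pos_iff.2 fun h0 => h (by simp [h0])

theorem powVec_half_one (v : EuclideanSpace ℂ A) (a : A) : powVec (1 / 2) 1 v a = v a := by
  unfold powVec
  split_ifs with h
  · exact h.symm
  · have : (‖v a‖ : ℂ) ≠ 0 := by simpa using h
    norm_num
    field_simp

@[simp] theorem powVec_zero (α β : ℂ) (a : A) : powVec α β (0 : EuclideanSpace ℂ A) a = 0 := by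
  simp [powVec]

theorem norm_powVec (α β : ℂ) {v : EuclideanSpace ℂ A} {a : A} (h : v a ≠ 0) :
    ‖powVec α β v a‖ = ‖v a‖ ^ (2 * α.re) * ‖v‖ ^ (β.re - 2 * α.re) := by
  have h1 : 0 < ‖v a‖ := norm_pos_iff.2 h
  have h2 := norm_pos_of_apply_ne_zero h
  rw [powVec, if_neg h, norm_mul, norm_mul, Complex.norm_cpow_eq_rpow_re_of_pos h1,
    Complex.norm_cpow_eq_rpow_re_of_pos h2, norm_div, Complex.norm_real, norm_norm,
    div_self h1.ne', one_mul]
  simp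

/-- The affine function with the values `s` at `0` and `t` at `1`. -/
def affineInterp (s t : ℝ) (z : ℂ) : ℂ := (1 - z) * s + z * t

@[simp] theorem affineInterp_re (s t : ℝ) (z : ℂ) :
    (affineInterp s t z).re = (1 - z.re) * s + z.re * t := by
  simp [affineInterp]

theorem differentiable_affineInterp (s t : ℝ) : Differentiable ℂ (affineInterp s t) := by
  unfold affineInterp
  fun_prop

theorem differentiable_powVec (s t s' t' : ℝ) (v : EuclideanSpace ℂ A) (a : A) :
    Differentiable ℂ fun z => powVec (affineInterp s t z) (affineInterp s' t' z) v a := by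
  unfold powVec
  split_ifs with h
  · exact differentiable_const _
  · have h1 : (‖v a‖ : ℂ) ≠ 0 := by simpa using h
    have h2 : (‖v‖ : ℂ) ≠ 0 := by simpa using (norm_pos_of_apply_ne_zero h).ne'
    have h3 := differentiable_affineInterp s t
    have h4 := differentiable_affineInterp s' t'
    refine Differentiable.mul (Differentiable.mul (differentiable_const _) ?_) ?_
    · exact Differentiable.const_cpow (by fun_prop) (Or.inl h1)
    · exact Differentiable.const_cpow (by fun_prop) (Or.inl h2)

theorem exists_norm_powVec_le (s t s' t' : ℝ) (v : EuclideanSpace ℂ A) (a : A) :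
    ∃ C, ∀ z : ℂ, 0 ≤ z.re → z.re ≤ 1 →
      ‖powVec (affineInterp s t z) (affineInterp s' t' z) v a‖ ≤ C := by
  by_cases h : v a = 0
  · exact ⟨0, fun z _ _ => by simp [powVec, h]⟩
  · have h1 : ‖v a‖ ≠ 0 := by simpa using h
    have h2 := (norm_pos_of_apply_ne_zero h).ne'
    have hc : Continuous fun u : ℝ => ‖v a‖ ^ (2 * ((1 - u) * s + u * t)) *
        ‖v‖ ^ ((1 - u) * s' + u * t' - 2 * ((1 - u) * s + u * t)) := by
      refine Continuous.mul ?_ ?_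
      · exact Continuous.rpow continuous_const (by fun_prop) fun _ => Or.inl h1
      · exact Continuous.rpow continuous_const (by fun_prop) fun _ => Or.inl h2
    obtain ⟨C, hC⟩ := (isCompact_Icc (a := (0 : ℝ)) (b := 1)).bddAbove_image hc.continuousOn
    refine ⟨C, fun z h0 h1 => ?_⟩
    rw [norm_powVec _ _ h, affineInterp_re, affineInterp_re]
    exact hC ⟨z.re, ⟨h0, h1⟩, rfl⟩

end powVec

variable {A B : Type*} [Fintype A]

/-- The function `x ↦ powVec α β (φ x) a` is a combination of indicator functions. -/
theorem powVec_comp_eq_sum [DecidableEq (EuclideanSpace ℂ A)]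
    (φ : SimpleFunc X (EuclideanSpace ℂ A)) (α β : ℂ) (a : A) :
    (fun x => powVec α β (φ x) a) = ∑ v ∈ φ.range.filter (· ≠ 0),
      powVec α β v a • (φ ⁻¹' {v}).indicator (fun _ => (1 : ℂ)) := by
  funext x
  rw [Finset.sum_apply]
  by_cases h : φ x = 0
  · rw [h, powVec_zero, Finset.sum_eq_zero]
    intro v hv
    have hv0 := (Finset.mem_filter.1 hv).2
    have : x ∉ φ ⁻¹' {v} := by simp [h, hv0.symm]
    simp [Set.indicator_of_notMem this]
  · rw [Finset.sum_eq_single (φ x)]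
    · simp
    · intro v _ hv
      have : x ∉ φ ⁻¹' {v} := by simp [hv.symm]
      simp [Set.indicator_of_notMem this]
    · intro hx
      simp [h] at hx

theorem memLp_indicator_preimage {A : Type*} {φ : SimpleFunc X (EuclideanSpace ℂ A)}
    (hφ : φ.FinMeasSupp μ)
    {v : EuclideanSpace ℂ A} (hv : v ≠ 0) (p : ℝ≥0∞) :
    MemLp ((φ ⁻¹' {v}).indicator fun _ => (1 : ℂ)) p μ :=
  memLp_indicator_const p (φ.measurableSet_fiber v) 1
    (Or.inr (hφ.meas_preimage_singleton_ne_zero hv).ne)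

/-- Complex interpolation for a pairing of operators with simple functions. By linearity the pairing
is a finite sum of exponentials in `z`, hence entire and bounded on the strip, and Hadamard's three
lines theorem applies. The component `b` of the output depends on the component `π b` of the input.
-/
theorem norm_sum_integral_le_of_edges [Fintype B] {T : B → (X → ℂ) → X → ℂ}
    (hT : ∀ b, IsL2Operator μ (T b)) (π : B → A)
    (φ : SimpleFunc X (EuclideanSpace ℂ A)) (hφ : φ.FinMeasSupp μ)
    (ψ : SimpleFunc X (EuclideanSpace ℂ B)) (hψ : ψ.FinMeasSupp μ)
    (α₀ α₁ β₀ β₁ γ₀ γ₁ δ₀ δ₁ θ M₀ M₁ : ℝ) (hθ : θ ∈ Set.Icc (0 : ℝ) 1)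
    (hα : (1 - θ) * α₀ + θ * α₁ = 1 / 2) (hβ : (1 - θ) * β₀ + θ * β₁ = 1)
    (hγ : (1 - θ) * γ₀ + θ * γ₁ = 1 / 2) (hδ : (1 - θ) * δ₀ + θ * δ₁ = 1)
    (h₀ : ∀ z : ℂ, z.re = 0 → ‖∑ b, ∫ x,
      T b (fun y => powVec (affineInterp α₀ α₁ z) (affineInterp β₀ β₁ z) (φ y) (π b)) x *
        powVec (affineInterp γ₀ γ₁ z) (affineInterp δ₀ δ₁ z) (ψ x) b ∂μ‖ ≤ M₀)
    (h₁ : ∀ z : ℂ, z.re = 1 → ‖∑ b, ∫ x,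
      T b (fun y => powVec (affineInterp α₀ α₁ z) (affineInterp β₀ β₁ z) (φ y) (π b)) x *
        powVec (affineInterp γ₀ γ₁ z) (affineInterp δ₀ δ₁ z) (ψ x) b ∂μ‖ ≤ M₁) :
    ‖∑ b, ∫ x, T b (fun y => φ y (π b)) x * ψ x b ∂μ‖ ≤ M₀ ^ (1 - θ) * M₁ ^ θ := by
  classical
  set Φ : ℂ → ℂ := fun z => ∑ b, ∫ x,
      T b (fun y => powVec (affineInterp α₀ α₁ z) (affineInterp β₀ β₁ z) (φ y) (π b)) x *
        powVec (affineInterp γ₀ γ₁ z) (affineInterp δ₀ δ₁ z) (ψ x) b ∂μ with hΦ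
  let F : ℂ → EuclideanSpace ℂ A → A → ℂ := fun z =>
    powVec (affineInterp α₀ α₁ z) (affineInterp β₀ β₁ z)
  let H : ℂ → EuclideanSpace ℂ B → B → ℂ := fun z =>
    powVec (affineInterp γ₀ γ₁ z) (affineInterp δ₀ δ₁ z)
  let R := φ.range.filter (· ≠ 0)
  let R' := ψ.range.filter (· ≠ 0)
  let c : B → EuclideanSpace ℂ A → EuclideanSpace ℂ B → ℂ := fun b v w =>
    ∫ x, T b ((φ ⁻¹' {v}).indicator fun _ => (1 : ℂ)) x * (ψ ⁻¹' {w}).indicator (fun _ => 1) x ∂μ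
  have hint : ∀ b, ∀ v ∈ R, ∀ w ∈ R', Integrable (fun x =>
      T b ((φ ⁻¹' {v}).indicator fun _ => (1 : ℂ)) x * (ψ ⁻¹' {w}).indicator (fun _ => 1) x) μ := by
    intro b v hv w hw
    have h1 := (hT b).memLp _ (memLp_indicator_preimage hφ (Finset.mem_filter.1 hv).2 2)
    have h2 := memLp_indicator_preimage hψ (Finset.mem_filter.1 hw).2 2
    exact h1.integrable_mul h2
  have hsum : ∀ z, Φ z = ∑ b, ∑ v ∈ R, ∑ w ∈ R', F z v (π b) * H z w b * c b v w := by
    intro z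
    refine Finset.sum_congr rfl fun b _ => ?_
    have h1 : ∀ᵐ x ∂μ, T b (fun y => F z (φ y) (π b)) x * H z (ψ x) b =
        ∑ v ∈ R, ∑ w ∈ R', (F z v (π b) * H z w b) *
          (T b ((φ ⁻¹' {v}).indicator fun _ => (1 : ℂ)) x *
            (ψ ⁻¹' {w}).indicator (fun _ => 1) x) := by
      have h2 := (hT b).map_sum_smul R (fun v => F z v (π b))
        (fun v => (φ ⁻¹' {v}).indicator fun _ => (1 : ℂ)) fun v hv =>
          memLp_indicator_preimage hφ (Finset.mem_filter.1 hv).2 2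
      rw [← powVec_comp_eq_sum] at h2
      have h3 := powVec_comp_eq_sum ψ (affineInterp γ₀ γ₁ z) (affineInterp δ₀ δ₁ z) b
      filter_upwards [h2] with x hx
      have h4 := congrFun h3 x
      simp only [F, H] at hx ⊢
      rw [hx, h4, Finset.sum_apply, Finset.sum_apply, Finset.sum_mul]
      refine Finset.sum_congr rfl fun v _ => ?_
      rw [Finset.mul_sum]
      refine Finset.sum_congr rfl fun w _ => ?_
      simp only [Pi.smul_apply, smul_eq_mul]
      ring
    rw [integral_congr_ae h1, integral_finsetSum _ fun v hv => integrable_finsetSum _ fun w hw =>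
      (hint b v hv w hw).const_mul _]
    refine Finset.sum_congr rfl fun v hv => ?_
    rw [integral_finsetSum _ fun w hw => (hint b v hv w hw).const_mul _]
    refine Finset.sum_congr rfl fun w hw => ?_
    rw [integral_const_mul]
  have hdiff : Differentiable ℂ Φ := by
    have : Φ = fun z => ∑ b, ∑ v ∈ R, ∑ w ∈ R', F z v (π b) * H z w b * c b v w := funext hsum
    rw [this]
    refine Differentiable.fun_sum fun b _ => Differentiable.fun_sum fun v _ =>
      Differentiable.fun_sum fun w _ => ?_
    exact ((differentiable_powVec _ _ _ _ v (π b)).mul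
      (differentiable_powVec _ _ _ _ w b)).mul_const _
  have hbdd : BddAbove ((norm ∘ Φ) '' Complex.HadamardThreeLines.verticalClosedStrip 0 1) := by
    choose CF hCF using fun v a => exists_norm_powVec_le (A := A) α₀ α₁ β₀ β₁ v a
    choose CH hCH using fun v a => exists_norm_powVec_le (A := B) γ₀ γ₁ δ₀ δ₁ v a
    refine ⟨∑ b, ∑ v ∈ R, ∑ w ∈ R', CF v (π b) * CH w b * ‖c b v w‖, ?_⟩
    rintro _ ⟨z, hz, rfl⟩
    have hz' : 0 ≤ z.re ∧ z.re ≤ 1 := hz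
    simp only [Function.comp_apply, hsum]
    refine (norm_sum_le _ _).trans (Finset.sum_le_sum fun b _ => ?_)
    refine (norm_sum_le _ _).trans (Finset.sum_le_sum fun v _ => ?_)
    refine (norm_sum_le _ _).trans (Finset.sum_le_sum fun w _ => ?_)
    rw [norm_mul, norm_mul]
    have e1 := hCF v (π b) z hz'.1 hz'.2
    have e2 := hCH w b z hz'.1 hz'.2
    have e3 : 0 ≤ CF v (π b) := (norm_nonneg _).trans e1
    gcongr
  have key := Complex.HadamardThreeLines.norm_le_interp_of_mem_verticalClosedStrip₀₁' Φ
    (z := (θ : ℂ)) (a := M₀) (b := M₁)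
    (by simpa [Complex.HadamardThreeLines.verticalClosedStrip] using hθ)
    hdiff.diffContOnCl hbdd (fun z hz => h₀ z hz) (fun z hz => h₁ z hz)
  rw [Complex.ofReal_re] at key
  refine le_trans (le_of_eq (congrArg norm ?_)) key
  have aff : ∀ s t u : ℝ, (1 - θ) * s + θ * t = u → affineInterp s t θ = u := by
    intro s t u h
    rw [← h, affineInterp]
    push_cast
    ring
  simp only [hΦ, aff _ _ _ hα, aff _ _ _ hβ, aff _ _ _ hγ, aff _ _ _ hδ]
  push_cast
  simp only [powVec_half_one]

end Interpolation

/-! ### Duality of Lebesgue spaces -/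

section Duality

variable {X : Type*} [MeasurableSpace X] {μ : Measure X} {A B : Type*} [Fintype A] [Fintype B]

theorem eLpNorm_ofReal {E : Type*} [TopologicalSpace E] [ContinuousENorm E] (f : X → E) {p : ℝ}
    (hp : 0 < p) :
    eLpNorm f (ENNReal.ofReal p) μ = (∫⁻ x, ‖f x‖ₑ ^ p ∂μ) ^ (1 / p) := by
  rw [eLpNorm_eq_lintegral_rpow_enorm_toReal (by simpa using hp) ENNReal.ofReal_ne_top,
    ENNReal.toReal_ofReal hp.le]

theorem exists_simpleFunc_tendsto {f : X → EuclideanSpace ℂ A} {p₀ : ℝ≥0∞} (h0 : p₀ ≠ 0)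
    (ht : p₀ ≠ ∞) (hf : MemLp f p₀ μ) :
    ∃ φ : ℕ → SimpleFunc X (EuclideanSpace ℂ A), (∀ n, (φ n).FinMeasSupp μ) ∧
      ∀ p : ℝ≥0∞, p ≠ ∞ → MemLp f p μ →
        Tendsto (fun n => eLpNorm (⇑(φ n) - f) p μ) atTop (𝓝 0) := by
  set g := hf.1.mk f with hg
  have hfg : f =ᵐ[μ] g := hf.1.ae_eq_mk
  have hgm : Measurable g := hf.1.stronglyMeasurable_mk.measurable
  refine ⟨fun n => SimpleFunc.approxOn g hgm (Set.range g ∪ {0}) 0 (by simp) n, fun n => ?_,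
    fun p hp hfp => ?_⟩
  · have h1 : MemLp g p₀ μ := (memLp_congr_ae hfg).1 hf
    exact (SimpleFunc.memLp_iff_finMeasSupp h0 ht).1 (SimpleFunc.memLp_approxOn_range hgm h1 n)
  · have h1 : MemLp g p μ := (memLp_congr_ae hfg).1 hfp
    refine (SimpleFunc.tendsto_approxOn_range_Lp_eLpNorm hp hgm h1.2).congr fun n => ?_
    refine eLpNorm_congr_ae ?_
    filter_upwards [hfg] with x hx
    simp [hx]

theorem memLp_of_finMeasSupp {E : Type*} [NormedAddCommGroup E] {φ : SimpleFunc X E}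
    (hφ : φ.FinMeasSupp μ)
    (p : ℝ≥0∞) : MemLp φ p μ :=
  SimpleFunc.memLp_of_finite_measure_preimage p fun _ hy => hφ.meas_preimage_singleton_ne_zero hy

theorem sum_enorm_mul_le (u v : EuclideanSpace ℂ B) : ∑ b, ‖u b‖ₑ * ‖v b‖ₑ ≤ ‖u‖ₑ * ‖v‖ₑ := by
  rw [enorm_euclidean, enorm_euclidean]
  exact ENNReal.inner_le_Lp_mul_Lq _ _ _ Real.HolderConjugate.two_two

theorem MemLp.apply_euclidean {u : X → EuclideanSpace ℂ B} {p : ℝ≥0∞} (hu : MemLp u p μ) (b : B) :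
    MemLp (fun x => u x b) p μ :=
  (PiLp.proj (𝕜 := ℂ) 2 (fun _ : B => ℂ) b).comp_memLp' hu

/-- The integral of the bilinear pairing of two vector-valued functions. -/
def pairing (μ : Measure X) (u v : X → EuclideanSpace ℂ B) : ℂ := ∑ b, ∫ x, u x b * v x b ∂μ

theorem enorm_pairing_le_sum (u v : X → EuclideanSpace ℂ B) :
    ‖pairing μ u v‖ₑ ≤ ∑ b, ∫⁻ x, ‖u x b‖ₑ * ‖v x b‖ₑ ∂μ := by
  refine (enorm_sum_le _ _).trans (Finset.sum_le_sum fun b _ => ?_)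
  refine (enorm_integral_le_lintegral_enorm _).trans (le_of_eq ?_)
  simp_rw [enorm_mul]

theorem enorm_pairing_le_lintegral {u v : X → EuclideanSpace ℂ B} (hu : AEStronglyMeasurable u μ)
    (hv : AEStronglyMeasurable v μ) : ‖pairing μ u v‖ₑ ≤ ∫⁻ x, ‖u x‖ₑ * ‖v x‖ₑ ∂μ := by
  refine (enorm_pairing_le_sum u v).trans ?_
  rw [← lintegral_finsetSum']
  · exact lintegral_mono fun x => sum_enorm_mul_le _ _
  · intro b _
    have h1 := ((PiLp.proj (𝕜 := ℂ) 2 (fun _ : B => ℂ) b).continuous.comp_aestronglyMeasurable hu)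
    have h2 := ((PiLp.proj (𝕜 := ℂ) 2 (fun _ : B => ℂ) b).continuous.comp_aestronglyMeasurable hv)
    exact h1.enorm.mul h2.enorm

theorem enorm_pairing_le {p p' : ℝ} (hp : p.HolderConjugate p') {u v : X → EuclideanSpace ℂ B}
    (hu : AEStronglyMeasurable u μ) (hv : AEStronglyMeasurable v μ) :
    ‖pairing μ u v‖ₑ ≤ eLpNorm u (ENNReal.ofReal p) μ * eLpNorm v (ENNReal.ofReal p') μ := by
  rw [eLpNorm_ofReal _ hp.pos, eLpNorm_ofReal _ hp.symm.pos]
  exact (enorm_pairing_le_lintegral hu hv).trans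
    (ENNReal.lintegral_mul_le_Lp_mul_Lq μ hp hu.enorm hv.enorm)

theorem integrable_apply_mul {p p' : ℝ} (hp : p.HolderConjugate p') {u v : X → EuclideanSpace ℂ B}
    (hu : MemLp u (ENNReal.ofReal p) μ) (hv : MemLp v (ENNReal.ofReal p') μ) (b : B) :
    Integrable (fun x => u x b * v x b) μ := by
  have : (ENNReal.ofReal p).HolderConjugate (ENNReal.ofReal p') := hp.ennrealOfReal
  exact (MemLp.apply_euclidean hu b).integrable_mul (MemLp.apply_euclidean hv b)

theorem pairing_sub {p p' : ℝ} (hp : p.HolderConjugate p') {u v w : X → EuclideanSpace ℂ B}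
    (hu : MemLp u (ENNReal.ofReal p) μ) (hv : MemLp v (ENNReal.ofReal p') μ)
    (hw : MemLp w (ENNReal.ofReal p') μ) :
    pairing μ u (v - w) = pairing μ u v - pairing μ u w := by
  rw [pairing, pairing, pairing, ← Finset.sum_sub_distrib]
  refine Finset.sum_congr rfl fun b _ => ?_
  rw [← integral_sub (integrable_apply_mul hp hu hv b) (integrable_apply_mul hp hu hw b)]
  refine integral_congr_ae (Eventually.of_forall fun x => ?_)
  simp [mul_sub]

theorem tendsto_pairing {p p' : ℝ} (hp : p.HolderConjugate p') {u v : X → EuclideanSpace ℂ B}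
    (hu : MemLp u (ENNReal.ofReal p) μ) (hv : MemLp v (ENNReal.ofReal p') μ)
    {w : ℕ → X → EuclideanSpace ℂ B} (hw : ∀ n, MemLp (w n) (ENNReal.ofReal p') μ)
    (h : Tendsto (fun n => eLpNorm (w n - v) (ENNReal.ofReal p') μ) atTop (𝓝 0)) :
    Tendsto (fun n => pairing μ u (w n)) atTop (𝓝 (pairing μ u v)) := by
  rw [tendsto_iff_edist_tendsto_0]
  have h1 : Tendsto (fun n => eLpNorm u (ENNReal.ofReal p) μ *
      eLpNorm (w n - v) (ENNReal.ofReal p') μ) atTop (𝓝 0) := by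
    have := ENNReal.Tendsto.const_mul (a := eLpNorm u (ENNReal.ofReal p) μ) h (Or.inr hu.2.ne)
    simpa using this
  refine tendsto_of_tendsto_of_tendsto_of_le_of_le tendsto_const_nhds h1 (fun _ => zero_le)
    fun n => ?_
  simp only [edist_eq_enorm_sub]
  rw [← pairing_sub hp hu (hw n) hv]
  exact enorm_pairing_le hp hu.1 ((hw n).sub hv).1

theorem tendsto_eLpNorm_of_sub {E : Type*} [NormedAddCommGroup E] {p : ℝ≥0∞} (hp : 1 ≤ p)
    {v : X → E} (hv : MemLp v p μ) {w : ℕ → X → E} (hw : ∀ n, MemLp (w n) p μ)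
    (h : Tendsto (fun n => eLpNorm (w n - v) p μ) atTop (𝓝 0)) :
    Tendsto (fun n => eLpNorm (w n) p μ) atTop (𝓝 (eLpNorm v p μ)) := by
  have h1 : ∀ n, eLpNorm (w n) p μ ≤ eLpNorm v p μ + eLpNorm (w n - v) p μ := fun n => by
    have := eLpNorm_add_le hv.1 ((hw n).sub hv).1 hp
    rwa [add_sub_cancel] at this
  have h2 : ∀ n, eLpNorm v p μ - eLpNorm (w n - v) p μ ≤ eLpNorm (w n) p μ := fun n => by
    rw [tsub_le_iff_right]
    have := eLpNorm_sub_le (hw n).1 ((hw n).sub hv).1 hp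
    rwa [sub_sub_cancel] at this
  refine tendsto_of_tendsto_of_tendsto_of_le_of_le ?_ ?_ h2 h1
  · have := ENNReal.Tendsto.sub (tendsto_const_nhds (x := eLpNorm v p μ)) h (Or.inl hv.2.ne)
    simpa using this
  · simpa using tendsto_const_nhds.add h

/-- Converse of Hölder's inequality, tested on simple functions. It is not assumed that `u` belongs
to `L^p`. -/
theorem eLpNorm_le_of_enorm_pairing_le {u : X → EuclideanSpace ℂ B} {s s' p p' : ℝ}
    (hs : s.HolderConjugate s') (hp : p.HolderConjugate p') (hu : MemLp u (ENNReal.ofReal s) μ)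
    {K : ℝ≥0∞} (hK : K ≠ ∞)
    (h : ∀ ψ : SimpleFunc X (EuclideanSpace ℂ B), ψ.FinMeasSupp μ →
      ‖pairing μ u ψ‖ₑ ≤ K * eLpNorm ψ (ENNReal.ofReal p') μ) :
    eLpNorm u (ENNReal.ofReal p) μ ≤ K := by
  wlog hum : StronglyMeasurable u generalizing u
  · have hae := hu.1.ae_eq_mk
    rw [eLpNorm_congr_ae hae]
    refine this ((memLp_congr_ae hae).1 hu) (fun ψ hψ => ?_) hu.1.stronglyMeasurable_mk
    convert h ψ hψ using 2
    refine Finset.sum_congr rfl fun b _ => integral_congr_ae ?_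
    filter_upwards [hae] with x hx
    rw [hx]
  have hnm : Measurable fun x => ‖u x‖ := hum.norm.measurable
  let E : ℕ → Set X := fun n => {x | ((n : ℝ) + 1)⁻¹ ≤ ‖u x‖} ∩ {x | ‖u x‖ ≤ n + 1}
  have hE : ∀ n, MeasurableSet (E n) := fun n =>
    (measurableSet_le measurable_const hnm).inter (measurableSet_le hnm measurable_const)
  have hEfin : ∀ n, μ (E n) < ∞ := by
    intro n
    refine lt_of_le_of_lt (measure_mono fun x hx => ?_)
      (hu.meas_ge_lt_top (by simpa using hs.pos) ENNReal.ofReal_ne_top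
        (ε := ⟨((n : ℝ) + 1)⁻¹, by positivity⟩) ?_)
    · exact hx.1
    · exact (NNReal.coe_pos.1 (by change (0 : ℝ) < ((n : ℝ) + 1)⁻¹; positivity)).ne'
  -- The extremal function of Hölder's inequality, cut off to a set where `u` is bounded below and
  -- above.
  let g : ℕ → X → EuclideanSpace ℂ B := fun n => (E n).indicator fun x =>
    toVec (fun b y => ((‖u y‖ ^ (p - 2) : ℝ) : ℂ) * conj (u y b)) x
  have hgnorm : ∀ n, ∀ x ∈ E n, ‖g n x‖ = ‖u x‖ ^ (p - 1) := by
    intro n x hx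
    have hpos : 0 < ‖u x‖ := lt_of_lt_of_le (by positivity) hx.1
    have h1 : g n x = ((‖u x‖ ^ (p - 2) : ℝ) : ℂ) • WithLp.toLp 2 (fun b => conj (u x b)) := by
      simp only [g, Set.indicator_of_mem hx]
      ext b
      simp
    have h2 : ‖(WithLp.toLp 2 (fun b => conj (u x b)) : EuclideanSpace ℂ B)‖ = ‖u x‖ := by
      rw [EuclideanSpace.norm_eq, EuclideanSpace.norm_eq]
      simp
    rw [h1, norm_smul, h2, Complex.norm_real, Real.norm_of_nonneg (by positivity),
      ← Real.rpow_add_one hpos.ne']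
    congr 1
    ring
  have hgm : ∀ n, AEStronglyMeasurable (g n) μ := by
    intro n
    refine AEStronglyMeasurable.indicator ?_ (hE n)
    refine aestronglyMeasurable_toVec fun b => ?_
    have h1 : Measurable fun x => u x b :=
      ((PiLp.proj (𝕜 := ℂ) 2 (fun _ : B => ℂ) b).continuous.measurable).comp hum.measurable
    refine Measurable.aestronglyMeasurable ?_
    have h2 : Measurable fun x => ((‖u x‖ ^ (p - 2) : ℝ) : ℂ) :=
      Complex.measurable_ofReal.comp (hnm.pow_const _)
    exact h2.mul (Complex.continuous_conj.measurable.comp h1)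
  have hgmem : ∀ n r, MemLp (g n) r μ := by
    intro n r
    have h1 : MemLp ((E n).indicator fun _ => ((n : ℝ) + 1) ^ (p - 1)) r μ :=
      memLp_indicator_const r (hE n) _ (Or.inr (hEfin n).ne)
    refine h1.of_le (hgm n) (Eventually.of_forall fun x => ?_)
    by_cases hx : x ∈ E n
    · rw [hgnorm n x hx, Set.indicator_of_mem hx, Real.norm_of_nonneg (by positivity)]
      exact Real.rpow_le_rpow (norm_nonneg _) hx.2 hp.sub_one_pos.le
    · simp [g, hx]
  have hpair : ∀ n, ‖pairing μ u (g n)‖ₑ ≤ K * eLpNorm (g n) (ENNReal.ofReal p') μ := by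
    intro n
    have hp'1 : 1 ≤ ENNReal.ofReal p' := by
      rw [← ENNReal.ofReal_one]
      exact ENNReal.ofReal_le_ofReal hp.symm.lt.le
    obtain ⟨φ, hφ, hφlim⟩ := exists_simpleFunc_tendsto (p₀ := 1) one_ne_zero ENNReal.one_ne_top
      (hgmem n 1)
    have l1 := tendsto_pairing hs hu (hgmem n _) (fun m => memLp_of_finMeasSupp (hφ m) _)
      (hφlim _ ENNReal.ofReal_ne_top (hgmem n _))
    have l2 := tendsto_eLpNorm_of_sub hp'1 (hgmem n _) (fun m => memLp_of_finMeasSupp (hφ m) _)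
      (hφlim _ ENNReal.ofReal_ne_top (hgmem n _))
    refine le_of_tendsto_of_tendsto' ((continuous_enorm.tendsto _).comp l1)
      (ENNReal.Tendsto.const_mul l2 (Or.inr hK)) fun m => h (φ m) (hφ m)
  have hI : ∀ n, ∫⁻ x in E n, ‖u x‖ₑ ^ p ∂μ ≤ K ^ p := by
    intro n
    set I := ∫⁻ x in E n, ‖u x‖ₑ ^ p ∂μ with hIdef
    have henn : ∀ x ∈ E n, ‖g n x‖ₑ = ‖u x‖ₑ ^ (p - 1) := by
      intro x hx
      rw [← ofReal_norm, hgnorm n x hx, ← ofReal_norm,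
        ENNReal.ofReal_rpow_of_nonneg (norm_nonneg _) hp.sub_one_pos.le]
    have hgI : eLpNorm (g n) (ENNReal.ofReal p') μ = I ^ (1 / p') := by
      rw [eLpNorm_ofReal _ hp.symm.pos, hIdef, ← lintegral_indicator (hE n)]
      congr 1
      refine lintegral_congr fun x => ?_
      by_cases hx : x ∈ E n
      · rw [henn x hx, Set.indicator_of_mem hx, ← ENNReal.rpow_mul, hp.sub_one_mul_conj]
      · have : g n x = 0 := by simp [g, hx]
        rw [this, Set.indicator_of_notMem hx]
        simp [hp.symm.pos]
    have hIfin : I ≠ ∞ := by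
      intro hI0
      have := (hgmem n (ENNReal.ofReal p')).2
      rw [hgI, hI0, ENNReal.top_rpow_of_pos (by have := hp.symm.pos; positivity)] at this
      exact lt_irrefl _ this
    have hpI : ‖pairing μ u (g n)‖ₑ = I := by
      have h1 : pairing μ u (g n) = ((∫ x in E n, ‖u x‖ ^ p ∂μ : ℝ) : ℂ) := by
        rw [pairing, ← integral_finsetSum _ fun b _ =>
          integrable_apply_mul hs hu (hgmem n _) b, ← integral_indicator (hE n)]
        refine Eq.trans ?_ (integral_ofReal (𝕜 := ℂ))
        refine integral_congr_ae (Eventually.of_forall fun x => ?_)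
        by_cases hx : x ∈ E n
        · have hpos : 0 < ‖u x‖ := lt_of_lt_of_le (by positivity) hx.1
          simp only [g, Set.indicator_of_mem hx, toVec_apply]
          have h2 : ∀ b, u x b * (((‖u x‖ ^ (p - 2) : ℝ) : ℂ) * conj (u x b)) =
              ((‖u x‖ ^ (p - 2) * ‖u x b‖ ^ 2 : ℝ) : ℂ) := by
            intro b
            rw [mul_left_comm, Complex.mul_conj, Complex.normSq_eq_norm_sq]
            push_cast
            ring
          simp_rw [h2]
          rw [← Complex.ofReal_sum, ← Finset.mul_sum, ← EuclideanSpace.norm_sq_eq]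
          congr 1
          rw [← Real.rpow_natCast, ← Real.rpow_add hpos]
          congr 1
          push_cast
          ring
        · simp [g, hx]
      rw [h1, ← ofReal_norm, Complex.norm_real, Real.norm_of_nonneg
        (integral_nonneg fun x => by positivity), hIdef,
        ofReal_integral_eq_lintegral_ofReal _ (Eventually.of_forall fun x => by positivity)]
      · refine lintegral_congr fun x => ?_
        rw [← ofReal_norm, ENNReal.ofReal_rpow_of_nonneg (norm_nonneg _) hp.nonneg]
      · refine ⟨(hnm.pow_const _).aestronglyMeasurable, ?_⟩
        rw [hasFiniteIntegral_iff_enorm]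
        refine lt_of_le_of_lt (le_of_eq ?_) hIfin.lt_top
        refine lintegral_congr fun x => ?_
        rw [Real.enorm_rpow_of_nonneg (norm_nonneg _) hp.nonneg, enorm_norm]
    have h2 := hpair n
    rw [hpI, hgI] at h2
    by_cases hI0 : I = 0
    · rw [hI0]; exact zero_le
    have h3 : I ^ (1 / p) * I ^ (1 / p') = I := by
      rw [← ENNReal.rpow_add _ _ hI0 hIfin, one_div, one_div, hp.inv_add_inv_eq_one,
        ENNReal.rpow_one]
    have h4 : I ^ (1 / p) ≤ K := by
      have h2 : I ^ (1 / p) * I ^ (1 / p') ≤ K * I ^ (1 / p') := by rwa [h3]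
      refine (ENNReal.mul_le_mul_iff_left ?_ ?_).1 h2
      · simp only [ne_eq, ENNReal.rpow_eq_zero_iff, not_or, not_and, not_lt]
        exact ⟨fun h => absurd h hI0, fun h => absurd h hIfin⟩
      · exact ENNReal.rpow_ne_top_of_nonneg (by have := hp.symm.pos; positivity) hIfin
    calc I = (I ^ (1 / p)) ^ p := by
          rw [← ENNReal.rpow_mul, one_div, inv_mul_cancel₀ hp.ne_zero, ENNReal.rpow_one]
      _ ≤ K ^ p := ENNReal.rpow_le_rpow h4 hp.nonneg
  rw [eLpNorm_ofReal _ hp.pos]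
  have hmono : Monotone E := by
    intro m n hmn x hx
    have hmn' : (m : ℝ) + 1 ≤ n + 1 := by exact_mod_cast Nat.succ_le_succ hmn
    exact ⟨(inv_anti₀ (by positivity) hmn').trans hx.1, hx.2.trans hmn'⟩
  have htot : ∫⁻ x, ‖u x‖ₑ ^ p ∂μ = ⨆ n, ∫⁻ x in E n, ‖u x‖ₑ ^ p ∂μ := by
    rw [← setLIntegral_iUnion_of_directed _ hmono.directed_le,
      ← lintegral_indicator (MeasurableSet.iUnion hE)]
    refine lintegral_congr fun x => ?_
    by_cases hx : x ∈ ⋃ n, E n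
    · rw [Set.indicator_of_mem hx]
    · rw [Set.indicator_of_notMem hx]
      have : u x = 0 := by
        by_contra h0
        have hpos : 0 < ‖u x‖ := norm_pos_iff.2 h0
        obtain ⟨n, hn⟩ := exists_nat_ge (max ‖u x‖ ‖u x‖⁻¹)
        refine hx (Set.mem_iUnion.2 ⟨n, ?_, ?_⟩)
        · refine inv_le_of_inv_le₀ hpos ?_
          exact (le_max_right _ _).trans (hn.trans (by linarith))
        · exact (le_max_left _ _).trans (hn.trans (by linarith))
      simp [this, hp.pos]
  calc (∫⁻ x, ‖u x‖ₑ ^ p ∂μ) ^ (1 / p) ≤ (K ^ p) ^ (1 / p) := by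
        refine ENNReal.rpow_le_rpow ?_ (by have := hp.pos; positivity)
        rw [htot]
        exact iSup_le hI
    _ = K := by rw [← ENNReal.rpow_mul, one_div, mul_inv_cancel₀ hp.ne_zero, ENNReal.rpow_one]

end Duality

/-! ### Vector-valued extension from a maximal inequality -/

section PowVecBounds

variable {A : Type*} [Fintype A]

theorem enorm_powVec (α β : ℂ) {v : EuclideanSpace ℂ A} {a : A} (h : v a ≠ 0) :
    ‖powVec α β v a‖ₑ = ‖v a‖ₑ ^ (2 * α.re) * ‖v‖ₑ ^ (β.re - 2 * α.re) := by
  have h1 : 0 < ‖v a‖ := norm_pos_iff.2 h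
  have h2 := norm_pos_of_apply_ne_zero h
  rw [← ofReal_norm, norm_powVec _ _ h, ENNReal.ofReal_mul (by positivity),
    ← ENNReal.ofReal_rpow_of_pos h1, ← ENNReal.ofReal_rpow_of_pos h2, ofReal_norm, ofReal_norm]

theorem powVec_eq_zero (α β : ℂ) {v : EuclideanSpace ℂ A} {a : A} (h : v a = 0) :
    powVec α β v a = 0 := by simp [powVec, h]

theorem sum_enorm_sq (v : EuclideanSpace ℂ A) : ∑ a, ‖v a‖ₑ ^ (2 : ℝ) = ‖v‖ₑ ^ (2 : ℝ) := by
  rw [enorm_euclidean, ← ENNReal.rpow_mul]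
  norm_num

theorem sum_weight_le (v : EuclideanSpace ℂ A) (s : ℝ) :
    ∑ a, (if v a = 0 then 0 else ‖v a‖ₑ ^ (2 : ℝ) * ‖v‖ₑ ^ (s - 2)) ≤ ‖v‖ₑ ^ s := by
  by_cases hv : v = 0
  · simp [hv]
  · have h1 : ‖v‖ₑ ≠ 0 := by simpa using hv
    calc _ ≤ ∑ a, ‖v a‖ₑ ^ (2 : ℝ) * ‖v‖ₑ ^ (s - 2) :=
          Finset.sum_le_sum fun a _ => by split_ifs <;> simp
      _ = ‖v‖ₑ ^ s := by
        rw [← Finset.sum_mul, sum_enorm_sq, ← ENNReal.rpow_add _ _ h1 enorm_ne_top]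
        congr 1
        ring

/-- The `ℓ^p` norm of `powVec α β v` for `Re α = 1 / p`. -/
theorem sum_enorm_powVec_rpow_le {p : ℝ} (hp : 0 < p) {α β : ℂ} (hα : α.re = 1 / p)
    (v : EuclideanSpace ℂ A) : ∑ a, ‖powVec α β v a‖ₑ ^ p ≤ ‖v‖ₑ ^ (p * β.re) := by
  refine le_trans (Finset.sum_le_sum fun a _ => ?_) (sum_weight_le v (p * β.re))
  by_cases h : v a = 0
  · simp [powVec_eq_zero _ _ h, h, hp]
  · rw [if_neg h, enorm_powVec _ _ h, ENNReal.mul_rpow_of_nonneg _ _ hp.le, ← ENNReal.rpow_mul,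
      ← ENNReal.rpow_mul, hα]
    apply le_of_eq
    congr 2
    · field_simp
    · field_simp

theorem norm_powVec_le {α β : ℂ} (hα : α.re = 0) (v : EuclideanSpace ℂ A) (a : A) :
    ‖powVec α β v a‖ ≤ ‖v‖ ^ β.re := by
  by_cases h : v a = 0
  · rw [powVec_eq_zero _ _ h, norm_zero]
    positivity
  · rw [norm_powVec _ _ h, hα]
    simp

theorem mul_rpow_le_add {p : ℝ} (hp : 1 ≤ p) (x y : ℝ≥0∞) : x * y ^ (1 - 1 / p) ≤ x ^ p + y := by
  have hp0 : 0 < p := by linarith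
  have hp1 : 0 ≤ 1 - 1 / p := by
    rw [sub_nonneg, div_le_one hp0]
    exact hp
  rcases le_total y (x ^ p) with h | h
  · refine le_trans ?_ le_self_add
    calc x * y ^ (1 - 1 / p) ≤ x * (x ^ p) ^ (1 - 1 / p) := by gcongr
      _ = x ^ (1 : ℝ) * x ^ (p - 1) := by
        rw [← ENNReal.rpow_mul, ENNReal.rpow_one]
        congr 2
        field_simp
      _ = x ^ p := by
        rw [← ENNReal.rpow_add_of_nonneg _ _ (by norm_num) (by linarith)]
        congr 1
        ring
  · refine le_trans ?_ le_add_self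
    calc x * y ^ (1 - 1 / p) = (x ^ p) ^ (1 / p) * y ^ (1 - 1 / p) := by
          rw [← ENNReal.rpow_mul, mul_one_div_cancel hp0.ne', ENNReal.rpow_one]
      _ ≤ y ^ (1 / p) * y ^ (1 - 1 / p) := by gcongr
      _ = y := by
        rw [← ENNReal.rpow_add_of_nonneg _ _ (by positivity) hp1]
        simp

/-- A substitute for Hölder's inequality in `ℓ^p` that includes the case `p = 1`. -/
theorem sum_mul_enorm_powVec_le {p p' : ℝ} (hp : 1 ≤ p) {α β : ℂ} (hα : α.re = 1 - 1 / p)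
    (hβ : β.re = p' * (1 - 1 / p)) (x : A → ℝ≥0∞) (v : EuclideanSpace ℂ A) :
    ∑ a, x a * ‖powVec α β v a‖ₑ ≤ ∑ a, x a ^ p + ‖v‖ₑ ^ p' := by
  have hp0 : 0 < p := by linarith
  have hp1 : 0 ≤ 1 - 1 / p := by
    rw [sub_nonneg, div_le_one hp0]
    exact hp
  calc _ ≤ ∑ a, (x a ^ p + (if v a = 0 then 0 else ‖v a‖ₑ ^ (2 : ℝ) * ‖v‖ₑ ^ (p' - 2))) := by
        refine Finset.sum_le_sum fun a _ => ?_
        by_cases h : v a = 0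
        · simp [powVec_eq_zero _ _ h]
        · rw [if_neg h, enorm_powVec _ _ h]
          refine le_trans (le_of_eq ?_) (mul_rpow_le_add hp _ _)
          rw [ENNReal.mul_rpow_of_nonneg _ _ hp1, ← ENNReal.rpow_mul, ← ENNReal.rpow_mul, hα, hβ]
          congr 3
          ring
    _ ≤ _ := by
        rw [Finset.sum_add_distrib]
        gcongr
        exact sum_weight_le v p'

theorem measurable_powVec (α β : ℂ) (a : A) :
    Measurable fun v : EuclideanSpace ℂ A => powVec α β v a := by
  unfold powVec
  have h1 : Measurable fun v : EuclideanSpace ℂ A => v a :=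
    (PiLp.proj (𝕜 := ℂ) 2 (fun _ : A => ℂ) a).continuous.measurable
  have h2 : Measurable fun v : EuclideanSpace ℂ A => (‖v a‖ : ℂ) :=
    Complex.measurable_ofReal.comp h1.norm
  have h3 : Measurable fun v : EuclideanSpace ℂ A => (‖v‖ : ℂ) :=
    Complex.measurable_ofReal.comp measurable_norm
  refine Measurable.ite (h1 (measurableSet_singleton 0)) measurable_const ?_
  exact ((h1.div h2).mul (h2.pow_const _)).mul (h3.pow_const _)

end PowVecBounds

section VectorInterpolation

variable {X : Type*} [MeasurableSpace X] {μ : Measure X} {A B : Type*} [Fintype A] [Fintype B]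

theorem norm_le_of_enorm_le {z : ℂ} {M : ℝ≥0} (h : ‖z‖ₑ ≤ M) : ‖z‖ ≤ M := by
  rw [← toReal_enorm]
  exact ENNReal.toReal_le_coe_of_le_coe h

theorem lintegral_le_one_of_eLpNorm_le_one {E : Type*} [NormedAddCommGroup E] {f : X → E} {p : ℝ}
    (hp : 0 < p) (h : eLpNorm f (ENNReal.ofReal p) μ ≤ 1) : ∫⁻ x, ‖f x‖ₑ ^ p ∂μ ≤ 1 := by
  rw [eLpNorm_ofReal _ hp] at h
  calc _ = ((∫⁻ x, ‖f x‖ₑ ^ p ∂μ) ^ (1 / p)) ^ p := by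
        rw [← ENNReal.rpow_mul, one_div, inv_mul_cancel₀ hp.ne', ENNReal.rpow_one]
    _ ≤ 1 ^ p := ENNReal.rpow_le_rpow h hp.le
    _ = 1 := ENNReal.one_rpow _

/-- The family of functions `T b (f (π b))`, as a vector-valued function. -/
def applyVec (T : B → (X → ℂ) → X → ℂ) (π : B → A) (f : X → EuclideanSpace ℂ A) :
    X → EuclideanSpace ℂ B := toVec fun b => T b fun y => f y (π b)

variable {T : B → (X → ℂ) → X → ℂ}

theorem memLp_applyVec (hT : ∀ b, IsL2Operator μ (T b)) (π : B → A) {f : X → EuclideanSpace ℂ A}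
    (hf : MemLp f 2 μ) : MemLp (applyVec T π f) 2 μ :=
  memLp_toVec fun b => (hT b).memLp _ (MemLp.apply_euclidean hf _)

theorem applyVec_smul (hT : ∀ b, IsL2Operator μ (T b)) (π : B → A) {f : X → EuclideanSpace ℂ A}
    (hf : MemLp f 2 μ) (c : ℂ) : applyVec T π (c • f) =ᵐ[μ] c • applyVec T π f := by
  have h : ∀ b, T b (fun y => (c • f) y (π b)) =ᵐ[μ] c • T b fun y => f y (π b) := fun b =>
    (hT b).linear.smul c _ (MemLp.apply_euclidean hf (π b))
  filter_upwards [ae_all_iff.2 h] with x hx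
  ext b
  exact hx b

theorem applyVec_sub (hT : ∀ b, IsL2Operator μ (T b)) (π : B → A) {f g : X → EuclideanSpace ℂ A}
    (hf : MemLp f 2 μ) (hg : MemLp g 2 μ) :
    applyVec T π (f - g) =ᵐ[μ] applyVec T π f - applyVec T π g := by
  have h : ∀ b, T b (fun y => (f - g) y (π b)) =ᵐ[μ]
      (T b fun y => f y (π b)) - T b fun y => g y (π b) := fun b =>
    (hT b).map_sub (MemLp.apply_euclidean hf (π b)) (MemLp.apply_euclidean hg (π b))
  filter_upwards [ae_all_iff.2 h] with x hx
  ext b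
  exact hx b

theorem applyVec_congr (hT : ∀ b, IsL2Operator μ (T b)) (π : B → A) {f g : X → EuclideanSpace ℂ A}
    (hf : MemLp f 2 μ) (hfg : f =ᵐ[μ] g) : applyVec T π f =ᵐ[μ] applyVec T π g := by
  have h : ∀ b, T b (fun y => f y (π b)) =ᵐ[μ] T b fun y => g y (π b) := fun b =>
    (hT b).linear.congr _ (MemLp.apply_euclidean hf (π b)) _
      (MemLp.apply_euclidean ((memLp_congr_ae hfg).1 hf) (π b))
      (hfg.mono fun x hx => by simp only [hx])
  filter_upwards [ae_all_iff.2 h] with x hx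
  ext b
  exact hx b

theorem pairing_congr {u u' v v' : X → EuclideanSpace ℂ B} (hu : u =ᵐ[μ] u') (hv : v =ᵐ[μ] v') :
    pairing μ u v = pairing μ u' v' := by
  refine Finset.sum_congr rfl fun b _ => integral_congr_ae ?_
  filter_upwards [hu, hv] with x h1 h2
  rw [h1, h2]

theorem pairing_smul_smul (c d : ℂ) (u v : X → EuclideanSpace ℂ B) :
    pairing μ (c • u) (d • v) = c * d * pairing μ u v := by
  rw [pairing, pairing, Finset.mul_sum]
  refine Finset.sum_congr rfl fun b _ => ?_
  rw [← integral_const_mul]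
  refine integral_congr_ae (Eventually.of_forall fun x => ?_)
  simp only [Pi.smul_apply, PiLp.smul_apply, smul_eq_mul]
  ring

theorem finMeasSupp_smul {A : Type*} {φ : SimpleFunc X (EuclideanSpace ℂ A)}
    (hφ : φ.FinMeasSupp μ) (c : ℂ) :
    (φ.map fun v => c • v).FinMeasSupp μ := hφ.map (smul_zero c)

/-- A bound for the pairing with normalized simple functions is a bound for the operator. -/
theorem eLpNorm_applyVec_le_of_normalized (hT : ∀ b, IsL2Operator μ (T b)) (π : B → A)
    {p p' : ℝ} (hp : p.HolderConjugate p') (K : ℝ≥0)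
    (h : ∀ (φ : SimpleFunc X (EuclideanSpace ℂ A)) (ψ : SimpleFunc X (EuclideanSpace ℂ B)),
      φ.FinMeasSupp μ → ψ.FinMeasSupp μ → ∫⁻ x, ‖φ x‖ₑ ^ p ∂μ ≤ 1 → ∫⁻ x, ‖ψ x‖ₑ ^ p' ∂μ ≤ 1 →
        ‖pairing μ (applyVec T π φ) ψ‖ ≤ K)
    (φ : SimpleFunc X (EuclideanSpace ℂ A)) (hφ : φ.FinMeasSupp μ) :
    eLpNorm (applyVec T π φ) (ENNReal.ofReal p) μ ≤ K * eLpNorm φ (ENNReal.ofReal p) μ := by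
  have hφ2 := memLp_of_finMeasSupp hφ
  have hTφ := memLp_applyVec hT π (hφ2 2)
  have hNtop := (hφ2 (ENNReal.ofReal p)).2.ne
  refine eLpNorm_le_of_enorm_pairing_le Real.HolderConjugate.two_two hp (by simpa using hTφ)
    (ENNReal.mul_ne_top ENNReal.coe_ne_top hNtop) fun ψ hψ => ?_
  have hψ2 := memLp_of_finMeasSupp hψ
  set N := eLpNorm φ (ENNReal.ofReal p) μ with hN
  set N' := eLpNorm ψ (ENNReal.ofReal p') μ with hN'
  have hN'top : N' ≠ ∞ := (hψ2 (ENNReal.ofReal p')).2.ne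
  by_cases hN0 : N = 0
  · have h1 : φ =ᵐ[μ] (0 : X → EuclideanSpace ℂ A) :=
      (eLpNorm_eq_zero_iff (hφ2 1).1 (by simpa using hp.pos)).1 hN0
    have h2 : applyVec T π φ =ᵐ[μ] 0 := by
      have h3 := applyVec_sub hT π (hφ2 2) (hφ2 2)
      have h4 := applyVec_congr hT π (g := ⇑φ - ⇑φ) (hφ2 2) (by simpa using h1)
      refine h4.trans (h3.trans ?_)
      simp
    rw [pairing_congr h2 (EventuallyEq.refl _ _)]
    simp [pairing]
  by_cases hN'0 : N' = 0
  · have h1 : ψ =ᵐ[μ] (0 : X → EuclideanSpace ℂ B) :=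
      (eLpNorm_eq_zero_iff (hψ2 1).1 (by simpa using hp.symm.pos)).1 hN'0
    rw [pairing_congr (EventuallyEq.refl _ _) h1]
    simp [pairing]
  set a := N.toReal with ha
  set a' := N'.toReal with ha'
  have hapos : 0 < a := ENNReal.toReal_pos hN0 hNtop
  have ha'pos : 0 < a' := ENNReal.toReal_pos hN'0 hN'top
  have hNa : N = ENNReal.ofReal a := (ENNReal.ofReal_toReal hNtop).symm
  have hNa' : N' = ENNReal.ofReal a' := (ENNReal.ofReal_toReal hN'top).symm
  have norm1 : ∀ c : ℝ, 0 < c → ‖((c⁻¹ : ℝ) : ℂ)‖ₑ * ENNReal.ofReal c = 1 := by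
    intro c hc
    rw [← ofReal_norm, Complex.norm_real, Real.norm_of_nonneg (by positivity),
      ← ENNReal.ofReal_mul (by positivity), inv_mul_cancel₀ hc.ne', ENNReal.ofReal_one]
  have key := h (φ.map fun v => ((a⁻¹ : ℝ) : ℂ) • v) (ψ.map fun v => ((a'⁻¹ : ℝ) : ℂ) • v)
    (finMeasSupp_smul hφ _) (finMeasSupp_smul hψ _) ?_ ?_
  · have e1 : (⇑(φ.map fun v => ((a⁻¹ : ℝ) : ℂ) • v)) = ((a⁻¹ : ℝ) : ℂ) • ⇑φ := by
      funext x; simp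
    have e2 : (⇑(ψ.map fun v => ((a'⁻¹ : ℝ) : ℂ) • v)) = ((a'⁻¹ : ℝ) : ℂ) • ⇑ψ := by
      funext x; simp
    rw [e1, e2, pairing_congr (applyVec_smul hT π (hφ2 2) _) (EventuallyEq.refl _ _),
      pairing_smul_smul, norm_mul, norm_mul, Complex.norm_real, Complex.norm_real,
      Real.norm_of_nonneg (by positivity), Real.norm_of_nonneg (by positivity)] at key
    have key2 : ‖pairing μ (applyVec T π φ) ψ‖ ≤ K * a * a' := by
      calc _ = (a⁻¹ * a'⁻¹ * ‖pairing μ (applyVec T π φ) ψ‖) * (a * a') := by field_simp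
        _ ≤ K * (a * a') := by gcongr
        _ = _ := by ring
    rw [← ofReal_norm, hNa, hNa']
    calc _ ≤ ENNReal.ofReal (K * a * a') := ENNReal.ofReal_le_ofReal key2
      _ = _ := by
        rw [ENNReal.ofReal_mul (by positivity), ENNReal.ofReal_mul (by positivity),
          ENNReal.ofReal_coe_nnreal]
  · refine lintegral_le_one_of_eLpNorm_le_one hp.pos (le_of_eq ?_)
    rw [SimpleFunc.coe_map]
    change eLpNorm (((a⁻¹ : ℝ) : ℂ) • ⇑φ) _ μ = 1
    rw [eLpNorm_const_smul, ← hN, hNa, norm1 a hapos]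
  · refine lintegral_le_one_of_eLpNorm_le_one hp.symm.pos (le_of_eq ?_)
    rw [SimpleFunc.coe_map]
    change eLpNorm (((a'⁻¹ : ℝ) : ℂ) • ⇑ψ) _ μ = 1
    rw [eLpNorm_const_smul, ← hN', hNa', norm1 a' ha'pos]

theorem finMeasSupp_map_powVec {φ : SimpleFunc X (EuclideanSpace ℂ A)} (hφ : φ.FinMeasSupp μ)
    (α β : ℂ) (a : A) : (φ.map fun v => powVec α β v a).FinMeasSupp μ :=
  hφ.map (powVec_zero α β a)

/-- Vector-valued extension by interpolation between `L^{p₀}(ℓ^{p₀})` and `L^{p₁}(ℓ^∞)`. The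
interpolation parameter is `1 - p₀ / 2`, which makes the intermediate sequence space `ℓ²`. The factor
`2` comes from the additive substitute for Hölder's inequality that is used on the first edge. -/
theorem eLpNorm_applyVec_le_of_maximal (hT : ∀ b, IsL2Operator μ (T b)) (π : B → A)
    {p₀ p₁ q q' : ℝ} (hp₀ : 1 ≤ p₀) (hp₀2 : p₀ ≤ 2) (hp₁ : 1 < p₁) (hq : q.HolderConjugate q')
    (hq₁ : q⁻¹ = (p₀ / 2) * p₀⁻¹ + (1 - p₀ / 2) * p₁⁻¹) {M₀ M₁ : ℝ≥0} (hM₀ : M₀ ≠ 0)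
    (h₀ : ∀ f : A → X → ℂ, (∀ a p, MemLp (f a) p μ) →
      ∑ b, ∫⁻ x, ‖T b (f (π b)) x‖ₑ ^ p₀ ∂μ ≤ (M₀ : ℝ≥0∞) ^ p₀ * ∑ a, ∫⁻ x, ‖f a x‖ₑ ^ p₀ ∂μ)
    (h₁ : ∀ F : X → ℂ, MemLp F (ENNReal.ofReal p₁) μ → ∃ G : X → ℝ≥0∞, AEMeasurable G μ ∧
      (∀ b, ∀ f : X → ℂ, AEStronglyMeasurable f μ → (∀ᵐ x ∂μ, ‖f x‖ ≤ ‖F x‖) →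
        ∀ᵐ x ∂μ, ‖T b f x‖ₑ ≤ G x) ∧
      eLpNorm G (ENNReal.ofReal p₁) μ ≤ M₁ * eLpNorm F (ENNReal.ofReal p₁) μ)
    (φ : SimpleFunc X (EuclideanSpace ℂ A)) (hφ : φ.FinMeasSupp μ) :
    eLpNorm (applyVec T π φ) (ENNReal.ofReal q) μ ≤
      ((2 * M₀) ^ (p₀ / 2) * M₁ ^ (1 - p₀ / 2) : ℝ≥0) * eLpNorm φ (ENNReal.ofReal q) μ := by
  refine eLpNorm_applyVec_le_of_normalized hT π hq _ (fun φ ψ hφ hψ hφ1 hψ1 => ?_) φ hφ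
  have hp₀0 : 0 < p₀ := by linarith
  have hp₁0 : 0 < p₁ := by linarith
  have hq0 := hq.pos
  have hq'0 := hq.symm.pos
  have hp₁' := Real.HolderConjugate.conjExponent hp₁
  set p₁' := Real.conjExponent p₁ with hp₁'def
  have hq'inv : 1 - q⁻¹ = q'⁻¹ := by linarith [hq.inv_add_inv_eq_one]
  have hp₁'inv : 1 - p₁⁻¹ = p₁'⁻¹ := by linarith [hp₁'.inv_add_inv_eq_one]
  have hp₀c : p₀ / 2 * p₀⁻¹ = 1 / 2 := by field_simp
  have key := norm_sum_integral_le_of_edges hT π φ hφ ψ hψ p₀⁻¹ 0 (q * p₀⁻¹) (q * p₁⁻¹)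
    (1 - 1 / p₀) 1 (q' * (1 - 1 / p₀)) (q' * p₁'⁻¹) (1 - p₀ / 2) (2 * M₀) M₁
    ⟨by linarith, by linarith⟩ (by linarith) ?_ (by rw [one_div]; linarith) ?_ ?_ ?_
  · refine key.trans (le_of_eq ?_)
    push_cast
    congr 2
    ring
  · calc _ = q * ((p₀ / 2) * p₀⁻¹ + (1 - p₀ / 2) * p₁⁻¹) := by ring
      _ = 1 := by rw [← hq₁, mul_inv_cancel₀ hq0.ne']
  · calc _ = q' * (1 - ((p₀ / 2) * p₀⁻¹ + (1 - p₀ / 2) * p₁⁻¹)) := by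
          rw [← hp₁'inv, one_div]
          ring
      _ = 1 := by rw [← hq₁, hq'inv, mul_inv_cancel₀ hq'0.ne']
  · intro z hz
    set f : A → X → ℂ := fun a y =>
      powVec (affineInterp p₀⁻¹ 0 z) (affineInterp (q * p₀⁻¹) (q * p₁⁻¹) z) (φ y) a with hf
    set g : B → X → ℂ := fun b y => powVec (affineInterp (1 - 1 / p₀) 1 z)
      (affineInterp (q' * (1 - 1 / p₀)) (q' * p₁'⁻¹) z) (ψ y) b with hg
    have hfmem : ∀ a p, MemLp (f a) p μ := fun a p =>
      memLp_of_finMeasSupp (finMeasSupp_map_powVec hφ _ _ a) p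
    have hgm : ∀ b, AEMeasurable (fun x => ‖g b x‖ₑ) μ := fun b =>
      ((measurable_powVec _ _ b).comp ψ.measurable).enorm.aemeasurable
    have hTm : ∀ b, AEMeasurable (fun x => ‖T b (f (π b)) x‖ₑ) μ := fun b =>
      ((hT b).linear.aestronglyMeasurable _ (hfmem _ 2)).enorm
    have hM₀' : (M₀ : ℝ≥0∞) ≠ 0 := by simpa using hM₀
    have hcancel : (M₀ : ℝ≥0∞) * (M₀ : ℝ≥0∞)⁻¹ = 1 :=
      ENNReal.mul_inv_cancel hM₀' ENNReal.coe_ne_top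
    have hfsum : ∑ a, ∫⁻ x, ‖f a x‖ₑ ^ p₀ ∂μ ≤ 1 := by
      rw [← lintegral_finsetSum' _ fun a _ => (hfmem a 1).1.enorm.pow_const _]
      refine le_trans (lintegral_mono fun x => ?_) hφ1
      refine (sum_enorm_powVec_rpow_le hp₀0 (by simp [hz]) (φ x)).trans (le_of_eq ?_)
      congr 1
      simp only [affineInterp_re, hz]
      field_simp
      ring
    refine norm_le_of_enorm_le (M := 2 * M₀) ?_
    calc _ ≤ ∑ b, ∫⁻ x, ‖T b (f (π b)) x‖ₑ * ‖g b x‖ₑ ∂μ :=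
          enorm_pairing_le_sum (toVec fun b => T b (f (π b))) (toVec g)
      _ = M₀ * ∫⁻ x, ∑ b, ((M₀ : ℝ≥0∞)⁻¹ * ‖T b (f (π b)) x‖ₑ) * ‖g b x‖ₑ ∂μ := by
          rw [lintegral_finsetSum' _ fun b _ => show AEMeasurable (fun x =>
            ((M₀ : ℝ≥0∞)⁻¹ * ‖T b (f (π b)) x‖ₑ) * ‖g b x‖ₑ) μ from
              ((hTm b).const_mul _).mul (hgm b), Finset.mul_sum]
          refine Finset.sum_congr rfl fun b _ => ?_
          rw [← lintegral_const_mul' _ _ ENNReal.coe_ne_top]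
          refine lintegral_congr fun x => ?_
          rw [← mul_assoc, ← mul_assoc, hcancel, one_mul]
      _ ≤ M₀ * ∫⁻ x, (∑ b, ((M₀ : ℝ≥0∞)⁻¹ * ‖T b (f (π b)) x‖ₑ) ^ p₀ + ‖ψ x‖ₑ ^ q') ∂μ := by
          gcongr with x
          exact sum_mul_enorm_powVec_le hp₀ (by simp [hz]) (by simp [hz]) _ (ψ x)
      _ = M₀ * (∑ b, ∫⁻ x, ((M₀ : ℝ≥0∞)⁻¹ * ‖T b (f (π b)) x‖ₑ) ^ p₀ ∂μ +
            ∫⁻ x, ‖ψ x‖ₑ ^ q' ∂μ) := by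
          rw [lintegral_add_right _ (ψ.measurable.enorm.pow_const _),
            lintegral_finsetSum' _ fun b _ => ((hTm b).const_mul _).pow_const _]
      _ ≤ M₀ * (1 + 1) := by
          gcongr
          calc _ = (M₀ : ℝ≥0∞)⁻¹ ^ p₀ * ∑ b, ∫⁻ x, ‖T b (f (π b)) x‖ₑ ^ p₀ ∂μ := by
                rw [Finset.mul_sum]
                refine Finset.sum_congr rfl fun b _ => ?_
                rw [← lintegral_const_mul'' _ ((hTm b).pow_const _)]
                refine lintegral_congr fun x => ?_
                rw [ENNReal.mul_rpow_of_nonneg _ _ hp₀0.le]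
            _ ≤ (M₀ : ℝ≥0∞)⁻¹ ^ p₀ * ((M₀ : ℝ≥0∞) ^ p₀ * 1) := by
                gcongr
                exact (h₀ f hfmem).trans (by gcongr)
            _ = 1 := by
                rw [mul_one, ← ENNReal.mul_rpow_of_nonneg _ _ hp₀0.le, mul_comm, hcancel,
                  ENNReal.one_rpow]
      _ = ((2 * M₀ : ℝ≥0) : ℝ≥0∞) := by
          push_cast
          ring
  · intro z hz
    set f : A → X → ℂ := fun a y =>
      powVec (affineInterp p₀⁻¹ 0 z) (affineInterp (q * p₀⁻¹) (q * p₁⁻¹) z) (φ y) a with hf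
    set g : B → X → ℂ := fun b y => powVec (affineInterp (1 - 1 / p₀) 1 z)
      (affineInterp (q' * (1 - 1 / p₀)) (q' * p₁'⁻¹) z) (ψ y) b with hg
    have hfmem : ∀ a p, MemLp (f a) p μ := fun a p =>
      memLp_of_finMeasSupp (finMeasSupp_map_powVec hφ _ _ a) p
    have hgm : ∀ b, AEMeasurable (fun x => ‖g b x‖ₑ) μ := fun b =>
      ((measurable_powVec _ _ b).comp ψ.measurable).enorm.aemeasurable
    -- All components of the input are dominated by one function in `L^{p₁}`.
    let F : X → ℂ := fun x => ((‖φ x‖ ^ (q * p₁⁻¹) : ℝ) : ℂ)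
    have hFmem : MemLp F (ENNReal.ofReal p₁) μ := by
      refine memLp_of_finMeasSupp (φ := φ.map fun v => ((‖v‖ ^ (q * p₁⁻¹) : ℝ) : ℂ)) (hφ.map ?_) _
      have : q * p₁⁻¹ ≠ 0 := by positivity
      simp [Real.zero_rpow this]
    have hF1 : eLpNorm F (ENNReal.ofReal p₁) μ ≤ 1 := by
      rw [eLpNorm_ofReal _ hp₁0]
      have : ∀ x, ‖F x‖ₑ ^ p₁ = ‖φ x‖ₑ ^ q := by
        intro x
        rw [← ofReal_norm, ← ofReal_norm, Complex.norm_real, Real.norm_of_nonneg (by positivity),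
          ENNReal.ofReal_rpow_of_nonneg (by positivity) hp₁0.le,
          ENNReal.ofReal_rpow_of_nonneg (by positivity) hq0.le, ← Real.rpow_mul (norm_nonneg _)]
        congr 2
        field_simp
      simp_rw [this]
      exact ENNReal.rpow_le_one hφ1 (by positivity)
    obtain ⟨G, hGm, hG, hGle⟩ := h₁ F hFmem
    have hTG : ∀ b, ∀ᵐ x ∂μ, ‖T b (f (π b)) x‖ₑ ≤ G x := fun b => by
      refine hG b _ (hfmem _ 1).1 (Eventually.of_forall fun x => ?_)
      refine (norm_powVec_le (by simp [hz]) (φ x) (π b)).trans (le_of_eq ?_)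
      rw [Complex.norm_real, Real.norm_of_nonneg (by positivity)]
      simp [hz]
    refine norm_le_of_enorm_le (M := M₁) ?_
    calc _ ≤ ∑ b, ∫⁻ x, ‖T b (f (π b)) x‖ₑ * ‖g b x‖ₑ ∂μ :=
          enorm_pairing_le_sum (toVec fun b => T b (f (π b))) (toVec g)
      _ ≤ ∑ b, ∫⁻ x, G x * ‖g b x‖ₑ ∂μ := by
          refine Finset.sum_le_sum fun b _ => lintegral_mono_ae ?_
          filter_upwards [hTG b] with x hx
          gcongr
      _ = ∫⁻ x, G x * ∑ b, ‖g b x‖ₑ ∂μ := by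
          rw [← lintegral_finsetSum' _ fun b _ => show AEMeasurable (fun x => G x * ‖g b x‖ₑ) μ from
            hGm.mul (hgm b)]
          simp_rw [Finset.mul_sum]
      _ ≤ ∫⁻ x, G x * ‖ψ x‖ₑ ^ (q' * p₁'⁻¹) ∂μ := by
          gcongr with x
          have := sum_enorm_powVec_rpow_le (p := 1) one_pos (α := affineInterp (1 - 1 / p₀) 1 z)
            (β := affineInterp (q' * (1 - 1 / p₀)) (q' * p₁'⁻¹) z) (by simp [hz]) (ψ x)
          refine le_trans (le_of_eq (Finset.sum_congr rfl fun b _ => (ENNReal.rpow_one _).symm))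
            (this.trans (le_of_eq ?_))
          simp [hz]
      _ ≤ (∫⁻ x, G x ^ p₁ ∂μ) ^ (1 / p₁) *
            (∫⁻ x, (‖ψ x‖ₑ ^ (q' * p₁'⁻¹)) ^ p₁' ∂μ) ^ (1 / p₁') :=
          ENNReal.lintegral_mul_le_Lp_mul_Lq μ hp₁' hGm
            (ψ.measurable.enorm.pow_const _).aemeasurable
      _ ≤ M₁ * 1 := by
          gcongr
          · have := hGle.trans (mul_le_mul_right hF1 _)
            rw [eLpNorm_ofReal _ hp₁0, mul_one] at this
            simpa using this
          · refine ENNReal.rpow_le_one ?_ (by have := hp₁'.symm.pos; positivity)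
            refine le_trans (le_of_eq (lintegral_congr fun x => ?_)) hψ1
            rw [← ENNReal.rpow_mul, mul_assoc, inv_mul_cancel₀ hp₁'.symm.pos.ne', mul_one]
      _ = M₁ := mul_one _

end VectorInterpolation

/-! ### Minkowski's inequality -/

section Minkowski

variable {X : Type*} [MeasurableSpace X] {μ : Measure X}

theorem lintegral_Lp_finsetSum_le {ι : Type*} {p : ℝ} (hp : 1 ≤ p) (s : Finset ι)
    (f : ι → X → ℝ≥0∞) (hf : ∀ i, AEMeasurable (f i) μ) :
    (∫⁻ x, (∑ i ∈ s, f i x) ^ p ∂μ) ^ (1 / p) ≤ ∑ i ∈ s, (∫⁻ x, f i x ^ p ∂μ) ^ (1 / p) := by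
  classical
  have hp0 : 0 < p := by linarith
  induction s using Finset.induction_on with
  | empty => simp [hp0]
  | insert i s hi ih =>
    simp only [Finset.sum_insert hi]
    refine (ENNReal.lintegral_Lp_add_le (hf i) (g := fun x => ∑ j ∈ s, f j x)
      (Finset.aemeasurable_fun_sum s fun j _ => hf j) hp).trans ?_
    gcongr

/-- Minkowski's inequality for a countable sum of functions with values in `[0, ∞]`. -/
theorem lintegral_Lp_tsum_le {ι : Type*} [Countable ι] {p : ℝ} (hp : 1 ≤ p)
    (f : ι → X → ℝ≥0∞) (hf : ∀ i, AEMeasurable (f i) μ) :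
    (∫⁻ x, (∑' i, f i x) ^ p ∂μ) ^ (1 / p) ≤ ∑' i, (∫⁻ x, f i x ^ p ∂μ) ^ (1 / p) := by
  have hp0 : 0 < p := by linarith
  set C := ∑' i, (∫⁻ x, f i x ^ p ∂μ) ^ (1 / p) with hC
  have h1 : ∀ x, (∑' i, f i x) ^ p = ⨆ s : Finset ι, (∑ i ∈ s, f i x) ^ p := by
    intro x
    rw [ENNReal.tsum_eq_iSup_sum]
    exact (ENNReal.orderIsoRpow p hp0).map_iSup _
  have h2 : ∫⁻ x, (∑' i, f i x) ^ p ∂μ ≤ C ^ p := by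
    simp_rw [h1]
    rw [lintegral_iSup_directed
      (fun s => (Finset.aemeasurable_fun_sum s fun j _ => hf j).pow_const _)]
    · refine iSup_le fun s => ?_
      have h3 := (lintegral_Lp_finsetSum_le hp s f hf).trans (ENNReal.sum_le_tsum s)
      calc _ = ((∫⁻ x, (∑ i ∈ s, f i x) ^ p ∂μ) ^ (1 / p)) ^ p := by
            rw [← ENNReal.rpow_mul, one_div, inv_mul_cancel₀ hp0.ne', ENNReal.rpow_one]
        _ ≤ C ^ p := ENNReal.rpow_le_rpow h3 hp0.le
    · refine Monotone.directed_le fun s t hst x => ?_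
      exact ENNReal.rpow_le_rpow (Finset.sum_le_sum_of_subset hst) hp0.le
  calc _ ≤ (C ^ p) ^ (1 / p) := ENNReal.rpow_le_rpow h2 (by positivity)
    _ = C := by rw [← ENNReal.rpow_mul, one_div, mul_inv_cancel₀ hp0.ne', ENNReal.rpow_one]

/-- Minkowski's inequality in `ℓ²`. -/
theorem Lp_tsum_tsum_le {ι κ : Type*} [Countable ι] (x : ι → κ → ℝ≥0∞) :
    (∑' j, (∑' n, x n j) ^ (2 : ℝ)) ^ (1 / 2 : ℝ) ≤
      ∑' n, (∑' j, x n j ^ (2 : ℝ)) ^ (1 / 2 : ℝ) := by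
  let _ : MeasurableSpace κ := ⊤
  have h := lintegral_Lp_tsum_le (μ := (Measure.count : Measure κ)) (p := 2) (by norm_num) x
    fun i => (measurable_from_top).aemeasurable
  simpa only [lintegral_count] using h

variable {A B M : Type*} [Fintype A] [Fintype B] [Fintype M]

theorem eLpNorm_toVec_le_sum {p : ℝ≥0∞} (hp : 1 ≤ p) {F : B → X → ℂ}
    (hF : ∀ b, AEStronglyMeasurable (F b) μ) :
    eLpNorm (toVec F) p μ ≤ ∑ b, eLpNorm (F b) p μ := by
  classical
  have h : toVec F = ∑ b, fun x => EuclideanSpace.single b (F b x) := by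
    funext x
    ext a
    simp [Finset.sum_apply, Pi.single_apply]
  have hm : ∀ b, AEStronglyMeasurable
      (fun x => (EuclideanSpace.single b (F b x) : EuclideanSpace ℂ B)) μ := fun b => by
    have hc : Continuous fun z : ℂ => (EuclideanSpace.single b z : EuclideanSpace ℂ B) :=
      (PiLp.continuous_toLp 2 _).comp (continuous_single (A := fun _ : B => ℂ) b)
    exact hc.comp_aestronglyMeasurable (hF b)
  rw [h]
  refine (eLpNorm_sum_le (fun b _ => hm b) hp).trans (Finset.sum_le_sum fun b _ => ?_)
  exact eLpNorm_mono fun x => by simp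

/-- A vector-valued function indexed by `A × M` whose `M`-slices are bounded in `L^p`, for
`p ≥ 2`: Minkowski's inequality in `L^{p/2}` for the squares of the norms of the slices. -/
theorem eLpNorm_toVec_prod_le {p : ℝ} (hp : 2 ≤ p) {F : A × M → X → ℂ}
    (hF : ∀ b, AEStronglyMeasurable (F b) μ) {K : ℝ≥0∞}
    (h : ∀ m, eLpNorm (toVec fun a => F (a, m)) (ENNReal.ofReal p) μ ≤ K) :
    eLpNorm (toVec F) (ENNReal.ofReal p) μ ≤ (Fintype.card M : ℝ≥0∞) ^ (1 / 2 : ℝ) * K := by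
  have hp0 : 0 < p := by linarith
  let W : M → X → ℝ≥0∞ := fun m x => ‖toVec (fun a => F (a, m)) x‖ₑ ^ (2 : ℝ)
  have hW : ∀ m, AEMeasurable (W m) μ := fun m =>
    (aestronglyMeasurable_toVec fun a => hF (a, m)).enorm.pow_const _
  have h1 : ∀ x, ‖toVec F x‖ₑ ^ p = (∑ m, W m x) ^ (p / 2) := by
    intro x
    have h2 : ∑ m, W m x = ‖toVec F x‖ₑ ^ (2 : ℝ) := by
      simp only [W]
      simp_rw [← sum_enorm_sq]
      rw [Fintype.sum_prod_type_right]
      rfl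
    rw [h2, ← ENNReal.rpow_mul]
    congr 1
    ring
  have h3 : ∀ m, (∫⁻ x, W m x ^ (p / 2) ∂μ) ^ (1 / (p / 2)) ≤ K ^ (2 : ℝ) := by
    intro m
    have h4 := h m
    rw [eLpNorm_ofReal _ hp0] at h4
    calc _ = ((∫⁻ x, ‖toVec (fun a => F (a, m)) x‖ₑ ^ p ∂μ) ^ (1 / p)) ^ (2 : ℝ) := by
          rw [← ENNReal.rpow_mul]
          congr 1
          · refine lintegral_congr fun x => ?_
            simp only [W]
            rw [← ENNReal.rpow_mul]
            congr 1
            ring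
          · field_simp
      _ ≤ _ := ENNReal.rpow_le_rpow h4 (by norm_num)
  have h5 : (∫⁻ x, (∑ m, W m x) ^ (p / 2) ∂μ) ^ (1 / (p / 2)) ≤
      (Fintype.card M : ℝ≥0∞) * K ^ (2 : ℝ) := by
    refine (lintegral_Lp_finsetSum_le (by linarith) Finset.univ W hW).trans ?_
    refine (Finset.sum_le_sum fun m _ => h3 m).trans (le_of_eq ?_)
    simp
  rw [eLpNorm_ofReal _ hp0]
  simp_rw [h1]
  calc _ = ((∫⁻ x, (∑ m, W m x) ^ (p / 2) ∂μ) ^ (1 / (p / 2))) ^ (1 / 2 : ℝ) := by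
        rw [← ENNReal.rpow_mul]
        congr 1
        field_simp
    _ ≤ ((Fintype.card M : ℝ≥0∞) * K ^ (2 : ℝ)) ^ (1 / 2 : ℝ) :=
        ENNReal.rpow_le_rpow h5 (by norm_num)
    _ = _ := by
        rw [ENNReal.mul_rpow_of_nonneg _ _ (by norm_num), ← ENNReal.rpow_mul]
        norm_num

end Minkowski

/-! ### Interpolation between Lebesgue exponents -/

section ScalarInterpolation

variable {X : Type*} [MeasurableSpace X] {μ : Measure X} {A B : Type*} [Fintype A] [Fintype B]
  {T : B → (X → ℂ) → X → ℂ}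

theorem enorm_toLp_powVec_le {α β : ℂ} (hα : α.re = 1 / 2) (v : EuclideanSpace ℂ A) :
    ‖(WithLp.toLp 2 (powVec α β v) : EuclideanSpace ℂ A)‖ₑ ≤ ‖v‖ₑ ^ β.re := by
  rw [enorm_euclidean]
  calc _ ≤ (‖v‖ₑ ^ (2 * β.re)) ^ (1 / 2 : ℝ) :=
        ENNReal.rpow_le_rpow (sum_enorm_powVec_rpow_le two_pos hα v) (by norm_num)
    _ = _ := by
        rw [← ENNReal.rpow_mul]
        congr 1
        ring

theorem eLpNorm_map_powVec_le_one {φ : SimpleFunc X (EuclideanSpace ℂ A)} {p r : ℝ} (hr : 0 < r)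
    (hφ : ∫⁻ x, ‖φ x‖ₑ ^ p ∂μ ≤ 1) {α β : ℂ} (hα : α.re = 1 / 2) (hβ : β.re = p * r⁻¹) :
    eLpNorm (φ.map fun v => (WithLp.toLp 2 (powVec α β v) : EuclideanSpace ℂ A))
      (ENNReal.ofReal r) μ ≤ 1 := by
  rw [eLpNorm_ofReal _ hr]
  refine ENNReal.rpow_le_one ?_ (by positivity)
  refine (lintegral_mono fun x => ?_).trans hφ
  calc _ ≤ (‖φ x‖ₑ ^ β.re) ^ r := ENNReal.rpow_le_rpow (enorm_toLp_powVec_le hα (φ x)) hr.le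
    _ = _ := by
        rw [← ENNReal.rpow_mul, hβ, mul_assoc, inv_mul_cancel₀ hr.ne', mul_one]

/-- Interpolation of the bounds of an operator with values in `ℓ²` between two Lebesgue
exponents. -/
theorem eLpNorm_applyVec_interp (hT : ∀ b, IsL2Operator μ (T b)) (π : B → A)
    {r₀ r₀' r₁ r₁' p p' θ : ℝ} (hr₀ : r₀.HolderConjugate r₀') (hr₁ : r₁.HolderConjugate r₁')
    (hp : p.HolderConjugate p') (hθ : θ ∈ Set.Icc (0 : ℝ) 1)
    (hpθ : p⁻¹ = (1 - θ) * r₀⁻¹ + θ * r₁⁻¹) {M₀ M₁ : ℝ≥0}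
    (h₀ : ∀ φ : SimpleFunc X (EuclideanSpace ℂ A), φ.FinMeasSupp μ →
      eLpNorm (applyVec T π φ) (ENNReal.ofReal r₀) μ ≤ M₀ * eLpNorm φ (ENNReal.ofReal r₀) μ)
    (h₁ : ∀ φ : SimpleFunc X (EuclideanSpace ℂ A), φ.FinMeasSupp μ →
      eLpNorm (applyVec T π φ) (ENNReal.ofReal r₁) μ ≤ M₁ * eLpNorm φ (ENNReal.ofReal r₁) μ)
    (φ : SimpleFunc X (EuclideanSpace ℂ A)) (hφ : φ.FinMeasSupp μ) :
    eLpNorm (applyVec T π φ) (ENNReal.ofReal p) μ ≤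
      (M₀ ^ (1 - θ) * M₁ ^ θ : ℝ≥0) * eLpNorm φ (ENNReal.ofReal p) μ := by
  refine eLpNorm_applyVec_le_of_normalized hT π hp _ (fun φ ψ hφ hψ hφ1 hψ1 => ?_) φ hφ
  have hp'θ : p'⁻¹ = (1 - θ) * r₀'⁻¹ + θ * r₁'⁻¹ := by
    have e1 := hp.inv_add_inv_eq_one
    have e2 : r₀'⁻¹ = 1 - r₀⁻¹ := by linarith [hr₀.inv_add_inv_eq_one]
    have e3 : r₁'⁻¹ = 1 - r₁⁻¹ := by linarith [hr₁.inv_add_inv_eq_one]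
    rw [e2, e3]
    linarith
  have edge : ∀ {r r' : ℝ} {M : ℝ≥0} {α β γ δ : ℂ}, r.HolderConjugate r' →
      (∀ φ : SimpleFunc X (EuclideanSpace ℂ A), φ.FinMeasSupp μ →
        eLpNorm (applyVec T π φ) (ENNReal.ofReal r) μ ≤ M * eLpNorm φ (ENNReal.ofReal r) μ) →
      α.re = 1 / 2 → β.re = p * r⁻¹ → γ.re = 1 / 2 → δ.re = p' * r'⁻¹ →
      ‖∑ b, ∫ x, T b (fun y => powVec α β (φ y) (π b)) x * powVec γ δ (ψ x) b ∂μ‖ ≤ M := by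
    intro r r' M α β γ δ hr h hα hβ hγ hδ
    let f := φ.map fun v => (WithLp.toLp 2 (powVec α β v) : EuclideanSpace ℂ A)
    let g := ψ.map fun v => (WithLp.toLp 2 (powVec γ δ v) : EuclideanSpace ℂ B)
    have hf : f.FinMeasSupp μ := hφ.map (by ext a; simp)
    refine norm_le_of_enorm_le ?_
    calc _ ≤ eLpNorm (applyVec T π f) (ENNReal.ofReal r) μ * eLpNorm g (ENNReal.ofReal r') μ :=
          enorm_pairing_le hr (memLp_applyVec hT π (memLp_of_finMeasSupp hf 2)).1
            g.aestronglyMeasurable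
      _ ≤ (M * 1) * 1 := by
          gcongr
          · exact (h f hf).trans (by
              gcongr; exact eLpNorm_map_powVec_le_one hr.pos hφ1 hα hβ)
          · exact eLpNorm_map_powVec_le_one hr.symm.pos hψ1 hγ hδ
      _ = M := by simp
  refine norm_sum_integral_le_of_edges hT π φ hφ ψ hψ (1 / 2) (1 / 2) (p * r₀⁻¹) (p * r₁⁻¹)
    (1 / 2) (1 / 2) (p' * r₀'⁻¹) (p' * r₁'⁻¹) θ M₀ M₁ hθ (by ring) ?_ (by ring) ?_ ?_ ?_
  · calc _ = p * ((1 - θ) * r₀⁻¹ + θ * r₁⁻¹) := by ring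
      _ = 1 := by rw [← hpθ, mul_inv_cancel₀ hp.ne_zero]
  · calc _ = p' * ((1 - θ) * r₀'⁻¹ + θ * r₁'⁻¹) := by ring
      _ = 1 := by rw [← hp'θ, mul_inv_cancel₀ hp.symm.ne_zero]
  · intro z hz
    exact edge hr₀ h₀ (by simp [hz]) (by simp [hz]) (by simp [hz]) (by simp [hz])
  · intro z hz
    exact edge hr₁ h₁ (by simp [hz]) (by simp [hz]) (by simp [hz]) (by simp [hz])

theorem exists_eLpNorm_applyVec_two_le (hT : ∀ b, IsL2Operator μ (T b)) (π : B → A) :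
    ∃ C : ℝ≥0, ∀ f : X → EuclideanSpace ℂ A, MemLp f 2 μ →
      eLpNorm (applyVec T π f) 2 μ ≤ C * eLpNorm f 2 μ := by
  choose C hC using fun b => (hT b).bound
  refine ⟨∑ b, C b, fun f hf => ?_⟩
  have hm : ∀ b, MemLp (fun y => f y (π b)) 2 μ := fun b => MemLp.apply_euclidean hf _
  refine (eLpNorm_toVec_le_sum (by norm_num) fun b =>
    (hT b).linear.aestronglyMeasurable _ (hm b)).trans ?_
  rw [ENNReal.ofNNReal_finsetSum, Finset.sum_mul]
  refine Finset.sum_le_sum fun b _ => (hC b _ (hm b)).trans ?_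
  gcongr
  exact eLpNorm_mono fun x => PiLp.norm_apply_le (f x) (π b)

/-- Fatou's lemma for convergence in measure. -/
theorem eLpNorm_le_of_tendstoInMeasure_of_tendsto {E : Type*} [NormedAddCommGroup E] {p : ℝ≥0∞}
    {f : ℕ → X → E} {g : X → E} {c : ℕ → ℝ≥0∞} {C : ℝ≥0∞} (h : ∀ n, eLpNorm (f n) p μ ≤ c n)
    (hc : Tendsto c atTop (𝓝 C)) (hfg : TendstoInMeasure μ f atTop g)
    (hf : ∀ n, AEStronglyMeasurable (f n) μ) : eLpNorm g p μ ≤ C := by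
  refine le_of_forall_gt_imp_ge_of_dense fun c' hc' => ?_
  refine eLpNorm_le_of_tendstoInMeasure ?_ hfg hf
  filter_upwards [hc.eventually_lt_const hc'] with n hn
  exact (h n).trans hn.le

/-- A bound on simple functions extends to `L² ∩ L^p`. -/
theorem eLpNorm_applyVec_le_of_simpleFunc (hT : ∀ b, IsL2Operator μ (T b)) (π : B → A)
    {p : ℝ≥0∞} (hp : 1 ≤ p) (hp' : p ≠ ∞) {K : ℝ≥0}
    (h : ∀ φ : SimpleFunc X (EuclideanSpace ℂ A), φ.FinMeasSupp μ →
      eLpNorm (applyVec T π φ) p μ ≤ K * eLpNorm φ p μ)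
    {f : X → EuclideanSpace ℂ A} (hf2 : MemLp f 2 μ) (hfp : MemLp f p μ) :
    eLpNorm (applyVec T π f) p μ ≤ K * eLpNorm f p μ := by
  obtain ⟨φ, hφ, hlim⟩ := exists_simpleFunc_tendsto two_ne_zero ENNReal.ofNat_ne_top hf2
  obtain ⟨C, hC⟩ := exists_eLpNorm_applyVec_two_le hT π
  have hφm : ∀ n p, MemLp (φ n) p μ := fun n p => memLp_of_finMeasSupp (hφ n) p
  have h1 : Tendsto (fun n => eLpNorm (applyVec T π (φ n) - applyVec T π f) 2 μ) atTop (𝓝 0) := by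
    have h2 : Tendsto (fun n => (C : ℝ≥0∞) * eLpNorm (⇑(φ n) - f) 2 μ) atTop (𝓝 0) := by
      have := ENNReal.Tendsto.const_mul (a := (C : ℝ≥0∞)) (hlim 2 ENNReal.ofNat_ne_top hf2)
        (Or.inr ENNReal.coe_ne_top)
      simpa using this
    refine tendsto_of_tendsto_of_tendsto_of_le_of_le tendsto_const_nhds h2 (fun _ => zero_le)
      fun n => ?_
    change eLpNorm _ 2 μ ≤ _
    rw [← eLpNorm_congr_ae (applyVec_sub hT π (hφm n 2) hf2)]
    exact hC _ ((hφm n 2).sub hf2)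
  have hmeas : ∀ n, AEStronglyMeasurable (applyVec T π (φ n)) μ := fun n =>
    (memLp_applyVec hT π (hφm n 2)).1
  have h3 := tendstoInMeasure_of_tendsto_eLpNorm two_ne_zero hmeas
    (memLp_applyVec hT π hf2).1 h1
  have h4 : Tendsto (fun n => K * eLpNorm (φ n) p μ) atTop (𝓝 (K * eLpNorm f p μ)) :=
    ENNReal.Tendsto.const_mul (tendsto_eLpNorm_of_sub hp hfp (fun n => hφm n p) (hlim p hp' hfp))
      (Or.inr ENNReal.coe_ne_top)
  exact eLpNorm_le_of_tendstoInMeasure_of_tendsto (fun n => h (φ n) (hφ n)) h4 h3 hmeas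

end ScalarInterpolation

/-! ### Summation over the Littlewood–Paley pieces -/

section ScalarInput

variable {X : Type*}

theorem norm_toVec_unit (f : X → ℂ) (x : X) : ‖toVec (fun _ : Unit => f) x‖ = ‖f x‖ := by
  simp [EuclideanSpace.norm_eq]

variable [MeasurableSpace X] {μ : Measure X}

theorem eLpNorm_toVec_unit (f : X → ℂ) (p : ℝ≥0∞) :
    eLpNorm (toVec fun _ : Unit => f) p μ = eLpNorm f p μ :=
  eLpNorm_congr_norm_ae (Eventually.of_forall (norm_toVec_unit f))

theorem memLp_toVec_unit {f : X → ℂ} {p : ℝ≥0∞} (hf : MemLp f p μ) :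
    MemLp (toVec fun _ : Unit => f) p μ := memLp_toVec fun _ => hf

/-- The part of a square function that belongs to finitely many indices. -/
theorem eLpNorm_toVec_le_squareFn {B ι : Type*} [Fintype B] (F : ι → X → ℂ) {e : B → ι}
    (he : Function.Injective e) (p : ℝ≥0∞) :
    eLpNorm (toVec fun b => F (e b)) p μ ≤ eLpNorm (squareFn F) p μ := by
  refine eLpNorm_mono_enorm fun x => ?_
  rw [enorm_toVec, enorm_eq_self]
  unfold squareFn
  gcongr
  exact ENNReal.tsum_comp_le_tsum_of_injective he fun i => ‖F i x‖ₑ ^ (2 : ℝ)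

theorem IsL2Operator.comp {T S : (X → ℂ) → X → ℂ} (hT : IsL2Operator μ T)
    (hS : IsL2Operator μ S) : IsL2Operator μ fun f => T (S f) where
  linear :=
    { aestronglyMeasurable := fun f hf => hT.linear.aestronglyMeasurable _ (hS.memLp f hf)
      congr := fun f hf g hg h =>
        hT.linear.congr _ (hS.memLp f hf) _ (hS.memLp g hg) (hS.linear.congr f hf g hg h)
      add := fun f hf g hg =>
        (hT.linear.congr _ (hS.memLp _ (MemLp.add hf hg)) _
          (MemLp.add (hS.memLp f hf) (hS.memLp g hg)) (hS.linear.add f hf g hg)).trans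
          (hT.linear.add _ (hS.memLp f hf) _ (hS.memLp g hg))
      smul := fun z f hf =>
        (hT.linear.congr _ (hS.memLp _ (MemLp.const_smul hf z)) _
          ((hS.memLp f hf).const_smul z) (hS.linear.smul z f hf)).trans
          (hT.linear.smul z _ (hS.memLp f hf)) }
  bound := by
    obtain ⟨C, hC⟩ := hT.bound
    obtain ⟨C', hC'⟩ := hS.bound
    refine ⟨C * C', fun f hf => (hC _ (hS.memLp f hf)).trans ?_⟩
    rw [ENNReal.coe_mul, mul_assoc]
    gcongr
    exact hC' f hf

end ScalarInput

section LittlewoodPaleySum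

variable {X : Type*} [MeasurableSpace X] {μ : Measure X} {r : ℕ} {M : Type*} [Fintype M]
  {Γ : Finset (Fin r → ℤ)}

/-- The bounds of the pieces `f ↦ (T_{g,m} S_{g+h} f)` on `L^q` and on `L²` are interpolated, and the
pieces are added up over `h` by means of the resolution of the identity. -/
theorem eLpNorm_toVec_le_tsum {T : Γ × M → (X → ℂ) → X → ℂ} (hT : ∀ b, IsL2Operator μ (T b))
    {S : (Fin r → ℤ) → (X → ℂ) → X → ℂ} (hS : ∀ g, IsL2Operator μ (S g))
    (E : ℕ → Finset (Fin r → ℤ))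
    (hE : ∀ f, MemLp f 2 μ →
      Tendsto (fun n => eLpNorm (fun x => ∑ g ∈ E n, S g f x - f x) 2 μ) atTop (𝓝 0))
    {q q' p p' θ : ℝ} (hq : q.HolderConjugate q') (hp : p.HolderConjugate p')
    (hθ : θ ∈ Set.Icc (0 : ℝ) 1) (hpθ : p⁻¹ = (1 - θ) * q⁻¹ + θ * 2⁻¹)
    {V : ℝ≥0} {W : (Fin r → ℤ) → ℝ≥0}
    (hV : ∀ h f, MemLp f 2 μ → MemLp f (ENNReal.ofReal q) μ →
      eLpNorm (toVec fun b : Γ × M => T b (S (b.1 + h) f)) (ENNReal.ofReal q) μ ≤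
        V * eLpNorm f (ENNReal.ofReal q) μ)
    (hW : ∀ h f, MemLp f 2 μ →
      eLpNorm (toVec fun b : Γ × M => T b (S (b.1 + h) f)) 2 μ ≤ W h * eLpNorm f 2 μ)
    {f : X → ℂ} (hf2 : MemLp f 2 μ) (hfp : MemLp f (ENNReal.ofReal p) μ) :
    eLpNorm (toVec fun b => T b f) (ENNReal.ofReal p) μ ≤
      (∑' h, ((V ^ (1 - θ) * W h ^ θ : ℝ≥0) : ℝ≥0∞)) * eLpNorm f (ENNReal.ofReal p) μ := by
  classical
  have hp1 : 1 ≤ ENNReal.ofReal p := by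
    rw [← ENNReal.ofReal_one]
    exact ENNReal.ofReal_le_ofReal hp.lt.le
  set K : (Fin r → ℤ) → ℝ≥0 := fun h => V ^ (1 - θ) * W h ^ θ with hK
  have step : ∀ h f, MemLp f 2 μ → MemLp f (ENNReal.ofReal p) μ →
      eLpNorm (toVec fun b : Γ × M => T b (S (b.1 + h) f)) (ENNReal.ofReal p) μ ≤
        K h * eLpNorm f (ENNReal.ofReal p) μ := by
    intro h f hf2 hfp
    have hTS : ∀ b : Γ × M, IsL2Operator μ fun f => T b (S (b.1 + h) f) := fun b =>
      (hT b).comp (hS _)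
    have hin : ∀ (φ : SimpleFunc X (EuclideanSpace ℂ Unit)) (s : ℝ≥0∞),
        eLpNorm (fun y => φ y ()) s μ = eLpNorm φ s μ := fun φ s =>
      eLpNorm_congr_norm_ae (Eventually.of_forall fun x => by simp [EuclideanSpace.norm_eq])
    have hin' : ∀ φ : SimpleFunc X (EuclideanSpace ℂ Unit), φ.FinMeasSupp μ → ∀ s : ℝ≥0∞,
        MemLp (fun y => φ y ()) s μ := fun φ hφ s =>
      MemLp.apply_euclidean (memLp_of_finMeasSupp hφ s) ()
    have h1 := eLpNorm_applyVec_le_of_simpleFunc hTS (fun _ => ()) hp1 ENNReal.ofReal_ne_top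
      (K := K h) (fun φ hφ => eLpNorm_applyVec_interp hTS (fun _ => ()) hq
        Real.HolderConjugate.two_two hp hθ hpθ (M₀ := V) (M₁ := W h) (fun φ hφ => ?_)
        (fun φ hφ => ?_) φ hφ)
      (memLp_toVec_unit hf2) (memLp_toVec_unit hfp)
    · rw [eLpNorm_toVec_unit] at h1
      exact h1
    · have := hV h _ (hin' φ hφ 2) (hin' φ hφ _)
      rw [hin] at this
      exact this
    · have := hW h _ (hin' φ hφ 2)
      rw [hin] at this
      rw [show ENNReal.ofReal 2 = 2 by simp]
      exact this
  -- The partial sums of the resolution of the identity.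
  let F : ℕ → X → ℂ := fun n => ∑ g ∈ E n, S g f
  have hF : ∀ n, MemLp (F n) 2 μ := fun n => memLp_finsetSum' _ fun g _ => (hS g).memLp f hf2
  have hFlim : Tendsto (fun n => eLpNorm (F n - f) 2 μ) atTop (𝓝 0) := by
    refine (hE f hf2).congr fun n => ?_
    congr 1
    funext x
    simp [F, Finset.sum_apply]
  have hFT : ∀ n, eLpNorm (toVec fun b => T b (F n)) (ENNReal.ofReal p) μ ≤
      (∑' h, (K h : ℝ≥0∞)) * eLpNorm f (ENNReal.ofReal p) μ := by
    intro n
    -- In the component `g` the index of the resolution is written as `g + h`. For each `h` the sum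
    -- over the indices in `E n` is a truncation of the piece of index `h`, with smaller components.
    let Hn : Finset (Fin r → ℤ) :=
      ((E n) ×ˢ (Finset.univ : Finset (Γ × M))).image fun y => y.1 - y.2.1
    let w : (Fin r → ℤ) → X → EuclideanSpace ℂ (Γ × M) := fun h =>
      toVec fun b => if (b.1 : Fin r → ℤ) + h ∈ E n then T b (S (b.1 + h) f) else 0
    have hTSm : ∀ (b : Γ × M) (g : Fin r → ℤ), AEStronglyMeasurable (T b (S g f)) μ := fun b g =>
      (hT b).linear.aestronglyMeasurable _ ((hS g).memLp f hf2)
    have hwm : ∀ h, AEStronglyMeasurable (w h) μ := fun h =>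
      aestronglyMeasurable_toVec fun b => by
        split_ifs
        · exact hTSm b _
        · exact aestronglyMeasurable_zero
    have hw : ∀ h, eLpNorm (w h) (ENNReal.ofReal p) μ ≤ K h * eLpNorm f (ENNReal.ofReal p) μ := by
      intro h
      refine le_trans (eLpNorm_mono_enorm fun x => ?_) (step h f hf2 hfp)
      rw [enorm_euclidean, enorm_euclidean]
      gcongr with b
      simp only [w, toVec_apply]
      split_ifs
      · exact le_rfl
      · simp
    have hsum : (toVec fun b => T b (F n)) =ᵐ[μ] ∑ h ∈ Hn, w h := by
      have h1 : ∀ b, T b (F n) =ᵐ[μ] ∑ g ∈ E n, T b (S g f) := fun b =>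
        (hT b).map_sum _ _ fun g _ => (hS g).memLp f hf2
      filter_upwards [ae_all_iff.2 h1] with x hx
      ext b
      rw [toVec_apply, hx b, Finset.sum_apply, Finset.sum_apply, WithLp.ofLp_sum, Finset.sum_apply]
      simp only [w, toVec_apply]
      have h2 : ∀ h, (if (b.1 : Fin r → ℤ) + h ∈ E n then T b (S (b.1 + h) f) else 0) x =
          if (b.1 : Fin r → ℤ) + h ∈ E n then T b (S (b.1 + h) f) x else 0 := fun h => by
        split_ifs <;> rfl
      simp_rw [h2]
      rw [← Finset.sum_filter]
      refine Finset.sum_nbij' (fun g => g - b.1) (fun h => b.1 + h) ?_ ?_ ?_ ?_ ?_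
      · intro g hg
        refine Finset.mem_filter.2 ⟨Finset.mem_image.2 ⟨(g, b), ?_, rfl⟩, by simpa using hg⟩
        exact Finset.mem_product.2 ⟨hg, Finset.mem_univ _⟩
      · intro h hh
        exact (Finset.mem_filter.1 hh).2
      · intro g _
        simp
      · intro h _
        simp
      · intro g _
        simp
    rw [eLpNorm_congr_ae hsum]
    refine (eLpNorm_sum_le (fun h _ => hwm h) hp1).trans ?_
    refine (Finset.sum_le_sum fun h _ => hw h).trans ?_
    rw [← Finset.sum_mul]
    gcongr
    exact ENNReal.sum_le_tsum Hn
  obtain ⟨C, hC⟩ := exists_eLpNorm_applyVec_two_le hT fun _ => ()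
  have happ : ∀ f : X → ℂ, applyVec T (fun _ => ()) (toVec fun _ : Unit => f) =
      toVec fun b => T b f := fun _ => rfl
  have hmeas : ∀ {f : X → ℂ}, MemLp f 2 μ → AEStronglyMeasurable (toVec fun b => T b f) μ :=
    fun hf => aestronglyMeasurable_toVec fun b => (hT b).linear.aestronglyMeasurable _ hf
  have hlim : Tendsto (fun n => eLpNorm ((toVec fun b => T b (F n)) - toVec fun b => T b f) 2 μ)
      atTop (𝓝 0) := by
    have h2 : Tendsto (fun n => (C : ℝ≥0∞) * eLpNorm (F n - f) 2 μ) atTop (𝓝 0) := by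
      have := ENNReal.Tendsto.const_mul (a := (C : ℝ≥0∞)) hFlim (Or.inr ENNReal.coe_ne_top)
      simpa using this
    refine tendsto_of_tendsto_of_tendsto_of_le_of_le tendsto_const_nhds h2 (fun _ => zero_le)
      fun n => ?_
    have h3 := applyVec_sub hT (fun _ => ()) (memLp_toVec_unit (hF n)) (memLp_toVec_unit hf2)
    rw [happ, happ] at h3
    change eLpNorm _ 2 μ ≤ _
    rw [← eLpNorm_congr_ae h3, ← eLpNorm_toVec_unit (F n - f)]
    exact hC _ (memLp_toVec_unit ((hF n).sub hf2))
  exact eLpNorm_le_of_tendstoInMeasure_of_tendsto hFT tendsto_const_nhds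
    (tendstoInMeasure_of_tendsto_eLpNorm two_ne_zero (fun n => hmeas (hF n)) (hmeas hf2) hlim)
    fun n => hmeas (hF n)

end LittlewoodPaleySum

/-! ### Linear combinations of the operators -/

section Combinations

variable {X : Type*} {k : ℕ} {H : (Fin k → ℝ) → (X → ℂ) → X → ℂ} {U : Type*} [Fintype U]

/-- The linear combination `∑_u σ_u H_{t_u}`. -/
def comb (H : (Fin k → ℝ) → (X → ℂ) → X → ℂ) (σ : U → ℝ) (t : U → Fin k → ℝ) (f : X → ℂ) :
    X → ℂ := fun x => ∑ u, (σ u : ℂ) * H (t u) f x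

theorem enorm_comb_le {σ : U → ℝ} (hσ : ∀ u, |σ u| ≤ 1) (t : U → Fin k → ℝ) (f : X → ℂ) (x : X) :
    ‖comb H σ t f x‖ₑ ≤ ∑ u, ‖H (t u) f x‖ₑ := by
  refine (enorm_sum_le _ _).trans (Finset.sum_le_sum fun u _ => ?_)
  rw [enorm_mul]
  refine mul_le_of_le_one_left zero_le ?_
  rw [← ofReal_norm, Complex.norm_real, Real.norm_eq_abs]
  exact ENNReal.ofReal_le_one.2 (hσ u)

variable [MeasurableSpace X] {μ : Measure X}

theorem IsLinearOperator.mono {D D' : Set (X → ℂ)} {T : (X → ℂ) → X → ℂ} (hD : D' ⊆ D)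
    (hT : IsLinearOperator D μ T) : IsLinearOperator D' μ T where
  aestronglyMeasurable f hf := hT.aestronglyMeasurable f (hD hf)
  congr f hf g hg := hT.congr f (hD hf) g (hD hg)
  add f hf g hg := hT.add f (hD hf) g (hD hg)
  smul z f hf := hT.smul z f (hD hf)

theorem IsLinearOperator.comb {D : Set (X → ℂ)} {σ : U → ℝ} {t : U → Fin k → ℝ}
    (hH : ∀ u, IsLinearOperator D μ (H (t u))) : IsLinearOperator D μ (comb H σ t) where
  aestronglyMeasurable f hf := Finset.aestronglyMeasurable_fun_sum _ fun u _ =>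
    ((hH u).aestronglyMeasurable f hf).const_mul _
  congr f hf g hg h := by
    filter_upwards [ae_all_iff.2 fun u => (hH u).congr f hf g hg h] with x hx
    simp only [MultiparamVariation.comb, hx]
  add f hf g hg := by
    filter_upwards [ae_all_iff.2 fun u => (hH u).add f hf g hg] with x hx
    simp only [MultiparamVariation.comb, hx, Pi.add_apply, mul_add, Finset.sum_add_distrib]
  smul z f hf := by
    filter_upwards [ae_all_iff.2 fun u => (hH u).smul z f hf] with x hx
    simp only [MultiparamVariation.comb, hx, Pi.smul_apply, smul_eq_mul, Finset.mul_sum]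
    exact Finset.sum_congr rfl fun u _ => by ring

theorem lpFun_two_subset (p₀ : ℝ≥0∞) : LpFun 2 μ ⊆ SumLpFun p₀ 2 μ := fun f hf =>
  ⟨0, f, MemLp.zero, hf, (zero_add f).symm⟩

theorem lintegral_rpow_le_of_eLpNorm_le {E F : Type*} [NormedAddCommGroup E]
    [NormedAddCommGroup F] {f : X → E} {g : X → F} {p : ℝ} (hp : 0 < p) {c : ℝ≥0∞}
    (h : eLpNorm f (ENNReal.ofReal p) μ ≤ c * eLpNorm g (ENNReal.ofReal p) μ) :
    ∫⁻ x, ‖f x‖ₑ ^ p ∂μ ≤ c ^ p * ∫⁻ x, ‖g x‖ₑ ^ p ∂μ := by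
  rw [eLpNorm_ofReal _ hp, eLpNorm_ofReal _ hp] at h
  have h1 : ∀ I : ℝ≥0∞, (I ^ (1 / p)) ^ p = I := fun I => by
    rw [← ENNReal.rpow_mul, one_div, inv_mul_cancel₀ hp.ne', ENNReal.rpow_one]
  calc _ = ((∫⁻ x, ‖f x‖ₑ ^ p ∂μ) ^ (1 / p)) ^ p := (h1 _).symm
    _ ≤ (c * (∫⁻ x, ‖g x‖ₑ ^ p ∂μ) ^ (1 / p)) ^ p := ENNReal.rpow_le_rpow h hp.le
    _ = _ := by rw [ENNReal.mul_rpow_of_nonneg _ _ hp.le, h1]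

/-- The maximal function dominates linear combinations of the operators. -/
theorem MaximalEstimate.exists_comb_le {p : ℝ} (hp : 0 < p) {A₁ : ℝ≥0}
    (hmax : MaximalEstimate μ H (ENNReal.ofReal p) A₁) {F : X → ℂ}
    (hF : MemLp F (ENNReal.ofReal p) μ) :
    ∃ G : X → ℝ≥0∞, AEMeasurable G μ ∧
      (∀ (σ : U → ℝ) (t : U → Fin k → ℝ), (∀ u, |σ u| ≤ 1) → (∀ u, t u ∈ posOrthant k) →
        ∀ f : X → ℂ, AEStronglyMeasurable f μ → (∀ᵐ x ∂μ, ‖f x‖ ≤ ‖F x‖) →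
          ∀ᵐ x ∂μ, ‖comb H σ t f x‖ₑ ≤ G x) ∧
      eLpNorm G (ENNReal.ofReal p) μ ≤
        (Fintype.card U * A₁ : ℝ≥0) * eLpNorm F (ENNReal.ofReal p) μ := by
  obtain ⟨G, hG, hGle⟩ := hmax F hF
  refine ⟨fun x => Fintype.card U * G x, hG.aemeasurable.const_mul _, ?_, ?_⟩
  · intro σ t hσ ht f hf hfF
    filter_upwards [ae_all_iff.2 fun u => hG.le (t u) (ht u) f hf hfF] with x hx
    refine (enorm_comb_le hσ t f x).trans ((Finset.sum_le_sum fun u _ => hx u).trans ?_)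
    simp
  · rw [eLpNorm_ofReal _ hp] at hGle ⊢
    simp only [enorm_eq_self] at hGle ⊢
    have : ∀ x, ((Fintype.card U : ℝ≥0∞) * G x) ^ p = (Fintype.card U : ℝ≥0∞) ^ p * G x ^ p :=
      fun x => ENNReal.mul_rpow_of_nonneg _ _ hp.le
    simp_rw [this]
    rw [lintegral_const_mul'' _ (hG.aemeasurable.pow_const _),
      ENNReal.mul_rpow_of_nonneg _ _ (by positivity), ← ENNReal.rpow_mul,
      mul_one_div_cancel hp.ne', ENNReal.rpow_one, ENNReal.coe_mul, mul_assoc]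
    push_cast
    gcongr

theorem MaximalEstimate.eLpNorm_comb_le {p : ℝ} (hp : 0 < p) {A₁ : ℝ≥0}
    (hmax : MaximalEstimate μ H (ENNReal.ofReal p) A₁) {σ : U → ℝ} {t : U → Fin k → ℝ}
    (hσ : ∀ u, |σ u| ≤ 1) (ht : ∀ u, t u ∈ posOrthant k) {f : X → ℂ}
    (hf : MemLp f (ENNReal.ofReal p) μ) :
    eLpNorm (comb H σ t f) (ENNReal.ofReal p) μ ≤
      (Fintype.card U * A₁ : ℝ≥0) * eLpNorm f (ENNReal.ofReal p) μ := by
  obtain ⟨G, -, hG, hGle⟩ := hmax.exists_comb_le (U := U) hp hf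
  refine le_trans (eLpNorm_mono_enorm_ae ?_) hGle
  filter_upwards [hG σ t hσ ht f hf.1 (Eventually.of_forall fun x => le_rfl)] with x hx
  simpa using hx

variable {A B : Type*} [Fintype A] [Fintype B] [DecidableEq A]

/-- The vector-valued estimate for families of combinations of the operators `H_s`. Each component
of the input feeds at most `n` of the combinations, whose norms on `L^{p₀}` are at most `δ`, so that
the norm of the family on `L^{p₀}(ℓ^{p₀})` is at most `n^{1/p₀} δ`. -/
theorem eLpNorm_applyVec_comb_le {σ : B → U → ℝ} {t : B → U → Fin k → ℝ}
    (hT : ∀ b, IsL2Operator μ (comb H (σ b) (t b))) (hσ : ∀ b u, |σ b u| ≤ 1)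
    (ht : ∀ b u, t b u ∈ posOrthant k) {p₀ p₁ q q' : ℝ} (hp₀ : 1 ≤ p₀) (hp₀2 : p₀ ≤ 2)
    (hp₁ : 1 < p₁) (hq : q.HolderConjugate q')
    (hq₁ : q⁻¹ = (p₀ / 2) * p₀⁻¹ + (1 - p₀ / 2) * p₁⁻¹) {A₁ : ℝ≥0}
    (hmax : MaximalEstimate μ H (ENNReal.ofReal p₁) A₁) (π : B → A) {n : ℕ}
    (hn : ∀ a, (Finset.univ.filter fun b => π b = a).card ≤ n) {δ M₀ : ℝ≥0} (hM₀ : M₀ ≠ 0)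
    (hδM : n * δ ^ p₀ ≤ M₀ ^ p₀)
    (hδ : ∀ b f, MemLp f (ENNReal.ofReal p₀) μ →
      eLpNorm (comb H (σ b) (t b) f) (ENNReal.ofReal p₀) μ ≤ δ * eLpNorm f (ENNReal.ofReal p₀) μ)
    {f : X → EuclideanSpace ℂ A} (hf2 : MemLp f 2 μ) (hfq : MemLp f (ENNReal.ofReal q) μ) :
    eLpNorm (applyVec (fun b => comb H (σ b) (t b)) π f) (ENNReal.ofReal q) μ ≤
      ((2 * M₀) ^ (p₀ / 2) * (Fintype.card U * A₁) ^ (1 - p₀ / 2) : ℝ≥0) *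
        eLpNorm f (ENNReal.ofReal q) μ := by
  have hp₀0 : 0 < p₀ := by linarith
  have hq1 : 1 ≤ ENNReal.ofReal q := by
    rw [← ENNReal.ofReal_one]
    exact ENNReal.ofReal_le_ofReal hq.lt.le
  refine eLpNorm_applyVec_le_of_simpleFunc hT π hq1 ENNReal.ofReal_ne_top
    (eLpNorm_applyVec_le_of_maximal hT π hp₀ hp₀2 hp₁ hq hq₁ hM₀ ?_ ?_) hf2 hfq
  · intro f hf
    calc ∑ b, ∫⁻ x, ‖comb H (σ b) (t b) (f (π b)) x‖ₑ ^ p₀ ∂μ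
        ≤ ∑ b, (δ : ℝ≥0∞) ^ p₀ * ∫⁻ x, ‖f (π b) x‖ₑ ^ p₀ ∂μ :=
          Finset.sum_le_sum fun b _ =>
            lintegral_rpow_le_of_eLpNorm_le hp₀0 (hδ b _ (hf (π b) _))
      _ = (δ : ℝ≥0∞) ^ p₀ * ∑ a, ∑ b with π b = a, ∫⁻ x, ‖f (π b) x‖ₑ ^ p₀ ∂μ := by
          rw [← Finset.mul_sum, Finset.sum_fiberwise]
      _ ≤ (δ : ℝ≥0∞) ^ p₀ * ∑ a, n * ∫⁻ x, ‖f a x‖ₑ ^ p₀ ∂μ := by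
          gcongr with a
          calc _ = ∑ b with π b = a, ∫⁻ x, ‖f a x‖ₑ ^ p₀ ∂μ :=
                Finset.sum_congr rfl fun b hb => by rw [(Finset.mem_filter.1 hb).2]
            _ ≤ _ := by
                rw [Finset.sum_const, nsmul_eq_mul]
                gcongr
                exact hn a
      _ = (n * δ ^ p₀ : ℝ≥0) * ∑ a, ∫⁻ x, ‖f a x‖ₑ ^ p₀ ∂μ := by
          rw [← Finset.mul_sum, ← mul_assoc, ENNReal.coe_mul,
            ENNReal.coe_rpow_of_nonneg _ hp₀0.le, mul_comm ((δ : ℝ≥0∞) ^ p₀)]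
          rfl
      _ ≤ _ := by
          rw [← ENNReal.coe_rpow_of_nonneg _ hp₀0.le]
          gcongr
  · intro F hF
    obtain ⟨G, hGm, hG, hGle⟩ := hmax.exists_comb_le (U := U) (by linarith) hF
    exact ⟨G, hGm, fun b f hf hfF => hG (σ b) (t b) (hσ b) (ht b) f hf hfF, hGle⟩

end Combinations

/-! ### The estimate on `L²` -/

section SquareEstimate

variable {X : Type*} [MeasurableSpace X] {μ : Measure X} {k r : ℕ}
  {H : (Fin k → ℝ) → (X → ℂ) → X → ℂ} {U : Type*} [Fintype U] {M : Type*} [Fintype M]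
  {Γ : Finset (Fin r → ℤ)} {S : (Fin r → ℤ) → (X → ℂ) → X → ℂ}

theorem eLpNorm_two_toVec_le {B : Type*} [Fintype B] {F G : B → X → ℂ} {δ : ℝ≥0∞}
    (hF : ∀ b, AEStronglyMeasurable (F b) μ) (hG : ∀ b, AEStronglyMeasurable (G b) μ)
    (h : ∀ b, eLpNorm (F b) 2 μ ≤ δ * eLpNorm (G b) 2 μ) :
    eLpNorm (toVec F) 2 μ ≤ δ * eLpNorm (toVec G) 2 μ := by
  have h2 : ENNReal.ofReal 2 = 2 := by simp
  have hI : ∀ F : B → X → ℂ, (∀ b, AEStronglyMeasurable (F b) μ) →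
      ∫⁻ x, ‖toVec F x‖ₑ ^ (2 : ℝ) ∂μ = ∑ b, ∫⁻ x, ‖F b x‖ₑ ^ (2 : ℝ) ∂μ := by
    intro F hF
    rw [← lintegral_finsetSum' _ fun b _ => (hF b).enorm.pow_const _]
    exact lintegral_congr fun x => (sum_enorm_sq _).symm
  have h3 : ∀ F : B → X → ℂ, (∀ b, AEStronglyMeasurable (F b) μ) →
      eLpNorm (toVec F) 2 μ = (∑ b, ∫⁻ x, ‖F b x‖ₑ ^ (2 : ℝ) ∂μ) ^ (1 / 2 : ℝ) := by
    intro F hF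
    rw [← hI F hF, ← eLpNorm_ofReal _ two_pos, h2]
  rw [h3 F hF, h3 G hG]
  calc _ ≤ (δ ^ (2 : ℝ) * ∑ b, ∫⁻ x, ‖G b x‖ₑ ^ (2 : ℝ) ∂μ) ^ (1 / 2 : ℝ) := by
        refine ENNReal.rpow_le_rpow ?_ (by norm_num)
        rw [Finset.mul_sum]
        refine Finset.sum_le_sum fun b _ => lintegral_rpow_le_of_eLpNorm_le two_pos ?_
        rw [h2]
        exact h b
    _ = _ := by
        rw [ENNReal.mul_rpow_of_nonneg _ _ (by norm_num), ← ENNReal.rpow_mul]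
        norm_num

theorem le_rpow_mul_rpow {x a b : ℝ≥0∞} (ha : x ≤ a) (hb : x ≤ b) {s : ℝ} (h0 : 0 ≤ s)
    (h1 : s ≤ 1) : x ≤ a ^ s * b ^ (1 - s) := by
  calc x = x ^ s * x ^ (1 - s) := by
        rw [← ENNReal.rpow_add_of_nonneg _ _ h0 (by linarith)]
        simp
    _ ≤ _ := by
        gcongr

/-- The `L²` estimate of the pieces: the off-diagonal estimate gives decay in `h`, the size of the
operators gives decay in the number of blocks, and the geometric mean of the two has both. -/
theorem eLpNorm_two_comb_le {L : ℕ} {left : (Fin r → ℤ) → Fin k → ℝ}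
    {σ : (Fin r → ℤ) → M → U → ℝ} {t : (Fin r → ℤ) → M → U → Fin k → ℝ}
    (hH : ∀ g m u, IsL2Operator μ (H (t g m u)))
    (hσ : ∀ g m u, |σ g m u| ≤ 1) (ht : ∀ g m u, t g m u ∈ cube L (left g))
    (hS : ∀ g, IsL2Operator μ (S g)) {c : ℝ} {h : Fin r → ℤ}
    (hoff : ∀ t' : (Fin r → ℤ) → Fin k → ℝ, (∀ g, t' g ∈ cube L (left g)) →
      ∀ f, MemLp f 2 μ →
        eLpNorm (squareFn fun g => H (t' g) (S (g + h) f)) 2 μ ≤ ENNReal.ofReal c * eLpNorm f 2 μ)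
    {a A' : ℝ≥0} (hLP : ∀ f, MemLp f 2 μ → eLpNorm (squareFn fun g => S g f) 2 μ ≤
      a * eLpNorm f 2 μ)
    (hδ : ∀ g m f, MemLp f 2 μ → eLpNorm (comb H (σ g m) (t g m) f) 2 μ ≤
      (A' / Fintype.card M : ℝ≥0) * eLpNorm f 2 μ) [Nonempty M]
    {ε : ℝ} (hε : ε ∈ Set.Ioo (0 : ℝ) (1 / 2)) {f : X → ℂ} (hf : MemLp f 2 μ) :
    eLpNorm (toVec fun b : Γ × M => comb H (σ b.1 b.2) (t b.1 b.2) (S (b.1 + h) f)) 2 μ ≤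
      ((Fintype.card U * c.toNNReal) ^ (1 / 2 - ε) * (A' * a) ^ (1 / 2 + ε) *
        (Fintype.card M : ℝ≥0) ^ (-ε) : ℝ≥0) * eLpNorm f 2 μ := by
  set N : ℝ≥0 := (Fintype.card M : ℝ≥0) with hN
  have hN0 : N ≠ 0 := by simp [hN]
  have hSf : ∀ g, MemLp (S g f) 2 μ := fun g => (hS g).memLp f hf
  have hHm : ∀ g m u g', AEStronglyMeasurable (H (t g m u) (S g' f)) μ := fun g m u g' =>
    (hH g m u).linear.aestronglyMeasurable _ (hSf g')
  have hcm : ∀ g m g', AEStronglyMeasurable (comb H (σ g m) (t g m) (S g' f)) μ := fun g m g' =>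
    Finset.aestronglyMeasurable_fun_sum _ fun u _ => (hHm g m u g').const_mul _
  -- decay in `h`: a fixed block is a combination of `|U|` off-diagonal square functions
  have h1 : ∀ m, eLpNorm (toVec fun g : Γ => comb H (σ g m) (t g m) (S (g + h) f)) 2 μ ≤
      (Fintype.card U * c.toNNReal : ℝ≥0) * eLpNorm f 2 μ := by
    intro m
    have e1 : (toVec fun g : Γ => comb H (σ g m) (t g m) (S (g + h) f)) =
        ∑ u, toVec fun g : Γ => fun x => (σ g m u : ℂ) * H (t g m u) (S (g + h) f) x := by
      funext x
      ext g
      simp [comb, Finset.sum_apply]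
    rw [e1]
    refine (eLpNorm_sum_le (p := 2) (μ := μ) (s := Finset.univ) (f := fun u => toVec
      fun g : Γ => fun x => (σ g m u : ℂ) * H (t g m u) (S (g + h) f) x)
      (fun u _ => aestronglyMeasurable_toVec fun g =>
        (hHm _ _ _ _).const_mul _) (by norm_num)).trans ?_
    have e2 : ∀ u, eLpNorm (toVec fun g : Γ => fun x =>
        (σ g m u : ℂ) * H (t g m u) (S (g + h) f) x) 2 μ ≤ ENNReal.ofReal c * eLpNorm f 2 μ := by
      intro u
      refine le_trans ?_ (hoff (fun g => t g m u) (fun g => ht g m u) f hf)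
      refine le_trans (eLpNorm_mono_enorm fun x => ?_) (eLpNorm_toVec_le_squareFn
        (fun g => H (t g m u) (S (g + h) f)) (Subtype.val_injective (p := (· ∈ Γ))) 2)
      rw [enorm_euclidean, enorm_euclidean]
      gcongr with g
      simp only [toVec_apply]
      rw [enorm_mul]
      refine mul_le_of_le_one_left zero_le ?_
      rw [← ofReal_norm, Complex.norm_real, Real.norm_eq_abs]
      exact ENNReal.ofReal_le_one.2 (hσ _ _ u)
    refine (Finset.sum_le_sum fun u _ => e2 u).trans (le_of_eq ?_)
    rw [Finset.sum_const, nsmul_eq_mul, ← mul_assoc]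
    push_cast
    rfl
  -- decay in the number of blocks
  have h2 : ∀ m, eLpNorm (toVec fun g : Γ => comb H (σ g m) (t g m) (S (g + h) f)) 2 μ ≤
      (A' / N * a : ℝ≥0) * eLpNorm f 2 μ := by
    intro m
    refine (eLpNorm_two_toVec_le (δ := ((A' / N : ℝ≥0) : ℝ≥0∞)) (fun g : Γ => hcm g m (g + h))
      (fun g : Γ => (hSf (g + h)).1) (fun g => hδ g m _ (hSf _))).trans ?_
    rw [ENNReal.coe_mul, mul_assoc]
    gcongr
    refine le_trans ?_ (hLP f hf)
    exact eLpNorm_toVec_le_squareFn (fun g => S g f) (e := fun g : Γ => (g : Fin r → ℤ) + h)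
      (fun g g' hg => Subtype.ext (add_right_cancel hg)) 2
  have h3 : ∀ K : ℝ≥0∞,
      (∀ m, eLpNorm (toVec fun g : Γ => comb H (σ g m) (t g m) (S (g + h) f)) 2 μ ≤ K) →
      eLpNorm (toVec fun b : Γ × M => comb H (σ b.1 b.2) (t b.1 b.2) (S (b.1 + h) f)) 2 μ ≤
        (N : ℝ≥0∞) ^ (1 / 2 : ℝ) * K := by
    intro K hK
    have h2 : ENNReal.ofReal 2 = 2 := by simp
    have h3 := eLpNorm_toVec_prod_le (p := 2) (μ := μ) (K := K) le_rfl
      (F := fun b : Γ × M => comb H (σ b.1 b.2) (t b.1 b.2) (S (b.1 + h) f))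
      (fun b => hcm _ _ _) (fun m => by rw [h2]; exact hK m)
    rwa [h2] at h3
  have hs0 : 0 ≤ 1 / 2 - ε := by linarith [hε.2]
  have hs1 : 0 ≤ 1 / 2 + ε := by linarith [hε.1]
  refine (h3 _ fun m => le_rpow_mul_rpow (h1 m) (h2 m) hs0 (by linarith [hε.1])).trans
    (le_of_eq ?_)
  rw [show 1 - (1 / 2 - ε) = 1 / 2 + ε by ring, ENNReal.mul_rpow_of_nonneg _ _ hs0,
    ENNReal.mul_rpow_of_nonneg _ _ hs1]
  have e3 : eLpNorm f 2 μ ^ (1 / 2 - ε) * eLpNorm f 2 μ ^ (1 / 2 + ε) = eLpNorm f 2 μ := by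
    rw [← ENNReal.rpow_add_of_nonneg _ _ hs0 hs1]
    ring_nf
    simp
  have e4 : (N ^ (1 / 2 : ℝ) * (A' / N * a) ^ (1 / 2 + ε) : ℝ≥0) =
      (A' * a) ^ (1 / 2 + ε) * N ^ (-ε) := by
    rw [show A' / N * a = A' * a * N⁻¹ by rw [div_eq_mul_inv, mul_right_comm], NNReal.mul_rpow,
      NNReal.inv_rpow, ← NNReal.rpow_neg, mul_left_comm, ← NNReal.rpow_add hN0]
    congr 2
    ring
  calc _ = (((Fintype.card U * c.toNNReal : ℝ≥0) ^ (1 / 2 - ε) *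
        (N ^ (1 / 2 : ℝ) * (A' / N * a) ^ (1 / 2 + ε)) : ℝ≥0) : ℝ≥0∞) *
          (eLpNorm f 2 μ ^ (1 / 2 - ε) * eLpNorm f 2 μ ^ (1 / 2 + ε)) := by
        generalize (Fintype.card U * c.toNNReal : ℝ≥0) = y, (A' / N * a : ℝ≥0) = z
        rw [ENNReal.coe_mul, ENNReal.coe_mul, ENNReal.coe_rpow_of_nonneg _ hs0,
          ENNReal.coe_rpow_of_nonneg _ hs1, ENNReal.coe_rpow_of_nonneg _ (by norm_num)]
        ring
    _ = _ := by rw [e3, e4, mul_assoc]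

end SquareEstimate

/-! ### Block families -/

section Blocks

variable {X : Type*} [MeasurableSpace X] {μ : Measure X} {k r : ℕ}
  {H : (Fin k → ℝ) → (X → ℂ) → X → ℂ} {U : Type*} [Fintype U] {M : Type*} [Fintype M]
  {L : ℕ} {left : (Fin r → ℤ) → Fin k → ℝ}
  {S : (Fin r → ℤ) → (X → ℂ) → X → ℂ}

/-- A family of linear combinations `∑_u σ_{g,m,u} H_{t_{g,m,u}}`, where `m` runs over a finite set
`M` of blocks, with nodes in the cube of index `g` and coefficients of size at most `1`, whose
norms on `L^{p₀}` and on `L²` are at most `A / |M|`. -/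
structure IsBlockFamily (μ : Measure X) (H : (Fin k → ℝ) → (X → ℂ) → X → ℂ) (L : ℕ)
    (left : (Fin r → ℤ) → Fin k → ℝ) (p₀ : ℝ≥0∞) (A : ℝ≥0)
    (σ : (Fin r → ℤ) → M → U → ℝ) (t : (Fin r → ℤ) → M → U → Fin k → ℝ) : Prop where
  abs_le : ∀ g m u, |σ g m u| ≤ 1
  mem_cube : ∀ g m u, t g m u ∈ cube L (left g)
  bound : ∀ p, p = p₀ ∨ p = 2 → ∀ g m f, MemLp f p μ →
    eLpNorm (comb H (σ g m) (t g m) f) p μ ≤ (A / Fintype.card M : ℝ≥0) * eLpNorm f p μ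

theorem LittlewoodPaleyEstimate.eLpNorm_toVec_le {p : ℝ≥0∞} {a : ℝ≥0}
    (h : LittlewoodPaleyEstimate μ S p a) {Γ : Type*} [Fintype Γ] {e : Γ → Fin r → ℤ}
    (he : Function.Injective e) {f : X → ℂ} (hf : MemLp f p μ) :
    eLpNorm (toVec fun g => S (e g) f) p μ ≤ a * eLpNorm f p μ :=
  (eLpNorm_toVec_le_squareFn (fun g => S g f) he p).trans (h.bound f hf)

theorem LittlewoodPaleyEstimate.isL2Operator {a : ℝ≥0} (h : LittlewoodPaleyEstimate μ S 2 a)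
    (g : Fin r → ℤ) : IsL2Operator μ (S g) where
  linear := h.linear g
  bound := by
    refine ⟨a, fun f hf => ?_⟩
    have := h.eLpNorm_toVec_le (e := fun _ : Unit => g) (fun _ _ _ => rfl) hf
    rwa [eLpNorm_toVec_unit] at this

theorem IsBlockFamily.isL2Operator {p₀ : ℝ≥0∞} {A : ℝ≥0} {σ : (Fin r → ℤ) → M → U → ℝ}
    {t : (Fin r → ℤ) → M → U → Fin k → ℝ} (hT : IsBlockFamily μ H L left p₀ A σ t)
    (hH : ∀ g, ∀ s ∈ cube L (left g), IsL2Operator μ (H s)) (g : Fin r → ℤ) (m : M) :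
    IsL2Operator μ (comb H (σ g m) (t g m)) where
  linear := IsLinearOperator.comb fun u => (hH g _ (hT.mem_cube g m u)).linear
  bound := ⟨_, hT.bound 2 (Or.inr rfl) g m⟩

theorem tsum_rpow_le_rpow_tsum {ι : Type*} (x : ι → ℝ≥0∞) {s : ℝ} (hs : 1 ≤ s) :
    ∑' i, x i ^ s ≤ (∑' i, x i) ^ s := by
  have h : ∀ y : ℝ≥0∞, y ^ s = y * y ^ (s - 1) := fun y => by
    conv_rhs => rw [← ENNReal.rpow_one y, ← ENNReal.rpow_mul, one_mul]
    rw [← ENNReal.rpow_add_of_nonneg _ _ zero_le_one (by linarith)]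
    ring_nf
  rw [h, ← ENNReal.tsum_mul_right]
  refine ENNReal.tsum_le_tsum fun i => ?_
  rw [h]
  gcongr
  exact ENNReal.le_tsum i

/-- From a vector-valued inequality for a block family on `L^q` to a bound on `L^p`, `p` between
`q` and `2`, with decay in the number of blocks. The condition `τ ≤ θ` makes the interpolated factors
`c_h^{(1/2 - ε) θ}` summable. -/
theorem IsBlockFamily.eLpNorm_toVec_le {p₀ p₁ : ℝ≥0∞} (hp₀2 : p₀ < 2) {A : ℝ≥0}
    {σ : (Fin r → ℤ) → M → U → ℝ} {t : (Fin r → ℤ) → M → U → Fin k → ℝ} [Nonempty M]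
    (hT : IsBlockFamily μ H L left p₀ A σ t)
    (hH : ∀ g, ∀ s ∈ cube L (left g), IsL2Operator μ (H s))
    {c : (Fin r → ℤ) → ℝ} {ε : ℝ} (hε : ε ∈ Set.Ioo (0 : ℝ) (1 / 2)) {A₄ : ℝ≥0∞ → ℝ≥0} {B : ℝ≥0}
    (hLP : LittlewoodPaley μ H S L left c p₀ p₁ ε A₄ B) {q q' p p' θ τ : ℝ}
    (hq : q.HolderConjugate q') (hp : p.HolderConjugate p')
    (hτ : τ = (p₁.toReal - p₀.toReal) / (2 - p₀.toReal)) (hτ0 : 0 < τ) (hτθ : τ ≤ θ) (hθ1 : θ ≤ 1)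
    (hpθ : p⁻¹ = (1 - θ) * q⁻¹ + θ * 2⁻¹) {aq V : ℝ≥0}
    (hLPq : LittlewoodPaleyEstimate μ S (ENNReal.ofReal q) aq) (Γ : Finset (Fin r → ℤ))
    (hV : ∀ F : X → EuclideanSpace ℂ Γ, MemLp F 2 μ → MemLp F (ENNReal.ofReal q) μ →
      eLpNorm (applyVec (fun b : Γ × M => comb H (σ b.1 b.2) (t b.1 b.2)) Prod.fst F)
        (ENNReal.ofReal q) μ ≤ V * eLpNorm F (ENNReal.ofReal q) μ)
    {f : X → ℂ} (hf2 : MemLp f 2 μ) (hfp : MemLp f (ENNReal.ofReal p) μ) :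
    eLpNorm (toVec fun b : Γ × M => comb H (σ b.1 b.2) (t b.1 b.2) f) (ENNReal.ofReal p) μ ≤
      ((V * aq) ^ (1 - θ) *
        ((Fintype.card U : ℝ≥0) ^ (1 / 2 - ε) * (A * A₄ 2) ^ (1 / 2 + ε)) ^ θ * B ^ (θ / τ) *
        (Fintype.card M : ℝ≥0) ^ (-(ε * θ)) : ℝ≥0) * eLpNorm f (ENNReal.ofReal p) μ := by
  have hLP2 : LittlewoodPaleyEstimate μ S 2 (A₄ 2) := hLP.square 2 ⟨hp₀2, le_rfl⟩
  obtain ⟨E, -, hE⟩ := hLP.resolution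
  have hθ0 : 0 ≤ θ := hτ0.le.trans hτθ
  set N : ℝ≥0 := (Fintype.card M : ℝ≥0) with hN
  have hs0 : 0 ≤ 1 / 2 - ε := by linarith [hε.2]
  refine (eLpNorm_toVec_le_tsum (T := fun b : Γ × M => comb H (σ b.1 b.2) (t b.1 b.2))
    (fun b => hT.isL2Operator hH _ _) hLP2.isL2Operator E hE hq hp ⟨hθ0, hθ1⟩ hpθ
    (V := V * aq) (W := fun h => (Fintype.card U * (c h).toNNReal) ^ (1 / 2 - ε) *
      (A * A₄ 2) ^ (1 / 2 + ε) * N ^ (-ε)) ?_ ?_ hf2 hfp).trans ?_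
  · intro h f hf2 hfq
    have inj : Function.Injective fun g : Γ => (g : Fin r → ℤ) + h := fun g g' hg =>
      Subtype.ext (add_right_cancel hg)
    have h2 := hLP2.eLpNorm_toVec_le inj hf2
    have hq := hLPq.eLpNorm_toVec_le inj hfq
    refine (hV (toVec fun g : Γ => S (g + h) f)
      ⟨aestronglyMeasurable_toVec fun g => (hLP2.linear _).aestronglyMeasurable f hf2,
        h2.trans_lt (ENNReal.mul_lt_top ENNReal.coe_lt_top hf2.2)⟩
      ⟨aestronglyMeasurable_toVec fun g => (hLP2.linear _).aestronglyMeasurable f hf2,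
        hq.trans_lt (ENNReal.mul_lt_top ENNReal.coe_lt_top hfq.2)⟩).trans ?_
    rw [ENNReal.coe_mul, mul_assoc]
    gcongr
  · intro h f hf2
    exact eLpNorm_two_comb_le (fun g m u => hH g _ (hT.mem_cube g m u)) hT.abs_le hT.mem_cube
      hLP2.isL2Operator (fun t' ht' => hLP.offDiag h t' ht') hLP2.bound
      (hT.bound 2 (Or.inr rfl)) hε hf2
  · gcongr
    have e1 : ∀ h, (V * aq) ^ (1 - θ) * ((Fintype.card U * (c h).toNNReal) ^ (1 / 2 - ε) *
        (A * A₄ 2) ^ (1 / 2 + ε) * N ^ (-ε)) ^ θ =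
        ((V * aq) ^ (1 - θ) *
          ((Fintype.card U : ℝ≥0) ^ (1 / 2 - ε) * (A * A₄ 2) ^ (1 / 2 + ε)) ^ θ *
          N ^ (-(ε * θ))) * ((c h).toNNReal ^ ((1 / 2 - ε) * τ)) ^ (θ / τ) := by
      intro h
      rw [← NNReal.rpow_mul, show (1 / 2 - ε) * τ * (θ / τ) = (1 / 2 - ε) * θ by field_simp,
        NNReal.mul_rpow (x := (Fintype.card U : ℝ≥0)), NNReal.rpow_mul _ _ θ]
      simp only [NNReal.mul_rpow]
      rw [← NNReal.rpow_mul N, neg_mul]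
      ring
    simp_rw [e1, ENNReal.coe_mul _ (_ ^ (θ / τ))]
    rw [ENNReal.tsum_mul_left, mul_right_comm _ (B ^ (θ / τ)), ENNReal.coe_mul _ (B ^ (θ / τ))]
    gcongr
    have hθτ : 1 ≤ θ / τ := (one_le_div hτ0).2 hτθ
    simp_rw [ENNReal.coe_rpow_of_nonneg _ (zero_le_one.trans hθτ)]
    refine (tsum_rpow_le_rpow_tsum _ hθτ).trans ?_
    gcongr
    refine le_trans (le_of_eq (tsum_congr fun h => ?_)) hLP.summable
    rw [← hτ, ENNReal.ofReal, Real.toNNReal_rpow_of_nonneg (hLP.pos h).le]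

/-- Monotone convergence: a bound uniform in the finite sets of indices holds for the full square
function. -/
theorem eLpNorm_tsum_sum_le {ι : Type*} [Countable ι] {F : ι → M → X → ℂ}
    (hF : ∀ g m, AEStronglyMeasurable (F g m) μ) {p : ℝ} (hp : 0 < p) {K : ℝ≥0∞}
    (h : ∀ Γ : Finset ι, eLpNorm (toVec fun b : Γ × M => F b.1 b.2) (ENNReal.ofReal p) μ ≤ K) :
    eLpNorm (fun x => (∑' g, ∑ m, ‖F g m x‖ₑ ^ (2 : ℝ)) ^ (1 / 2 : ℝ)) (ENNReal.ofReal p) μ ≤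
      K := by
  have hp2 : 0 < p / 2 := by positivity
  have hK : ∀ Γ : Finset ι, ∫⁻ x, (∑ g ∈ Γ, ∑ m, ‖F g m x‖ₑ ^ (2 : ℝ)) ^ (p / 2) ∂μ ≤ K ^ p := by
    intro Γ
    have h1 := h Γ
    rw [eLpNorm_ofReal _ hp] at h1
    have h2 := ENNReal.rpow_le_rpow h1 hp.le
    rw [← ENNReal.rpow_mul, one_div, inv_mul_cancel₀ hp.ne', ENNReal.rpow_one] at h2
    refine le_trans (le_of_eq (lintegral_congr fun x => ?_)) h2
    rw [show p = 2 * (p / 2) by ring, ENNReal.rpow_mul, ← sum_enorm_sq, Fintype.sum_prod_type]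
    simp only [toVec_apply]
    rw [Finset.sum_coe_sort Γ fun g => ∑ m, ‖F g m x‖ₑ ^ (2 : ℝ)]
    congr 2
    ring
  rw [eLpNorm_ofReal _ hp]
  have h3 : ∫⁻ x, ‖(∑' g, ∑ m, ‖F g m x‖ₑ ^ (2 : ℝ)) ^ (1 / 2 : ℝ)‖ₑ ^ p ∂μ ≤ K ^ p := by
    have e1 : ∀ x, ‖(∑' g, ∑ m, ‖F g m x‖ₑ ^ (2 : ℝ)) ^ (1 / 2 : ℝ)‖ₑ ^ p =
        ⨆ Γ : Finset ι, (∑ g ∈ Γ, ∑ m, ‖F g m x‖ₑ ^ (2 : ℝ)) ^ (p / 2) := by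
      intro x
      rw [enorm_eq_self, ← ENNReal.rpow_mul, show (1 / 2 : ℝ) * p = p / 2 by ring,
        ENNReal.tsum_eq_iSup_sum]
      exact (ENNReal.orderIsoRpow (p / 2) hp2).map_iSup _
    simp_rw [e1]
    rw [lintegral_iSup_directed]
    · exact iSup_le hK
    · exact fun Γ => (Finset.aemeasurable_fun_sum _ fun g _ => Finset.aemeasurable_fun_sum _
        fun m _ => (hF g m).enorm.pow_const _).pow_const _
    · refine Monotone.directed_le fun Γ Γ' hΓ x => ?_
      exact ENNReal.rpow_le_rpow (Finset.sum_le_sum_of_subset hΓ) hp2.le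
  calc _ ≤ (K ^ p) ^ (1 / p) := ENNReal.rpow_le_rpow h3 (by positivity)
    _ = K := by rw [← ENNReal.rpow_mul, mul_one_div_cancel hp.ne', ENNReal.rpow_one]

end Blocks

/-! ### Truncation, and density for exponents below two -/

section Truncation

variable {X : Type*} [MeasurableSpace X] {μ : Measure X}

/-- Truncation of a function of `L^p` at the heights `1, 2, …`: the truncated functions belong to
the higher `L^v`, and the remainders tend to `0` in the lower `L^s`. -/
theorem exists_truncation {s p v : ℝ} (hs : 0 < s) (hsp : s ≤ p) (hpv : p ≤ v) {f : X → ℂ}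
    (hf : MemLp f (ENNReal.ofReal p) μ) :
    ∃ g : ℕ → X → ℂ, (∀ j, MemLp (g j) (ENNReal.ofReal v) μ) ∧
      (∀ j, AEStronglyMeasurable (g j) μ) ∧ (∀ j x, ‖g j x‖ ≤ ‖f x‖) ∧
      (∀ j, MemLp (f - g j) (ENNReal.ofReal s) μ) ∧
      Tendsto (fun j => eLpNorm (f - g j) (ENNReal.ofReal s) μ) atTop (𝓝 0) := by
  have hp : 0 < p := hs.trans_le hsp
  have hv : 0 < v := hp.trans_le hpv
  have hI : ∫⁻ x, ‖f x‖ₑ ^ p ∂μ < ∞ := by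
    have h1 := hf.2
    rw [eLpNorm_ofReal _ hp] at h1
    by_contra h
    rw [not_lt, top_le_iff] at h
    rw [h, ENNReal.top_rpow_of_pos (by positivity)] at h1
    exact lt_irrefl _ h1
  let E : ℕ → Set X := fun j => {x | ‖f x‖ₑ ≤ ((j + 1 : ℕ) : ℝ≥0∞)}
  have hE : ∀ j, NullMeasurableSet (E j) μ := fun j =>
    nullMeasurableSet_le hf.1.enorm aemeasurable_const
  have hg : ∀ j, AEStronglyMeasurable ((E j).indicator f) μ := fun j => hf.1.indicator₀ (hE j)
  have hw : ∀ j x, ‖(f - (E j).indicator f) x‖ₑ ^ s ≤ ‖f x‖ₑ ^ p := by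
    intro j x
    by_cases hx : x ∈ E j
    · simp [hx, hs]
    · have h1 : 1 ≤ ‖f x‖ₑ := by
        refine le_trans ?_ (le_of_lt (not_le.1 hx))
        exact_mod_cast Nat.le_add_left 1 j
      simp only [Pi.sub_apply, Set.indicator_of_notMem hx, sub_zero]
      exact ENNReal.rpow_le_rpow_of_exponent_le h1 hsp
  have hmem : ∀ {q : ℝ}, 0 < q → ∀ {u : X → ℂ}, AEStronglyMeasurable u μ →
      ∫⁻ x, ‖u x‖ₑ ^ q ∂μ < ∞ → MemLp u (ENNReal.ofReal q) μ := by
    intro q hq u hu h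
    refine ⟨hu, ?_⟩
    rw [eLpNorm_ofReal _ hq]
    exact ENNReal.rpow_lt_top_of_nonneg (by positivity) h.ne
  refine ⟨fun j => (E j).indicator f, fun j => hmem hv (hg j) ?_, hg, fun j x => ?_,
    fun j => hmem hs (hf.1.sub (hg j)) ?_, ?_⟩
  · have h1 : ∀ x, ‖(E j).indicator f x‖ₑ ^ v ≤
        ((j + 1 : ℕ) : ℝ≥0∞) ^ (v - p) * ‖f x‖ₑ ^ p := by
      intro x
      by_cases hx : x ∈ E j
      · rw [Set.indicator_of_mem hx]
        calc ‖f x‖ₑ ^ v = ‖f x‖ₑ ^ (v - p) * ‖f x‖ₑ ^ p := by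
              rw [← ENNReal.rpow_add_of_nonneg _ _ (by linarith) hp.le]
              ring_nf
          _ ≤ _ := by
              gcongr
              exact hx
      · rw [Set.indicator_of_notMem hx]
        simp [hv]
    refine (lintegral_mono h1).trans_lt ?_
    rw [lintegral_const_mul' _ _ (ENNReal.rpow_ne_top_of_nonneg (by linarith)
      (ENNReal.natCast_ne_top _))]
    exact ENNReal.mul_lt_top (ENNReal.rpow_lt_top_of_nonneg (by linarith)
      (ENNReal.natCast_ne_top _)) hI
  · exact norm_indicator_le_norm_self _ _
  · exact (lintegral_mono (hw j)).trans_lt hI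
  · simp_rw [eLpNorm_ofReal _ hs]
    have h1 : Tendsto (fun j => ∫⁻ x, ‖(f - (E j).indicator f) x‖ₑ ^ s ∂μ) atTop
        (𝓝 (∫⁻ _, 0 ∂μ)) := by
      refine tendsto_lintegral_of_dominated_convergence' _
        (fun j => (hf.1.sub (hg j)).enorm.pow_const _)
        (fun j => Eventually.of_forall (hw j)) hI.ne (Eventually.of_forall fun x => ?_)
      obtain ⟨N, hN⟩ := ENNReal.exists_nat_gt (enorm_ne_top (x := f x))
      refine tendsto_const_nhds.congr' ?_
      filter_upwards [eventually_ge_atTop N] with j hj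
      have hx : x ∈ E j := hN.le.trans (by exact_mod_cast hj.trans (Nat.le_succ j))
      simp [hx, hs]
    rw [lintegral_zero] at h1
    have h2 := h1.ennrpow_const (1 / s)
    rwa [ENNReal.zero_rpow_of_pos (by positivity)] at h2

theorem lpFun_subset_sumLpFun {s p v : ℝ} (hs : 0 < s) (hsp : s ≤ p) (hpv : p ≤ v) :
    LpFun (ENNReal.ofReal p) μ ⊆ SumLpFun (ENNReal.ofReal s) (ENNReal.ofReal v) μ := by
  intro f hf
  obtain ⟨g, h1, -, -, h2, -⟩ := exists_truncation hs hsp hpv hf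
  exact ⟨f - g 0, g 0, h2 0, h1 0, by simp⟩

end Truncation

section BlocksBelowTwo

variable {X : Type*} [MeasurableSpace X] {μ : Measure X} {k r : ℕ}
  {H : (Fin k → ℝ) → (X → ℂ) → X → ℂ} {U : Type*} [Fintype U] {B : Type*} [Fintype B]

theorem IsLinearOperator.map_sub {D : Set (X → ℂ)} {T : (X → ℂ) → X → ℂ}
    (hT : IsLinearOperator D μ T) {f g : X → ℂ} (hf : f ∈ D) (hg : g ∈ D)
    (hg' : (-1 : ℂ) • g ∈ D) : T (f - g) =ᵐ[μ] T f - T g := by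
  have h1 := hT.add f hf _ hg'
  have h2 := hT.smul (-1) g hg
  rw [show f - g = f + (-1 : ℂ) • g by simp [sub_eq_add_neg]]
  filter_upwards [h1, h2] with x hx1 hx2
  rw [hx1, Pi.add_apply, hx2]
  simp [sub_eq_add_neg]

/-- For `p₁ ≤ p ≤ 2` a bound on `L² ∩ L^p` extends to `L^p`, as the maximal inequality makes the
operators continuous on `L^{p₁}`. -/
theorem eLpNorm_toVec_comb_le_of_inter {p₀ p₁ p : ℝ} (hp₀ : 0 < p₀) (hp₀₁ : p₀ ≤ p₁)
    (h1 : 1 ≤ p₁) (hp₁ : p₁ ≤ p) (hp2 : p ≤ 2) {σ : B → U → ℝ} {t : B → U → Fin k → ℝ}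
    (hσ : ∀ b u, |σ b u| ≤ 1) (ht : ∀ b u, t b u ∈ posOrthant k)
    (hlin : ∀ s ∈ posOrthant k, IsLinearOperator (SumLpFun (ENNReal.ofReal p₀) 2 μ) μ (H s))
    {A₁ : ℝ≥0} (hmax : MaximalEstimate μ H (ENNReal.ofReal p₁) A₁) {K : ℝ≥0}
    (hK : ∀ f, MemLp f 2 μ → MemLp f (ENNReal.ofReal p) μ →
      eLpNorm (toVec fun b => comb H (σ b) (t b) f) (ENNReal.ofReal p) μ ≤
        K * eLpNorm f (ENNReal.ofReal p) μ)
    {f : X → ℂ} (hf : MemLp f (ENNReal.ofReal p) μ) :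
    eLpNorm (toVec fun b => comb H (σ b) (t b) f) (ENNReal.ofReal p) μ ≤
      K * eLpNorm f (ENNReal.ofReal p) μ := by
  have e2 : ENNReal.ofReal 2 = 2 := by simp
  have hp₁0 : 0 < p₁ := by linarith
  obtain ⟨g, hg2, hgm, hgf, hgs, hlim⟩ := exists_truncation hp₁0 hp₁ hp2 hf
  have hD : ∀ u {q : ℝ}, p₁ ≤ q → q ≤ 2 → MemLp u (ENNReal.ofReal q) μ →
      u ∈ SumLpFun (ENNReal.ofReal p₀) 2 μ := fun u q h1 h2 hu =>
    e2 ▸ lpFun_subset_sumLpFun hp₀ (hp₀₁.trans h1) h2 hu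
  have hT : ∀ b, IsLinearOperator (SumLpFun (ENNReal.ofReal p₀) 2 μ) μ (comb H (σ b) (t b)) :=
    fun b => IsLinearOperator.comb fun u => hlin _ (ht b u)
  have hgp : ∀ j, MemLp (g j) (ENNReal.ofReal p) μ := fun j =>
    hf.of_le (hgm j) (Eventually.of_forall (hgf j))
  have hsub : ∀ b j, comb H (σ b) (t b) (f - g j) =ᵐ[μ]
      comb H (σ b) (t b) f - comb H (σ b) (t b) (g j) := fun b j =>
    (hT b).map_sub (hD _ hp₁ hp2 hf) (hD _ hp₁ hp2 (hgp j)) (hD _ hp₁ hp2 ((hgp j).const_smul _))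
  have hfm : ∀ b, AEStronglyMeasurable (comb H (σ b) (t b) f) μ := fun b =>
    (hT b).aestronglyMeasurable _ (hD _ hp₁ hp2 hf)
  have hgjm : ∀ b j, AEStronglyMeasurable (comb H (σ b) (t b) (g j)) μ := fun b j =>
    (hT b).aestronglyMeasurable _ (hD _ hp₁ hp2 (hgp j))
  refine eLpNorm_le_of_tendstoInMeasure_of_tendsto
    (f := fun j => toVec fun b => comb H (σ b) (t b) (g j))
    (c := fun _ => K * eLpNorm f (ENNReal.ofReal p) μ) (fun j => ?_) tendsto_const_nhds ?_
    (fun j => aestronglyMeasurable_toVec fun b => hgjm b j)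
  · refine (hK (g j) (e2 ▸ hg2 j) (hgp j)).trans ?_
    gcongr
    exact eLpNorm_mono (hgf j)
  · refine tendstoInMeasure_of_tendsto_eLpNorm (p := ENNReal.ofReal p₁)
      (by simpa using hp₁0) (fun j => aestronglyMeasurable_toVec fun b => hgjm b j)
      (aestronglyMeasurable_toVec hfm) ?_
    have hle : ∀ j, eLpNorm ((toVec fun b => comb H (σ b) (t b) (g j)) -
        toVec fun b => comb H (σ b) (t b) f) (ENNReal.ofReal p₁) μ ≤
        ∑ _b : B, (Fintype.card U * A₁ : ℝ≥0) * eLpNorm (f - g j) (ENNReal.ofReal p₁) μ := by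
      intro j
      rw [eLpNorm_sub_comm]
      have e3 : (toVec fun b => comb H (σ b) (t b) f) - (toVec fun b => comb H (σ b) (t b) (g j)) =
          toVec fun b => comb H (σ b) (t b) f - comb H (σ b) (t b) (g j) := by
        funext x
        ext b
        simp
      rw [e3]
      refine (eLpNorm_toVec_le_sum ?_ fun b => (hfm b).sub (hgjm b j)).trans
        (Finset.sum_le_sum fun b _ => ?_)
      · rw [← ENNReal.ofReal_one]
        exact ENNReal.ofReal_le_ofReal h1
      · rw [← eLpNorm_congr_ae (hsub b j)]
        exact hmax.eLpNorm_comb_le hp₁0 (hσ b) (ht b) (hgs j)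
    refine tendsto_of_tendsto_of_tendsto_of_le_of_le tendsto_const_nhds ?_ (fun _ => zero_le) hle
    have : Tendsto (fun j => ∑ _b : B, (Fintype.card U * A₁ : ℝ≥0) *
        eLpNorm (f - g j) (ENNReal.ofReal p₁) μ) atTop
        (𝓝 (∑ _b : B, ((Fintype.card U * A₁ : ℝ≥0) : ℝ≥0∞) * 0)) :=
      tendsto_finsetSum _ fun b _ => ENNReal.Tendsto.const_mul hlim (Or.inr ENNReal.coe_ne_top)
    simpa using this

end BlocksBelowTwo

/-! ### Differences on the cubes as block families -/

section DifferenceBlocks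

variable {k : ℕ}

/-- The telescoping inverse of the inclusion-exclusion formula for `multiDiff`. -/
theorem sum_multiDiff (K : Finset (Fin k)) (h : Fin k → ℝ) (a : (Fin k → ℝ) → ℂ)
    (s : Fin k → ℝ) : ∑ K' ∈ K.powerset, multiDiff K' h a s = a (shiftOn K h s) := by
  induction K using Finset.induction_on generalizing s with
  | empty =>
    have hs : shiftOn ∅ h s = s := by
      funext i
      simp [shiftOn]
    simp [multiDiff_empty, hs]
  | insert j K hj ih =>
    have h1 : ∀ K' ∈ K.powerset, multiDiff (insert j K') h a s =
        multiDiff K' h a (Function.update s j (s j + h j)) - multiDiff K' h a s := fun K' hK' =>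
      multiDiff_insert K' j (fun hh => hj (Finset.mem_powerset.1 hK' hh)) h a s
    rw [Finset.sum_powerset_insert hj, Finset.sum_congr rfl h1, Finset.sum_sub_distrib, ih, ih]
    have h2 : shiftOn K h (Function.update s j (s j + h j)) = shiftOn (insert j K) h s := by
      funext i
      by_cases hij : i = j
      · subst hij; simp [shiftOn, hj]
      · simp [shiftOn, hij]
    rw [h2]
    ring

theorem multiDiff_eq_zero {K : Finset (Fin k)} {h : Fin k → ℝ} {j : Fin k} (hj : j ∈ K)
    (h0 : h j = 0) (a : (Fin k → ℝ) → ℂ) (s : Fin k → ℝ) : multiDiff K h a s = 0 := by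
  rw [← Finset.insert_erase hj, multiDiff_insert _ _ (Finset.notMem_erase j K)]
  simp [h0]

/-- The coefficients of `multiDiff K`, extended by zero to all subsets. -/
def diffCoeff (K u : Finset (Fin k)) : ℝ := if u ⊆ K then (-1) ^ (K.card - u.card) else 0

/-- The nodes of `multiDiff K h · s`; the nodes with coefficient zero are put at `s`. -/
def diffNode (K : Finset (Fin k)) (h s : Fin k → ℝ) (u : Finset (Fin k)) : Fin k → ℝ :=
  if u ⊆ K then shiftOn u h s else s

theorem abs_diffCoeff_le (K u : Finset (Fin k)) : |diffCoeff K u| ≤ 1 := by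
  unfold diffCoeff
  split_ifs <;> simp

theorem comb_diff {X : Type*} (H : (Fin k → ℝ) → (X → ℂ) → X → ℂ) (K : Finset (Fin k))
    (h s : Fin k → ℝ) (f : X → ℂ) (x : X) :
    comb H (diffCoeff K) (diffNode K h s) f x = multiDiff K h (fun u => H u f x) s := by
  unfold comb multiDiff
  have h1 : K.powerset = Finset.univ.filter fun u => u ⊆ K := by
    ext u
    simp
  rw [h1, Finset.sum_filter]
  refine Finset.sum_congr rfl fun u _ => ?_
  by_cases hu : u ⊆ K
  · simp [diffCoeff, diffNode, hu]
  · simp [diffCoeff, hu]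

theorem diffNode_mem {L : ℕ} {left h s : Fin k → ℝ} {K : Finset (Fin k)}
    (h0 : ∀ i ∈ K, 0 ≤ h i) (hs : s ∈ cube L left)
    (hsh : ∀ i ∈ K, s i + h i ≤ (1 + 2 ^ L) * left i) (u : Finset (Fin k)) :
    diffNode K h s u ∈ cube L left := by
  unfold diffNode
  split_ifs with hu
  · refine ⟨fun i => ?_, fun i => ?_⟩
    · have := hs.1 i
      unfold shiftOn
      split_ifs with hi
      · linarith [h0 i (hu hi)]
      · exact this
    · have := hs.2 i
      unfold shiftOn
      split_ifs with hi
      · simpa using hsh i (hu hi)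
      · exact this
  · exact hs

theorem cube_subset_posOrthant {L : ℕ} {left : Fin k → ℝ} (hl : left ∈ posOrthant k) :
    cube L left ⊆ posOrthant k := fun _ ht i => (hl i).trans_le (ht.1 i)

end DifferenceBlocks

section Operators

variable {X : Type*} [MeasurableSpace X] {μ : Measure X} {k r L : ℕ}
  {H : (Fin k → ℝ) → (X → ℂ) → X → ℂ} {left : (Fin r → ℤ) → Fin k → ℝ}

/-- A common bound for the norms of the operators `H_s`, `s` in a cube, and for the constants of the
block families made of their differences. The summand `1` keeps it nonzero. -/
def blockSize (k L : ℕ) (A : ℝ≥0) : ℝ≥0 := 2 ^ k * (2 ^ L) ^ k * A + 1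

/-- The cancellation condition bounds the operators themselves: `H_t` is the sum of the differences of
`H` at the lower corner of the cube with the steps `tᵢ - ℓᵢ`. The step in a coordinate with `tᵢ = ℓᵢ`
is not used, and is set to the full side so that all steps are positive. -/
theorem CancellationCondition.eLpNorm_le {p : ℝ≥0∞} {A : ℝ≥0} (hp : 1 ≤ p)
    (hc : CancellationCondition μ H L left p A) (hl : ∀ g, left g ∈ posOrthant k)
    (hm : ∀ s ∈ posOrthant k, ∀ f, MemLp f p μ → AEStronglyMeasurable (H s f) μ)
    {g : Fin r → ℤ} {t : Fin k → ℝ} (ht : t ∈ cube L (left g)) {f : X → ℂ} (hf : MemLp f p μ) :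
    eLpNorm (H t f) p μ ≤ blockSize k L A * eLpNorm f p μ := by
  classical
  set K : Finset (Fin k) := Finset.univ.filter fun i => left g i < t i with hK
  set h : Fin k → ℝ := fun i => if left g i < t i then t i - left g i else left g i * 2 ^ L with hh
  have hpos : h ∈ posOrthant k := by
    intro i
    simp only [hh]
    split_ifs with hi
    · linarith
    · have := hl g i
      positivity
  have hshift : shiftOn K h (left g) = t := by
    funext i
    simp only [shiftOn, hK, hh, Finset.mem_filter, Finset.mem_univ, true_and]
    split_ifs with hi
    · ring
    · exact le_antisymm (ht.1 i) (not_lt.1 hi)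
  have hle : ∀ i, left g i + h i ≤ (1 + 2 ^ L) * left g i := by
    intro i
    simp only [hh]
    split_ifs with hi
    · have := ht.2 i
      simp only [Pi.smul_apply, smul_eq_mul] at this
      linarith
    · linarith
  have hself : left g ∈ cube L (left g) := by
    refine ⟨le_rfl, fun i => ?_⟩
    have := hpos i
    simp only [Pi.smul_apply, smul_eq_mul]
    linarith [hle i]
  have hmem : left g + h ∈ cube L (left g) := by
    refine ⟨fun i => ?_, fun i => ?_⟩
    · have := hpos i
      simp only [Pi.add_apply]
      linarith
    · simpa using hle i
  have h1 : H t f = ∑ K' ∈ K.powerset, fun x => multiDiff K' h (fun u => H u f x) (left g) := by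
    funext x
    rw [Finset.sum_apply, sum_multiDiff, hshift]
  have hmeas : ∀ K' ∈ K.powerset, AEStronglyMeasurable
      (fun x => multiDiff K' h (fun u => H u f x) (left g)) μ := by
    intro K' _
    refine Finset.aestronglyMeasurable_fun_sum _ fun u _ => (hm _ (fun i => ?_) f hf).const_mul _
    have h2 := hpos i
    have h3 := hl g i
    unfold shiftOn
    split_ifs <;> linarith
  rw [h1]
  refine (eLpNorm_sum_le hmeas hp).trans ?_
  have h2 : ∀ K' ∈ K.powerset,
      eLpNorm (fun x => multiDiff K' h (fun u => H u f x) (left g)) p μ ≤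
        ((2 ^ L) ^ k * A : ℝ≥0) * eLpNorm f p μ := by
    intro K' _
    refine (hc K' g (left g) h hpos hself hmem f hf).trans ?_
    rw [ENNReal.coe_mul, mul_comm (A : ℝ≥0∞)]
    gcongr
    have h3 : ∏ i ∈ K', h i / left g i ≤ (2 ^ L) ^ k := by
      calc ∏ i ∈ K', h i / left g i ≤ ∏ _i ∈ K', (2 ^ L : ℝ) := by
            refine Finset.prod_le_prod (fun i _ => (div_pos (hpos i) (hl g i)).le) fun i _ => ?_
            rw [div_le_iff₀ (hl g i)]
            linarith [hle i]
        _ ≤ (2 ^ L) ^ k := by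
            rw [Finset.prod_const]
            exact pow_le_pow_right₀ (one_le_pow₀ (by norm_num))
              (by simpa using Finset.card_le_univ K')
    refine (ENNReal.ofReal_le_ofReal h3).trans (le_of_eq ?_)
    rw [ENNReal.ofReal_pow (by positivity), ENNReal.ofReal_pow (by positivity)]
    simp
  refine (Finset.sum_le_sum h2).trans ?_
  rw [Finset.sum_const, nsmul_eq_mul, ← mul_assoc]
  gcongr
  have h4 : K.powerset.card ≤ 2 ^ k := by
    rw [Finset.card_powerset]
    exact Nat.pow_le_pow_right (by norm_num) (by simpa using Finset.card_le_univ K)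
  calc ((K.powerset.card : ℕ) : ℝ≥0∞) * ((2 ^ L) ^ k * A : ℝ≥0)
      = ((K.powerset.card * ((2 ^ L) ^ k * A) : ℝ≥0) : ℝ≥0∞) := by push_cast; rfl
    _ ≤ _ := by
        rw [ENNReal.coe_le_coe, blockSize]
        have : (K.powerset.card : ℝ≥0) ≤ 2 ^ k := by exact_mod_cast h4
        calc (K.powerset.card : ℝ≥0) * ((2 ^ L) ^ k * A) ≤ 2 ^ k * ((2 ^ L) ^ k * A) := by gcongr
          _ = 2 ^ k * (2 ^ L) ^ k * A := by ring
          _ ≤ _ := le_self_add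

/-- The operators at the points of the cubes, as a family with a single block. -/
theorem isBlockFamily_point {p₀ : ℝ≥0∞} {A : ℝ≥0} (hp₀ : 1 ≤ p₀)
    (hc : ∀ p, p = p₀ ∨ p = 2 → CancellationCondition μ H L left p A)
    (hl : ∀ g, left g ∈ posOrthant k)
    (hlin : ∀ s ∈ posOrthant k, IsLinearOperator (SumLpFun p₀ 2 μ) μ (H s))
    {pt : (Fin r → ℤ) → Fin k → ℝ} (hpt : ∀ g, pt g ∈ cube L (left g)) :
    IsBlockFamily (M := Unit) μ H L left p₀ (blockSize k L A)
      (fun _ _ => diffCoeff (∅ : Finset (Fin k))) (fun g _ => diffNode ∅ 0 (pt g)) where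
  abs_le _ _ u := abs_diffCoeff_le _ u
  mem_cube g _ u := diffNode_mem (by simp) (hpt g) (by simp) u
  bound := by
    intro p hp g m f hf
    have h1 : comb H (diffCoeff (∅ : Finset (Fin k))) (diffNode ∅ 0 (pt g)) f = H (pt g) f := by
      funext x
      rw [comb_diff, multiDiff_empty]
    rw [h1]
    refine ((hc p hp).eLpNorm_le ?_ hl (fun s hs f hf => ?_) (hpt g) hf).trans ?_
    · rcases hp with rfl | rfl
      · exact hp₀
      · norm_num
    · refine (hlin s hs).aestronglyMeasurable f ?_
      rcases hp with rfl | rfl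
      · exact ⟨f, 0, hf, MemLp.zero, by simp⟩
      · exact lpFun_two_subset _ hf
    · simp

/-- The block increments of a fixed scale `n`. For positive steps the cancellation condition gives
the norm `∏ᵢ 2^L / 2^{nᵢ}` over the active coordinates, up to a constant, and the number of blocks is
`∏ᵢ 2^{nᵢ}`. A step can vanish only in an active coordinate, and then the increment is zero. -/
theorem isBlockFamily_blockDiff {p₀ : ℝ≥0∞} {A : ℝ≥0}
    (hc : ∀ p, p = p₀ ∨ p = 2 → CancellationCondition μ H L left p A)
    (hl : ∀ g, left g ∈ posOrthant k) (n : Fin k → ℕ) :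
    IsBlockFamily (M := ∀ i, Fin (2 ^ n i)) μ H L left p₀ (blockSize k L A)
      (fun _ _ => diffCoeff (activeSet n))
      (fun g q => diffNode (activeSet n) (blockStep L (left g) n fun i => q i)
        (blockBase L (left g) n fun i => q i)) := by
  have hstep0 : ∀ g (q : ∀ i, Fin (2 ^ n i)) i, 0 ≤ blockStep L (left g) n (fun i => q i) i := by
    intro g q i
    have := hl g i
    unfold blockStep
    split_ifs <;> positivity
  have hsum : ∀ g (q : ∀ i, Fin (2 ^ n i)) i, blockBase L (left g) n (fun i => q i) i +
      blockStep L (left g) n (fun i => q i) i ≤ (1 + 2 ^ L) * left g i := by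
    intro g q i
    have hli := hl g i
    have h2 : (0 : ℝ) < 2 ^ n i := by positivity
    have h3 : (2 * ((q i : ℕ) / 2 : ℕ) + (if n i = 0 then 1 else ((q i : ℕ) % 2 : ℕ)) : ℝ) ≤
        2 ^ n i := by
      have hq := (q i).2
      have h4 : 2 * ((q i : ℕ) / 2) + (if n i = 0 then 1 else (q i : ℕ) % 2) ≤ 2 ^ n i := by
        split_ifs with h0
        · have h5 : 2 ^ n i = 1 := by simp [h0]
          omega
        · omega
      have h5 : ((2 * ((q i : ℕ) / 2) + (if n i = 0 then 1 else (q i : ℕ) % 2) : ℕ) : ℝ) ≤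
        (2 ^ n i : ℕ) := by exact_mod_cast h4
      push_cast at h5
      convert h5 using 1
      push_cast
      rfl
    have h6 : blockBase L (left g) n (fun i => q i) i + blockStep L (left g) n (fun i => q i) i =
        left g i + left g i * 2 ^ L *
          ((2 * ((q i : ℕ) / 2 : ℕ) + (if n i = 0 then 1 else ((q i : ℕ) % 2 : ℕ)) : ℝ) /
            2 ^ n i) := by
      unfold blockBase blockStep
      field_simp
      ring
    rw [h6]
    have h7 : left g i * 2 ^ L *
          ((2 * ((q i : ℕ) / 2 : ℕ) + (if n i = 0 then 1 else ((q i : ℕ) % 2 : ℕ)) : ℝ) /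
            2 ^ n i) ≤ left g i * 2 ^ L * 1 := by
      gcongr
      exact (div_le_one h2).2 h3
    linarith
  have hbase : ∀ g (q : ∀ i, Fin (2 ^ n i)) i,
      left g i ≤ blockBase L (left g) n (fun i => q i) i := by
    intro g q i
    have := hl g i
    unfold blockBase
    refine le_mul_of_one_le_right this.le ?_
    have : (0 : ℝ) ≤ 2 ^ L * (2 * ((q i : ℕ) / 2 : ℕ) / 2 ^ n i) := by positivity
    linarith
  have hbcube : ∀ g (q : ∀ i, Fin (2 ^ n i)),
      blockBase L (left g) n (fun i => q i) ∈ cube L (left g) := by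
    refine fun g q => ⟨hbase g q, fun i => ?_⟩
    have h1 := hsum g q i
    have h2 := hstep0 g q i
    simp only [Pi.smul_apply, smul_eq_mul]
    linarith
  refine ⟨fun _ _ u => abs_diffCoeff_le _ u, fun g q u => diffNode_mem (fun i _ => hstep0 g q i)
    (hbcube g q) (fun i _ => hsum g q i) u, ?_⟩
  intro p hp g q f hf
  have h1 : comb H (diffCoeff (activeSet n)) (diffNode (activeSet n)
      (blockStep L (left g) n fun i => q i) (blockBase L (left g) n fun i => q i)) f =
      fun x => multiDiff (activeSet n) (blockStep L (left g) n fun i => q i) (fun u => H u f x)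
        (blockBase L (left g) n fun i => q i) := by
    funext x
    rw [comb_diff]
  rw [h1]
  by_cases hall : ∀ i, 0 < blockStep L (left g) n (fun i => q i) i
  · refine (hc p hp (activeSet n) g _ _ hall (hbcube g q)
      ⟨fun i => ?_, fun i => ?_⟩ f hf).trans ?_
    · have h2 := hall i
      have h3 := hbase g q i
      simp only [Pi.add_apply]
      linarith
    · simpa using hsum g q i
    · gcongr
      have hN : (Fintype.card (∀ i, Fin (2 ^ n i)) : ℝ) = ∏ i, (2 : ℝ) ^ n i := by simp
      have h2 : ∏ i ∈ activeSet n, blockStep L (left g) n (fun i => q i) i /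
          blockBase L (left g) n (fun i => q i) i ≤
          (2 ^ L) ^ k / (Fintype.card (∀ i, Fin (2 ^ n i)) : ℝ) := by
        have h3 : ∀ i ∈ activeSet n, blockStep L (left g) n (fun i => q i) i /
            blockBase L (left g) n (fun i => q i) i ≤ 2 ^ L / 2 ^ n i := by
          intro i _
          have hli := hl g i
          have hb := hbase g q i
          rw [div_le_iff₀ (hli.trans_le hb)]
          calc blockStep L (left g) n (fun i => q i) i ≤ left g i * 2 ^ L / 2 ^ n i * 1 := by
                unfold blockStep
                gcongr
                split_ifs
                · simp
                · exact_mod_cast Nat.le_of_lt_succ (Nat.mod_lt _ two_pos)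
            _ = 2 ^ L / 2 ^ n i * left g i := by ring
            _ ≤ _ := by gcongr
        calc _ ≤ ∏ i ∈ activeSet n, (2 : ℝ) ^ L / 2 ^ n i :=
              Finset.prod_le_prod (fun i _ => (div_pos (hall i)
                ((hl g i).trans_le (hbase g q i))).le) h3
          _ = (∏ i ∈ activeSet n, (2 : ℝ) ^ L) / ∏ i ∈ activeSet n, 2 ^ n i :=
              Finset.prod_div_distrib _ _
          _ = (∏ i ∈ activeSet n, (2 : ℝ) ^ L) / ∏ i, 2 ^ n i := by
              congr 1
              refine Finset.prod_subset (Finset.subset_univ _) fun i _ hi => ?_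
              have : n i = 0 := by simpa [activeSet] using hi
              simp [this]
          _ ≤ _ := by
              rw [hN, Finset.prod_const]
              gcongr
              · exact one_le_pow₀ (by norm_num)
              · simpa using Finset.card_le_univ (activeSet n)
      calc (A : ℝ≥0∞) * ENNReal.ofReal (∏ i ∈ activeSet n,
            blockStep L (left g) n (fun i => q i) i / blockBase L (left g) n (fun i => q i) i)
          ≤ A * ENNReal.ofReal ((2 ^ L) ^ k / (Fintype.card (∀ i, Fin (2 ^ n i)) : ℝ)) := by
            gcongr
        _ = ((A * (2 ^ L) ^ k / Fintype.card (∀ i, Fin (2 ^ n i)) : ℝ≥0) : ℝ≥0∞) := by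
            rw [mul_div_assoc, ENNReal.coe_mul, ENNReal.ofReal]
            congr 2
            rw [Real.toNNReal_div (by positivity), Real.toNNReal_pow (by positivity),
              Real.toNNReal_pow (by positivity), Real.toNNReal_natCast, Real.toNNReal_ofNat]
        _ ≤ _ := by
            rw [ENNReal.coe_le_coe]
            gcongr
            unfold blockSize
            calc A * (2 ^ L) ^ k = 1 * (2 ^ L) ^ k * A := by ring
              _ ≤ 2 ^ k * (2 ^ L) ^ k * A := by
                  gcongr
                  exact one_le_pow₀ (by norm_num)
              _ ≤ _ := le_self_add
  · push Not at hall
    obtain ⟨i, hi⟩ := hall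
    have hi0 : blockStep L (left g) n (fun i => q i) i = 0 := le_antisymm hi (hstep0 g q i)
    have hiA : i ∈ activeSet n := by
      by_contra hcon
      have h0 : n i = 0 := by simpa [activeSet] using hcon
      have := hl g i
      unfold blockStep at hi0
      rw [if_pos h0] at hi0
      have : 0 < left g i * 2 ^ L / 2 ^ n i * 1 := by positivity
      linarith
    have h2 : (fun x => multiDiff (activeSet n) (blockStep L (left g) n fun i => q i)
        (fun u => H u f x) (blockBase L (left g) n fun i => q i)) = 0 := by
      funext x
      exact multiDiff_eq_zero hiA hi0 _ _
    rw [h2, eLpNorm_zero]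
    exact zero_le

end Operators

/-! ### Decay of the block square functions for exponents below two -/

section Decay

variable {X : Type*} [MeasurableSpace X] {μ : Measure X} {k r L : ℕ}
  {H : (Fin k → ℝ) → (X → ℂ) → X → ℂ} {left : (Fin r → ℤ) → Fin k → ℝ}

/-- The square functions of the operators `H` along block families are bounded on `L^p`, with a norm
that decays like a power of the number of blocks. The coefficients and nodes have to form a block
family with constant `A` for `H` and also for a second family `H'`, which stands for the adjoint
operators in the range `p ≥ 2`. -/
def HasBlockDecay (μ : Measure X) (H H' : (Fin k → ℝ) → (X → ℂ) → X → ℂ) (L : ℕ)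
    (left : (Fin r → ℤ) → Fin k → ℝ) (p₀ : ℝ≥0∞) (A : ℝ≥0) (p : ℝ) (D : ℝ≥0) (η : ℝ) : Prop :=
  ∀ (M : Type) [Fintype M] [Nonempty M] (σ : (Fin r → ℤ) → M → Finset (Fin k) → ℝ)
    (t : (Fin r → ℤ) → M → Finset (Fin k) → Fin k → ℝ), IsBlockFamily μ H L left p₀ A σ t →
      IsBlockFamily μ H' L left p₀ A σ t → ∀ f, MemLp f (ENNReal.ofReal p) μ →
        eLpNorm (fun x => (∑' g, ∑ m, ‖comb H (σ g m) (t g m) f x‖ₑ ^ (2 : ℝ)) ^ (1 / 2 : ℝ))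
          (ENNReal.ofReal p) μ ≤
          (D * (Fintype.card M : ℝ≥0) ^ (-η) : ℝ≥0) * eLpNorm f (ENNReal.ofReal p) μ

/-- The exponent `q` of the vector-valued inequality, and the parameter `θ` of the interpolation
between `L^q`, or the conjugate space, and `L²`. -/
theorem exists_interpolation_exponents {a b p : ℝ} (ha : 1 ≤ a) (hab : a < b) (hb : b ≤ 2)
    (hp : |p⁻¹ - 2⁻¹| ≤ b⁻¹ - 2⁻¹) :
    ∃ q q' θ : ℝ, q.HolderConjugate q' ∧ q⁻¹ = (a / 2) * a⁻¹ + (1 - a / 2) * b⁻¹ ∧ a < q ∧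
      q ≤ 2 ∧ (b - a) / (2 - a) ≤ θ ∧ θ ≤ 1 ∧ |p⁻¹ - 2⁻¹| = (1 - θ) * (q⁻¹ - 2⁻¹) := by
  have ha0 : 0 < a := by linarith
  have hb0 : 0 < b := by linarith
  have h2a : 0 < 2 - a := by linarith
  -- `w = 1 / q - 1 / 2`
  set w : ℝ := (2 - a) / (2 * b) with hw
  have hw0 : 0 < w := by positivity
  have hwa : 2⁻¹ + w < a⁻¹ := by
    have h1 : w < (2 - a) / (2 * a) := by
      rw [hw]
      gcongr
    have h2 : (2 - a) / (2 * a) = a⁻¹ - 2⁻¹ := by field_simp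
    linarith
  have hq0 : 0 < 2⁻¹ + w := by positivity
  have haq : a < (2⁻¹ + w)⁻¹ := by
    rw [lt_inv_comm₀ ha0 hq0]
    exact hwa
  refine ⟨(2⁻¹ + w)⁻¹, (2⁻¹ + w)⁻¹.conjExponent, 1 - |p⁻¹ - 2⁻¹| / w,
    Real.HolderConjugate.conjExponent (by linarith), ?_, haq, ?_, ?_, ?_, ?_⟩
  · rw [inv_inv, hw]
    field_simp
  · rw [inv_le_comm₀ hq0 two_pos]
    linarith
  · have h1 : |p⁻¹ - 2⁻¹| / w ≤ (b⁻¹ - 2⁻¹) / w := by gcongr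
    have h2 : (b⁻¹ - 2⁻¹) / w = 1 - (b - a) / (2 - a) := by
      rw [hw]
      field_simp
      ring
    linarith
  · have : 0 ≤ |p⁻¹ - 2⁻¹| / w := by positivity
    linarith
  · rw [inv_inv]
    field_simp
    ring

theorem natCast_mul_div_rpow_le {N : ℕ} (hN : 1 ≤ N) (A : ℝ≥0) {a : ℝ} (ha : 1 ≤ a) :
    (N : ℝ≥0) * (A / N) ^ a ≤ A ^ a := by
  have hN' : (1 : ℝ≥0) ≤ N := by exact_mod_cast hN
  have hN0 : (N : ℝ≥0) ≠ 0 := (zero_lt_one.trans_le hN').ne'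
  rw [NNReal.div_rpow, ← mul_div_assoc, mul_comm, mul_div_assoc]
  refine mul_le_of_le_one_right zero_le ?_
  rw [div_le_one (NNReal.rpow_pos (zero_lt_one.trans_le hN'))]
  simpa using NNReal.rpow_le_rpow_of_exponent_le hN' ha

variable {S : (Fin r → ℤ) → (X → ℂ) → X → ℂ} {pt : (Fin r → ℤ) → Fin k → ℝ}
  {c : (Fin r → ℤ) → ℝ} {ε : ℝ} {A₁ A₅ B : ℝ≥0} {A₂ A₄ : ℝ≥0∞ → ℝ≥0}

theorem isL2Operator_of_cancellation {p₀ : ℝ≥0∞}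
    (hlin : ∀ s ∈ posOrthant k, IsLinearOperator (SumLpFun p₀ 2 μ) μ (H s))
    (hl : ∀ g, left g ∈ posOrthant k) (hc : CancellationCondition μ H L left 2 A₅) :
    ∀ g, ∀ s ∈ cube L (left g), IsL2Operator μ (H s) := fun g s hs =>
  ⟨(hlin s (cube_subset_posOrthant (hl g) hs)).mono (lpFun_two_subset _), _,
    fun _ hf => hc.eLpNorm_le (by norm_num) hl (fun s hs f hf =>
      (hlin s hs).aestronglyMeasurable f (lpFun_two_subset _ hf)) hs hf⟩

/-- The decay of the block square functions for `p₁ ≤ p ≤ 2`. The second family of operators plays no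
role in this range. -/
theorem hasBlockDecay_of_le_two (k r L : ℕ) {a b p : ℝ} (ha : 1 ≤ a) (hab : a < b) (hb : b ≤ 2)
    (hbp : b ≤ p) (hp2 : p ≤ 2) {ε : ℝ} (hε : ε ∈ Set.Ioo (0 : ℝ) (1 / 2)) (A₁ A₅ B : ℝ≥0)
    (A₂ A₄ : ℝ≥0∞ → ℝ≥0) :
    ∃ (D : ℝ≥0) (η : ℝ), 0 < η ∧ ∀ (X : Type*) [MeasurableSpace X] (μ : Measure X)
      (H H' : (Fin k → ℝ) → (X → ℂ) → X → ℂ) (S : (Fin r → ℤ) → (X → ℂ) → X → ℂ)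
      (left pt : (Fin r → ℤ) → Fin k → ℝ) (c : (Fin r → ℤ) → ℝ),
      Hypotheses μ H S L left pt c (ENNReal.ofReal a) (ENNReal.ofReal b) ε A₁ A₅ B A₂ A₄ →
        HasBlockDecay μ H H' L left (ENNReal.ofReal a) (blockSize k L A₅) p D η := by
  have hb0 : 0 < b := by linarith
  have hp0 : 0 < p := by linarith
  have hpinv : 2⁻¹ ≤ p⁻¹ := inv_anti₀ hp0 hp2
  have habs : |p⁻¹ - 2⁻¹| = p⁻¹ - 2⁻¹ := abs_of_nonneg (by linarith)
  obtain ⟨q, q', θ, hq, hqab, haq, hq2, hτθ, hθ1, hθ⟩ :=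
    exists_interpolation_exponents (p := p) ha hab hb (by
      rw [habs]
      linarith [inv_anti₀ hb0 hbp])
  rw [habs] at hθ
  have hτ0 : 0 < (b - a) / (2 - a) := div_pos (by linarith) (by linarith)
  set A := blockSize k L A₅ with hA
  have hA0 : A ≠ 0 := by simp [hA, blockSize]
  refine ⟨((2 * A) ^ (a / 2) * (Fintype.card (Finset (Fin k)) * A₁) ^ (1 - a / 2) *
      A₄ (ENNReal.ofReal q)) ^ (1 - θ) *
    ((Fintype.card (Finset (Fin k)) : ℝ≥0) ^ (1 / 2 - ε) * (A * A₄ 2) ^ (1 / 2 + ε)) ^ θ *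
      B ^ (θ / ((b - a) / (2 - a))), ε * θ, mul_pos hε.1 (hτ0.trans_le hτθ), ?_⟩
  intro X _ μ H H' S left pt c hyp M _ _ σ t hT _ f hf
  have e2 : ENNReal.ofReal 2 = 2 := by simp
  have ha2 : ENNReal.ofReal a < 2 := by
    rw [← e2]
    exact (ENNReal.ofReal_lt_ofReal_iff two_pos).2 (by linarith)
  have hH := isL2Operator_of_cancellation hyp.linear hyp.left_pos (hyp.cancellation 2 (Or.inr rfl))
  have hnode : ∀ g m u, t g m u ∈ posOrthant k := fun g m u =>
    cube_subset_posOrthant (hyp.left_pos g) (hT.mem_cube g m u)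
  have hD : ∀ u, MemLp u (ENNReal.ofReal p) μ → u ∈ SumLpFun (ENNReal.ofReal a) 2 μ :=
    fun u hu => e2 ▸ lpFun_subset_sumLpFun (by linarith) (by linarith) hp2 hu
  have hLPq : LittlewoodPaleyEstimate μ S (ENNReal.ofReal q) (A₄ (ENNReal.ofReal q)) := by
    refine hyp.littlewoodPaley.square _ ⟨?_, ?_⟩
    · exact (ENNReal.ofReal_lt_ofReal_iff (by linarith)).2 haq
    · rw [← e2]
      exact ENNReal.ofReal_le_ofReal hq2
  refine eLpNorm_tsum_sum_le (fun g m => (IsLinearOperator.comb fun u =>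
    hyp.linear _ (hnode g m u)).aestronglyMeasurable f (hD f hf)) hp0 fun Γ => ?_
  refine eLpNorm_toVec_comb_le_of_inter (p₀ := a) (p₁ := b) (B := Γ × M)
    (σ := fun b => σ b.1 b.2) (t := fun b => t b.1 b.2) (by linarith) hab.le (by linarith) hbp hp2
    (fun b u => hT.abs_le _ _ _) (fun b u => hnode _ _ _) hyp.linear hyp.maximal ?_ hf
  intro f hf2 hfp
  refine hT.eLpNorm_toVec_le ha2 hH hε hyp.littlewoodPaley hq
    (Real.HolderConjugate.conjExponent (show 1 < p by linarith)) ?_ hτ0 hτθ hθ1 (by linarith) hLPq Γ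
    (fun F hF2 hFq => ?_) hf2 hfp
  · rw [ENNReal.toReal_ofReal (by linarith), ENNReal.toReal_ofReal (by linarith)]
  · refine eLpNorm_applyVec_comb_le (σ := fun b : Γ × M => σ b.1 b.2)
      (t := fun b : Γ × M => t b.1 b.2) (n := Fintype.card M)
      (δ := A / Fintype.card M) (fun b => hT.isL2Operator hH _ _)
      (fun b u => hT.abs_le _ _ _) (fun b u => hnode _ _ _) ha (by linarith) (by linarith) hq hqab
      hyp.maximal Prod.fst (fun g => ?_) hA0 (natCast_mul_div_rpow_le Fintype.card_pos A ha)
      (fun b f hf => hT.bound _ (Or.inl rfl) _ _ f hf) hF2 hFq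
    refine Finset.card_le_card_of_injOn (t := Finset.univ) (fun b => b.2) (fun _ _ => by simp) ?_
    intro b hb b' hb' h
    simp only [Finset.coe_filter, Finset.mem_univ, true_and, Set.mem_ofPred_eq] at hb hb'
    exact Prod.ext (hb.trans hb'.symm) h

end Decay

/-! ### From block decay to variations -/

/-- A geometric series in several variables. -/
theorem tsum_prod_pow_le (k : ℕ) (x : ℝ≥0∞) :
    ∑' n : Fin k → ℕ, ∏ i, x ^ n i ≤ ((1 - x)⁻¹) ^ k := by
  rw [ENNReal.tsum_eq_iSup_sum]
  refine iSup_le fun s => ?_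
  set N := s.sup fun n => ∑ i, n i with hN
  have hs : s ⊆ Fintype.piFinset fun _ : Fin k => Finset.range (N + 1) := by
    intro n hn
    rw [Fintype.mem_piFinset]
    intro i
    rw [Finset.mem_range, Nat.lt_succ_iff]
    exact (Finset.single_le_sum (fun j _ => Nat.zero_le (n j)) (Finset.mem_univ i)).trans
      (Finset.le_sup (f := fun n : Fin k → ℕ => ∑ i, n i) hn)
  refine (Finset.sum_le_sum_of_subset hs).trans ?_
  rw [Finset.sum_prod_piFinset (Finset.range (N + 1)) fun _ j => x ^ j, Finset.prod_const,
    Finset.card_univ, Fintype.card_fin]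
  gcongr
  rw [← ENNReal.tsum_geometric]
  exact ENNReal.sum_le_tsum _

section Assembly

variable {X : Type*} [MeasurableSpace X] {μ : Measure X} {k r L : ℕ}
  {H H' : (Fin k → ℝ) → (X → ℂ) → X → ℂ} {left pt : (Fin r → ℤ) → Fin k → ℝ}

theorem outerLpNorm_le {F G : X → ℝ≥0∞} (p : ℝ≥0∞) (hG : AEMeasurable G μ) (h : F ≤ᵐ[μ] G) :
    outerLpNorm F p μ ≤ eLpNorm G p μ := by
  rw [eLpNorm_congr_ae hG.ae_eq_mk]
  exact iInf₂_le_of_le _ hG.measurable_mk (iInf_le _ (h.trans hG.ae_eq_mk.le))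

theorem eLpNorm_ennreal_const_mul {G : X → ℝ≥0∞} (hG : AEMeasurable G μ) (C : ℝ≥0∞) {p : ℝ}
    (hp : 0 < p) :
    eLpNorm (fun x => C * G x) (ENNReal.ofReal p) μ = C * eLpNorm G (ENNReal.ofReal p) μ := by
  rw [eLpNorm_ofReal _ hp, eLpNorm_ofReal _ hp]
  simp only [enorm_eq_self, ENNReal.mul_rpow_of_nonneg _ _ hp.le]
  rw [lintegral_const_mul'' _ (hG.pow_const _), ENNReal.mul_rpow_of_nonneg _ _ (by positivity),
    ← ENNReal.rpow_mul, mul_one_div_cancel hp.ne', ENNReal.rpow_one]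

theorem outerLpNorm_mono_mul {F G : X → ℝ≥0∞} {C : ℝ≥0∞} {p : ℝ} (hp : 0 < p)
    (hC : C ≠ 0) (hC' : C ≠ ∞) (h : ∀ x, F x ≤ C * G x) :
    outerLpNorm F (ENNReal.ofReal p) μ ≤ C * outerLpNorm G (ENNReal.ofReal p) μ := by
  unfold outerLpNorm
  rw [ENNReal.mul_iInf_of_ne hC hC']
  refine le_iInf fun G' => ?_
  rw [ENNReal.mul_iInf_of_ne hC hC']
  refine le_iInf fun hG' => ?_
  rw [ENNReal.mul_iInf_of_ne hC hC']
  refine le_iInf fun hGG' => ?_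
  rw [← eLpNorm_ennreal_const_mul hG'.aemeasurable C hp]
  refine iInf₂_le_of_le _ (hG'.const_mul C) (iInf_le_of_le ?_ le_rfl)
  filter_upwards [hGG'] with x hx
  exact (h x).trans (by gcongr)

theorem outerLpNorm_long_variation_le (hr : 0 < r) {p₀ : ℝ≥0∞} {A D : ℝ≥0} {p η : ℝ} (hp : 0 < p)
    (hp₀ : 1 ≤ p₀) (hdecay : HasBlockDecay μ H H' L left p₀ (blockSize k L A) p D η)
    (hc : ∀ p, p = p₀ ∨ p = 2 → CancellationCondition μ H L left p A)
    (hc' : ∀ p, p = p₀ ∨ p = 2 → CancellationCondition μ H' L left p A)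
    (hl : ∀ g, left g ∈ posOrthant k)
    (hlin : ∀ s ∈ posOrthant k, IsLinearOperator (SumLpFun p₀ 2 μ) μ (H s))
    (hlin' : ∀ s ∈ posOrthant k, IsLinearOperator (SumLpFun p₀ 2 μ) μ (H' s))
    (hpt : ∀ g, pt g ∈ cube L (left g)) {f : X → ℂ} (hf : MemLp f (ENNReal.ofReal p) μ)
    (hm : ∀ s ∈ posOrthant k, AEStronglyMeasurable (H s f) μ) :
    outerLpNorm (fun x => variation 2 Set.univ fun g => H (pt g) f x) (ENNReal.ofReal p) μ ≤
      (2 * D : ℝ≥0) * eLpNorm f (ENNReal.ofReal p) μ := by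
  have h1 := hdecay Unit _ _ (isBlockFamily_point hp₀ hc hl hlin hpt)
    (isBlockFamily_point hp₀ hc' hl hlin' hpt) f hf
  simp only [comb_diff, multiDiff_empty, Finset.univ_unique, Finset.sum_singleton,
    Fintype.card_unit, Nat.cast_one, NNReal.one_rpow, mul_one] at h1
  have hmeas : AEMeasurable (fun x => (∑' g, ‖H (pt g) f x‖ₑ ^ (2 : ℝ)) ^ (1 / 2 : ℝ)) μ :=
    (AEMeasurable.tsum fun g => ((hm _ (cube_subset_posOrthant (hl g)
      (hpt g))).enorm.pow_const _)).pow_const _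
  refine (outerLpNorm_le (G := fun x => 2 * (∑' g, ‖H (pt g) f x‖ₑ ^ (2 : ℝ)) ^ (1 / 2 : ℝ)) _
    (hmeas.const_mul _) (Eventually.of_forall fun x => variation_univ_le hr _)).trans ?_
  rw [eLpNorm_ennreal_const_mul hmeas _ hp, ENNReal.coe_mul, mul_assoc]
  gcongr
  rfl

theorem outerLpNorm_short_variation_le {p₀ : ℝ≥0∞} {A D : ℝ≥0} {p η : ℝ} (hp : 1 ≤ p)
    (hdecay : HasBlockDecay μ H H' L left p₀ (blockSize k L A) p D η)
    (hc : ∀ p, p = p₀ ∨ p = 2 → CancellationCondition μ H L left p A)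
    (hc' : ∀ p, p = p₀ ∨ p = 2 → CancellationCondition μ H' L left p A)
    (hl : ∀ g, left g ∈ posOrthant k) {f : X → ℂ} (hf : MemLp f (ENNReal.ofReal p) μ)
    (hm : ∀ s ∈ posOrthant k, AEStronglyMeasurable (H s f) μ)
    (hcont : ∀ g, ∀ᵐ x ∂μ, ContinuousOn (fun s => H s f x) (cube L (left g))) :
    outerLpNorm (fun x =>
      (∑' g, (variation 2 (cube L (left g)) fun s => H s f x) ^ (2 : ℝ)) ^ (1 / 2 : ℝ))
        (ENNReal.ofReal p) μ ≤
      2 * D * ((1 - ENNReal.ofReal (2 ^ (-η)))⁻¹) ^ k * eLpNorm f (ENNReal.ofReal p) μ := by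
  have hp0 : 0 < p := by linarith
  let Y : (Fin k → ℕ) → X → ℝ≥0∞ := fun n x => (∑' g, ∑ q : ∀ i, Fin (2 ^ n i),
    ‖blockDiff L (left g) n (fun i => q i) fun s => H s f x‖ₑ ^ (2 : ℝ)) ^ (1 / 2 : ℝ)
  have hfam := fun n => isBlockFamily_blockDiff (μ := μ) (H := H) hc hl n
  have hbd : ∀ n g (q : ∀ i, Fin (2 ^ n i)),
      AEStronglyMeasurable (fun x => blockDiff L (left g) n (fun i => q i) fun s => H s f x) μ := by
    intro n g q
    have h1 : (fun x => blockDiff L (left g) n (fun i => q i) fun s => H s f x) =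
        fun x => comb H (diffCoeff (activeSet n)) (diffNode (activeSet n)
          (blockStep L (left g) n fun i => q i) (blockBase L (left g) n fun i => q i)) f x := by
      funext x
      rw [comb_diff]
      rfl
    rw [h1]
    exact Finset.aestronglyMeasurable_fun_sum _ fun u _ =>
      (hm _ (cube_subset_posOrthant (hl g) ((hfam n).mem_cube g q u))).const_mul _
  have hY : ∀ n, AEMeasurable (Y n) μ := fun n => (AEMeasurable.tsum fun g =>
    Finset.aemeasurable_fun_sum _ fun q _ => (hbd n g q).enorm.pow_const _).pow_const _
  have hYle : ∀ n, eLpNorm (Y n) (ENNReal.ofReal p) μ ≤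
      D * (∏ i, ENNReal.ofReal (2 ^ (-η)) ^ n i) * eLpNorm f (ENNReal.ofReal p) μ := by
    intro n
    have h1 := hdecay _ _ _ (hfam n) (isBlockFamily_blockDiff hc' hl n) f hf
    simp only [comb_diff] at h1
    refine h1.trans (le_of_eq ?_)
    rw [ENNReal.coe_mul]
    congr 2
    rw [Fintype.card_pi]
    simp only [Fintype.card_fin]
    push_cast
    rw [← NNReal.finsetProd_rpow, ENNReal.ofNNReal_finsetProd]
    refine Finset.prod_congr rfl fun i _ => ?_
    rw [ENNReal.ofReal, ← ENNReal.coe_pow, Real.toNNReal_rpow_of_nonneg two_pos.le,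
      Real.toNNReal_ofNat, ← NNReal.rpow_natCast, ← NNReal.rpow_natCast, ← NNReal.rpow_mul,
      ← NNReal.rpow_mul, mul_comm]
  have hpt : (fun x => (∑' g, (variation 2 (cube L (left g)) fun s => H s f x) ^ (2 : ℝ)) ^
      (1 / 2 : ℝ)) ≤ᵐ[μ] fun x => 2 * ∑' n, Y n x := by
    filter_upwards [ae_all_iff.2 hcont] with x hx
    let y : (Fin k → ℕ) → (Fin r → ℤ) → ℝ≥0∞ := fun n g => (∑ q : ∀ i, Fin (2 ^ n i),
      ‖blockDiff L (left g) n (fun i => q i) fun s => H s f x‖ₑ ^ (2 : ℝ)) ^ (1 / 2 : ℝ)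
    have hy : ∀ n, (∑' g, y n g ^ (2 : ℝ)) ^ (1 / 2 : ℝ) = Y n x := by
      intro n
      simp only [y, Y]
      congr 2
      funext g
      rw [← ENNReal.rpow_mul]
      norm_num
    calc _ ≤ (∑' g, (2 * ∑' n, y n g) ^ (2 : ℝ)) ^ (1 / 2 : ℝ) := by
          gcongr with g
          exact variation_cube_le (hl g) _ (hx g)
      _ = 2 * (∑' g, (∑' n, y n g) ^ (2 : ℝ)) ^ (1 / 2 : ℝ) := by
          simp_rw [ENNReal.mul_rpow_of_nonneg _ _ two_pos.le]
          rw [ENNReal.tsum_mul_left, ENNReal.mul_rpow_of_nonneg _ _ (by norm_num),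
            ← ENNReal.rpow_mul]
          norm_num
      _ ≤ 2 * ∑' n, (∑' g, y n g ^ (2 : ℝ)) ^ (1 / 2 : ℝ) := by
          gcongr
          exact Lp_tsum_tsum_le y
      _ = _ := by simp_rw [hy]
  have hYsum : AEMeasurable (fun x => ∑' n, Y n x) μ := AEMeasurable.tsum hY
  refine (outerLpNorm_le _ (hYsum.const_mul 2) hpt).trans ?_
  rw [eLpNorm_ennreal_const_mul hYsum _ hp0, mul_assoc, mul_assoc]
  gcongr
  have h2 : eLpNorm (fun x => ∑' n, Y n x) (ENNReal.ofReal p) μ ≤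
      ∑' n, eLpNorm (Y n) (ENNReal.ofReal p) μ := by
    simp_rw [eLpNorm_ofReal _ hp0, enorm_eq_self]
    exact lintegral_Lp_tsum_le hp Y hY
  refine (h2.trans (ENNReal.tsum_le_tsum hYle)).trans ?_
  rw [ENNReal.tsum_mul_right, ENNReal.tsum_mul_left, mul_assoc]
  gcongr
  exact tsum_prod_pow_le k _

/-- The constant of the variation and oscillation inequalities, in terms of the constant `A` of the
splitting estimate, and of the constant `D` and the rate `η` of the decay of the block square
functions. -/
def variationConst (k : ℕ) (A D : ℝ≥0) (η : ℝ) : ℝ≥0 :=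
  3 * (A * (2 * D + 2 * D * ((1 - (2 ^ (-η) : ℝ≥0))⁻¹) ^ k))

/-- The variation and oscillation inequalities follow from the decay of the block square functions:
the long variation is controlled by the operators at the points `pt g`, the short variations by
the dyadic block increments. -/
theorem HasBlockDecay.variationOscillationBound (hr : 0 < r) {p₀ : ℝ≥0∞} {A D A' : ℝ≥0}
    {p η : ℝ} (hp : 1 ≤ p) (hη : 0 < η) (hp₀ : 1 ≤ p₀)
    (hdecay : HasBlockDecay μ H H' L left p₀ (blockSize k L A) p D η)
    (hc : ∀ p, p = p₀ ∨ p = 2 → CancellationCondition μ H L left p A)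
    (hc' : ∀ p, p = p₀ ∨ p = 2 → CancellationCondition μ H' L left p A)
    (hl : ∀ g, left g ∈ posOrthant k)
    (hlin : ∀ s ∈ posOrthant k, IsLinearOperator (SumLpFun p₀ 2 μ) μ (H s))
    (hlin' : ∀ s ∈ posOrthant k, IsLinearOperator (SumLpFun p₀ 2 μ) μ (H' s))
    (hpt : ∀ g, pt g ∈ cube L (left g))
    (hm : ∀ s ∈ posOrthant k, ∀ f, MemLp f (ENNReal.ofReal p) μ → AEStronglyMeasurable (H s f) μ)
    (hsplit : SplittingEstimate μ H L left pt (ENNReal.ofReal p) A')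
    (hcont : ContinuityCondition μ H L left (ENNReal.ofReal p)) :
    VariationOscillationBound μ H (ENNReal.ofReal p) (variationConst k A' D η) := by
  unfold variationConst
  have hp0 : 0 < p := by linarith
  set C := A' * (2 * D + 2 * D * ((1 - (2 ^ (-η) : ℝ≥0))⁻¹) ^ k) with hC
  have hlt : (2 ^ (-η) : ℝ≥0) < 1 :=
    NNReal.rpow_lt_one_of_one_lt_of_neg (by norm_num) (by linarith)
  have hx : (1 - ENNReal.ofReal (2 ^ (-η)))⁻¹ = (((1 - (2 ^ (-η) : ℝ≥0))⁻¹ : ℝ≥0) : ℝ≥0∞) := by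
    rw [ENNReal.coe_inv (tsub_pos_of_lt hlt).ne', ENNReal.coe_sub, ENNReal.ofReal,
      Real.toNNReal_rpow_of_nonneg two_pos.le, Real.toNNReal_ofNat, ENNReal.coe_one]
  have hvar : ∀ f, MemLp f (ENNReal.ofReal p) μ →
      outerLpNorm (fun x => variation 2 (posOrthant k) fun s => H s f x) (ENNReal.ofReal p) μ ≤
        C * eLpNorm f (ENNReal.ofReal p) μ := by
    intro f hf
    refine (hsplit f hf).trans ?_
    rw [hC, ENNReal.coe_mul, mul_assoc]
    gcongr
    have h1 := outerLpNorm_long_variation_le hr hp0 hp₀ hdecay hc hc' hl hlin hlin' hpt hf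
      fun s hs => hm s hs f hf
    have h2 := outerLpNorm_short_variation_le hp hdecay hc hc' hl hf (fun s hs => hm s hs f hf)
      (hcont f hf)
    rw [hx] at h2
    refine (add_le_add h1 h2).trans (le_of_eq ?_)
    push_cast
    ring
  have hC3 : ∀ f : X → ℂ, ((3 * C : ℝ≥0) : ℝ≥0∞) * eLpNorm f (ENNReal.ofReal p) μ =
      3 * (C * eLpNorm f (ENNReal.ofReal p) μ) := fun f => by
    push_cast
    ring
  refine ⟨fun f hf => (hvar f hf).trans ?_, fun f hf => ?_⟩
  · rw [hC3]
    exact le_mul_of_one_le_left zero_le (by norm_num)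
  · refine iSup_le fun I => iSup_le fun hI => iSup_le fun hI' => ?_
    rw [hC3]
    refine le_trans (outerLpNorm_mono_mul hp0 (by norm_num) (by norm_num) fun x =>
      multiOscillation_le_variation I hI hI' fun s => H s f x) ?_
    gcongr
    exact hvar f hf

end Assembly

/-! ### Duality -/

section Duality

variable {X : Type*} [MeasurableSpace X] {μ : Measure X} {k : ℕ}
  {H H' : (Fin k → ℝ) → (X → ℂ) → X → ℂ} {U : Type*} [Fintype U] {B : Type*} [Fintype B]

/-- For `s ∈ Q` the operator `H_s` maps `L^p` to itself, `H'_s` maps the functions which belong to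
all the spaces `L^q` to `L^{p'}`, and `H'_s` is the adjoint of `H_s`. -/
structure AdjointOn (μ : Measure X) (H H' : (Fin k → ℝ) → (X → ℂ) → X → ℂ)
    (Q : Set (Fin k → ℝ)) (p p' : ℝ) : Prop where
  memLp : ∀ s ∈ Q, ∀ f, MemLp f (ENNReal.ofReal p) μ → MemLp (H s f) (ENNReal.ofReal p) μ
  memLp_adjoint : ∀ s ∈ Q, ∀ g : X → ℂ, (∀ q, MemLp g q μ) →
    MemLp (H' s g) (ENNReal.ofReal p') μ
  adjoint : ∀ s ∈ Q, ∀ f g : X → ℂ, MemLp f (ENNReal.ofReal p) μ → (∀ q, MemLp g q μ) →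
    ∫ x, H s f x * conj (g x) ∂μ = ∫ x, f x * conj (H' s g x) ∂μ

variable {Q : Set (Fin k → ℝ)} {p p' : ℝ} {σ : B → U → ℝ} {t : B → U → Fin k → ℝ}

/-- The vector-valued adjoint operator, applied to `ψ` and conjugated before and after. -/
def adjVec (H' : (Fin k → ℝ) → (X → ℂ) → X → ℂ) (σ : B → U → ℝ) (t : B → U → Fin k → ℝ)
    (ψ : X → EuclideanSpace ℂ B) : X → EuclideanSpace ℂ B :=
  toVec fun b x => conj (comb H' (σ b) (t b) (fun y => conj (ψ y b)) x)

theorem eLpNorm_adjVec (ψ : X → EuclideanSpace ℂ B) (q : ℝ≥0∞) :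
    eLpNorm (adjVec H' σ t ψ) q μ =
      eLpNorm (applyVec (fun b => comb H' (σ b) (t b)) id (toVec fun b x => conj (ψ x b))) q μ :=
  eLpNorm_congr_norm_ae (Eventually.of_forall fun x => by
    simp [adjVec, applyVec, EuclideanSpace.norm_eq])

theorem eLpNorm_toVec_conj (ψ : X → EuclideanSpace ℂ B) (q : ℝ≥0∞) :
    eLpNorm (toVec fun b x => conj (ψ x b)) q μ = eLpNorm ψ q μ :=
  eLpNorm_congr_norm_ae (Eventually.of_forall fun x => by simp [EuclideanSpace.norm_eq])

theorem memLp_conj {g : X → ℂ} {q : ℝ≥0∞} (hg : MemLp g q μ) :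
    MemLp (fun x => conj (g x)) q μ :=
  hg.congr_norm (Complex.continuous_conj.comp_aestronglyMeasurable hg.1)
    (Eventually.of_forall fun x => by simp)

theorem AdjointOn.memLp_adjVec (h : AdjointOn μ H H' Q p p') (ht : ∀ b u, t b u ∈ Q)
    {ψ : X → EuclideanSpace ℂ B} (hψ : ∀ q, MemLp ψ q μ) :
    MemLp (adjVec H' σ t ψ) (ENNReal.ofReal p') μ :=
  memLp_toVec fun b => memLp_conj <| memLp_finsetSum _ fun u _ =>
    (h.memLp_adjoint _ (ht b u) _ fun q => memLp_conj (MemLp.apply_euclidean (hψ q) b)).const_mul _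

theorem AdjointOn.pairing_comb (h : AdjointOn μ H H' Q p p') (hp : p.HolderConjugate p')
    (ht : ∀ b u, t b u ∈ Q) {F : B → X → ℂ} (hF : ∀ b, MemLp (F b) (ENNReal.ofReal p) μ)
    {ψ : X → EuclideanSpace ℂ B} (hψ : ∀ q, MemLp ψ q μ) :
    pairing μ (toVec fun b => comb H (σ b) (t b) (F b)) ψ =
      pairing μ (adjVec H' σ t ψ) (toVec F) := by
  have hpp : (ENNReal.ofReal p).HolderConjugate (ENNReal.ofReal p') := hp.ennrealOfReal
  refine Finset.sum_congr rfl fun b _ => ?_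
  have hψb : ∀ q, MemLp (fun x => ψ x b) q μ := fun q =>
    MemLp.apply_euclidean (hψ q) b
  have e1 : ∀ x, toVec (fun b => comb H (σ b) (t b) (F b)) x b * ψ x b =
      ∑ u, (σ b u : ℂ) * (H (t b u) (F b) x * conj (conj (ψ x b))) := by
    intro x
    simp only [toVec_apply, comb, Finset.sum_mul, Complex.conj_conj, mul_assoc]
  have e2 : ∀ x, adjVec H' σ t ψ x b * toVec F x b =
      ∑ u, (σ b u : ℂ) * (F b x * conj (H' (t b u) (fun y => conj (ψ y b)) x)) := by
    intro x
    simp only [adjVec, toVec_apply, comb, map_sum, Finset.sum_mul, map_mul, Complex.conj_ofReal]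
    exact Finset.sum_congr rfl fun u _ => by ring
  simp_rw [e1, e2]
  rw [integral_finsetSum, integral_finsetSum]
  · refine Finset.sum_congr rfl fun u _ => ?_
    rw [integral_const_mul, integral_const_mul,
      h.adjoint _ (ht b u) _ _ (hF b) fun q => memLp_conj (hψb q)]
  · exact fun u _ => ((hF b).integrable_mul (memLp_conj (h.memLp_adjoint _ (ht b u) _
      fun q => memLp_conj (hψb q)))).const_mul _
  · exact fun u _ => ((h.memLp _ (ht b u) _ (hF b)).integrable_mul
      (memLp_conj (memLp_conj (hψb (ENNReal.ofReal p'))))).const_mul _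

/-- A vector-valued bound for the adjoint operators on `L^q` gives one for the operators themselves
on the conjugate space. -/
theorem AdjointOn.eLpNorm_applyVec_le (h : AdjointOn μ H H' Q 2 2) {q q' : ℝ}
    (hq : q.HolderConjugate q') (ht : ∀ b u, t b u ∈ Q) {K : ℝ≥0}
    (hK : ∀ F : X → EuclideanSpace ℂ B, MemLp F 2 μ → MemLp F (ENNReal.ofReal q) μ →
      eLpNorm (applyVec (fun b => comb H' (σ b) (t b)) id F) (ENNReal.ofReal q) μ ≤
        K * eLpNorm F (ENNReal.ofReal q) μ)
    {F : X → EuclideanSpace ℂ B} (hF2 : MemLp F 2 μ) (hFq : MemLp F (ENNReal.ofReal q') μ) :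
    eLpNorm (applyVec (fun b => comb H (σ b) (t b)) id F) (ENNReal.ofReal q') μ ≤
      K * eLpNorm F (ENNReal.ofReal q') μ := by
  have e2 : ENNReal.ofReal 2 = 2 := by simp
  have hFb : ∀ b, MemLp (fun x => F x b) (ENNReal.ofReal 2) μ := fun b => by
    rw [e2]
    exact MemLp.apply_euclidean hF2 b
  refine eLpNorm_le_of_enorm_pairing_le (u := applyVec (fun b => comb H (σ b) (t b)) id F)
    (s := 2) (s' := 2) Real.HolderConjugate.two_two hq.symm
    (memLp_toVec fun b => memLp_finsetSum _ fun u _ =>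
      (h.memLp _ (ht b u) _ (hFb b)).const_mul _)
    (ENNReal.mul_ne_top ENNReal.coe_ne_top hFq.2.ne) fun ψ hψ => ?_
  have hψq := fun q => memLp_of_finMeasSupp hψ q
  have h1 : pairing μ (applyVec (fun b => comb H (σ b) (t b)) id F) ψ =
      pairing μ (adjVec H' σ t ψ) F :=
    h.pairing_comb Real.HolderConjugate.two_two ht hFb hψq
  have hm : MemLp (adjVec H' σ t ψ) (ENNReal.ofReal 2) μ := h.memLp_adjVec ht hψq
  rw [h1]
  refine (enorm_pairing_le hq hm.1 hF2.1).trans ?_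
  have hψc : ∀ s, MemLp (toVec fun b x => conj (ψ x b)) s μ := fun s =>
    memLp_toVec fun b => memLp_conj (MemLp.apply_euclidean (hψq s) b)
  have h2 := hK _ (hψc 2) (hψc _)
  rw [← eLpNorm_adjVec, eLpNorm_toVec_conj] at h2
  calc _ ≤ K * eLpNorm ψ (ENNReal.ofReal q) μ * eLpNorm F (ENNReal.ofReal q') μ := by gcongr
    _ = _ := by ring

/-- A bound on `L² ∩ L^p` extends to `L^p`, as the adjoint operators make the pairings with simple
functions continuous on `L^p`. -/
theorem AdjointOn.eLpNorm_toVec_le (h : AdjointOn μ H H' Q p p') (hp : p.HolderConjugate p')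
    (ht : ∀ b u, t b u ∈ Q) {K : ℝ≥0}
    (hK : ∀ f, MemLp f 2 μ → MemLp f (ENNReal.ofReal p) μ →
      eLpNorm (toVec fun b => comb H (σ b) (t b) f) (ENNReal.ofReal p) μ ≤
        K * eLpNorm f (ENNReal.ofReal p) μ)
    {f : X → ℂ} (hf : MemLp f (ENNReal.ofReal p) μ) :
    eLpNorm (toVec fun b => comb H (σ b) (t b) f) (ENNReal.ofReal p) μ ≤
      K * eLpNorm f (ENNReal.ofReal p) μ := by
  have hp1 : 1 ≤ ENNReal.ofReal p := by
    rw [← ENNReal.ofReal_one]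
    exact ENNReal.ofReal_le_ofReal hp.lt.le
  obtain ⟨φ, hφ, hlim⟩ := exists_simpleFunc_tendsto (μ := μ) (p₀ := ENNReal.ofReal p)
    (zero_lt_one.trans_le hp1).ne' ENNReal.ofReal_ne_top (memLp_toVec_unit hf)
  have hlim := hlim _ ENNReal.ofReal_ne_top (memLp_toVec_unit hf)
  set g : ℕ → X → ℂ := fun n x => φ n x () with hg
  have hgm : ∀ n q, MemLp (g n) q μ := fun n q =>
    MemLp.apply_euclidean (memLp_of_finMeasSupp (hφ n) q) ()
  have hgf : Tendsto (fun n => eLpNorm (g n - f) (ENNReal.ofReal p) μ) atTop (𝓝 0) := by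
    refine hlim.congr fun n => eLpNorm_congr_norm_ae (Eventually.of_forall fun x => ?_)
    simp [EuclideanSpace.norm_eq, hg]
  have hnorm := tendsto_eLpNorm_of_sub hp1 hf (fun n => hgm n _) hgf
  have hmem : ∀ u, MemLp u (ENNReal.ofReal p) μ →
      MemLp (toVec fun b => comb H (σ b) (t b) u) (ENNReal.ofReal p) μ := fun u hu =>
    memLp_toVec fun b => memLp_finsetSum _ fun v _ => (h.memLp _ (ht b v) _ hu).const_mul _
  refine eLpNorm_le_of_enorm_pairing_le hp hp (hmem f hf)
    (ENNReal.mul_ne_top ENNReal.coe_ne_top hf.2.ne) fun ψ hψ => ?_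
  have hψq := fun q => memLp_of_finMeasSupp hψ q
  have hsub : Tendsto (fun n => eLpNorm ((toVec fun _ : B => g n) - toVec fun _ : B => f)
      (ENNReal.ofReal p) μ) atTop (𝓝 0) := by
    refine tendsto_of_tendsto_of_tendsto_of_le_of_le tendsto_const_nhds
      (h := fun n => ∑ _b : B, eLpNorm (g n - f) (ENNReal.ofReal p) μ) ?_ (fun _ => zero_le)
      fun n => ?_
    · have := tendsto_finsetSum (Finset.univ : Finset B) fun b _ => hgf
      simpa using this
    · have e3 : (toVec fun _ : B => g n) - (toVec fun _ : B => f) = toVec fun _ : B => g n - f := by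
        funext x
        ext b
        simp
      rw [e3]
      exact eLpNorm_toVec_le_sum hp1 fun b => (hgm n 1).1.sub hf.1
  have hpair := tendsto_pairing hp.symm (h.memLp_adjVec (σ := σ) ht hψq)
    (memLp_toVec fun _ : B => hf) (fun n => memLp_toVec fun _ : B => hgm n _) hsub
  rw [h.pairing_comb hp ht (fun _ => hf) hψq]
  refine le_of_tendsto_of_tendsto (continuous_enorm.continuousAt.tendsto.comp hpair)
    (ENNReal.Tendsto.mul_const (ENNReal.Tendsto.const_mul hnorm (Or.inr ENNReal.coe_ne_top))
      (Or.inr (hψq _).2.ne)) (Eventually.of_forall fun n => ?_)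
  simp only [Function.comp_apply]
  rw [← h.pairing_comb hp ht (fun _ => hgm n _) hψq]
  refine (enorm_pairing_le hp (hmem _ (hgm n _)).1 (hψq 1).1).trans ?_
  gcongr
  exact hK _ (hgm n 2) (hgm n _)

theorem memLp_of_le_of_le {s q v : ℝ} (hs : 0 < s) (hsq : s ≤ q) (hqv : q ≤ v) {u : X → ℂ}
    (h1 : MemLp u (ENNReal.ofReal s) μ) (h2 : MemLp u (ENNReal.ofReal v) μ) :
    MemLp u (ENNReal.ofReal q) μ := by
  have hq : 0 < q := hs.trans_le hsq
  have hv : 0 < v := hq.trans_le hqv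
  have hI : ∀ {a : ℝ}, 0 < a → MemLp u (ENNReal.ofReal a) μ → ∫⁻ x, ‖u x‖ₑ ^ a ∂μ < ∞ := by
    intro a ha h
    have := h.eLpNorm_lt_top
    rw [eLpNorm_ofReal _ ha, ENNReal.rpow_lt_top_iff_of_pos (by positivity)] at this
    exact this
  refine ⟨h1.1, ?_⟩
  rw [eLpNorm_ofReal _ hq, ENNReal.rpow_lt_top_iff_of_pos (by positivity)]
  calc ∫⁻ x, ‖u x‖ₑ ^ q ∂μ ≤ ∫⁻ x, ‖u x‖ₑ ^ s + ‖u x‖ₑ ^ v ∂μ := by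
        refine lintegral_mono fun x => ?_
        rcases le_total ‖u x‖ₑ 1 with h | h
        · exact (ENNReal.rpow_le_rpow_of_exponent_ge h hsq).trans le_self_add
        · exact (ENNReal.rpow_le_rpow_of_exponent_le h hqv).trans le_add_self
    _ = ∫⁻ x, ‖u x‖ₑ ^ s ∂μ + ∫⁻ x, ‖u x‖ₑ ^ v ∂μ :=
        lintegral_add_left' (h1.1.enorm.pow_const _) _
    _ < ∞ := ENNReal.add_lt_top.2 ⟨hI hs h1, hI hv h2⟩

end Duality

/-! ### Decay of the block square functions for exponents above two -/

section BlocksAboveTwo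

variable {X : Type*} [MeasurableSpace X] {μ : Measure X} {k r L : ℕ}
  {H H' : (Fin k → ℝ) → (X → ℂ) → X → ℂ} {left pt : (Fin r → ℤ) → Fin k → ℝ}
  {S : (Fin r → ℤ) → (X → ℂ) → X → ℂ} {c : (Fin r → ℤ) → ℝ} {ε : ℝ} {A₁ A₅ B : ℝ≥0}
  {A₂ A₄ : ℝ≥0∞ → ℝ≥0}

theorem conjExponent_ofReal {b b' : ℝ} (hb : b.HolderConjugate b') :
    (ENNReal.ofReal b).conjExponent = ENNReal.ofReal b' := by
  have : (ENNReal.ofReal b).HolderConjugate (ENNReal.ofReal b') := hb.ennrealOfReal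
  exact ENNReal.HolderConjugate.conjExponent_eq

theorem MaximalEstimate.memLp {p : ℝ} (hp : 0 < p) {A : ℝ≥0}
    (hmax : MaximalEstimate μ H (ENNReal.ofReal p) A) {s : Fin k → ℝ} (hs : s ∈ posOrthant k)
    {f : X → ℂ} (hf : MemLp f (ENNReal.ofReal p) μ) (hm : AEStronglyMeasurable (H s f) μ) :
    MemLp (H s f) (ENNReal.ofReal p) μ := by
  have h := hmax.eLpNorm_comb_le hp (σ := fun _ : Unit => 1) (t := fun _ => s) (by simp)
    (fun _ => hs) hf
  have e : comb H (fun _ : Unit => 1) (fun _ => s) f = H s f := by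
    funext x
    simp [comb]
  rw [e] at h
  exact ⟨hm, h.trans_lt (ENNReal.mul_lt_top ENNReal.coe_lt_top hf.2)⟩

/-- The dual hypotheses give the adjoint relation for `2 ≤ p ≤ p₁'`. The operators `H'_s` map to
`L^{p'}`, `p₁ ≤ p' ≤ 2`, because they are bounded on `L^{p₁}` and on `L²`. -/
theorem DualHypotheses.adjointOn {a b b' p p' : ℝ} (hb : b.HolderConjugate b')
    (hb2 : b ≤ 2) (hp : p.HolderConjugate p') (hp2 : 2 ≤ p) (hpb : p ≤ b')
    (hl : ∀ g, left g ∈ posOrthant k)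
    (hd : DualHypotheses μ H H' S L left pt (ENNReal.ofReal a) (ENNReal.ofReal b) A₁ A₅ A₂ A₄) :
    AdjointOn μ H H' (⋃ g, cube L (left g)) p p' := by
  have e2 : ENNReal.ofReal 2 = 2 := by simp
  have hpI : ENNReal.ofReal p ∈
      Set.Icc (ENNReal.ofReal b) (ENNReal.ofReal b).conjExponent := by
    rw [conjExponent_ofReal hb]
    exact ⟨ENNReal.ofReal_le_ofReal (hb2.trans hp2), ENNReal.ofReal_le_ofReal hpb⟩
  have hpos : ∀ s ∈ ⋃ g, cube L (left g), s ∈ posOrthant k := by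
    intro s hs
    obtain ⟨g, hg⟩ := Set.mem_iUnion.1 hs
    exact cube_subset_posOrthant (hl g) hg
  refine ⟨fun s hs => (hd.extension _ hpI s (hpos s hs)).2, fun s hs g hg => ?_,
    fun s hs f g hf hg => hd.adjoint _ hpI s (hpos s hs) f g hf (hg _) (hg _)⟩
  have hp'2 : p' ≤ 2 := by
    have h1 := hp.inv_add_inv_eq_one
    have h2 := inv_anti₀ two_pos hp2
    rw [← inv_le_inv₀ two_pos hp.symm.pos]
    linarith
  have hbp' : b ≤ p' := by
    have h1 := hp.inv_add_inv_eq_one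
    have h2 := hb.inv_add_inv_eq_one
    have h3 := inv_anti₀ hp.pos hpb
    rw [← inv_le_inv₀ hp.symm.pos hb.pos]
    linarith
  obtain ⟨g', hg'⟩ := Set.mem_iUnion.1 hs
  have h2 : MemLp (H' s g) 2 μ := (isL2Operator_of_cancellation hd.linear_adjoint hl
    (hd.cancellation 2 (Or.inr rfl)) g' s hg').memLp g (hg 2)
  exact memLp_of_le_of_le hb.pos hbp' hp'2 (hd.maximal.memLp hb.pos (hpos s hs) (hg _) h2.1)
    (e2.symm ▸ h2)

/-- The decay of the block square functions for `2 ≤ p ≤ p₁'`, by interpolation between `L²` and the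
space `L^{q'}` conjugate to the one of the vector-valued inequality for the adjoint operators. -/
theorem hasBlockDecay_of_two_le (k r L : ℕ) {a b b' p : ℝ} (ha : 1 ≤ a) (hab : a < b) (hb : b ≤ 2)
    (hbb : b.HolderConjugate b') (hp2 : 2 ≤ p) (hpb : p ≤ b') {ε : ℝ}
    (hε : ε ∈ Set.Ioo (0 : ℝ) (1 / 2)) (A₁ A₅ B : ℝ≥0) (A₂ A₄ : ℝ≥0∞ → ℝ≥0) :
    ∃ (D : ℝ≥0) (η : ℝ), 0 < η ∧ ∀ (X : Type*) [MeasurableSpace X] (μ : Measure X)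
      (H H' : (Fin k → ℝ) → (X → ℂ) → X → ℂ) (S : (Fin r → ℤ) → (X → ℂ) → X → ℂ)
      (left pt : (Fin r → ℤ) → Fin k → ℝ) (c : (Fin r → ℤ) → ℝ),
      Hypotheses μ H S L left pt c (ENNReal.ofReal a) (ENNReal.ofReal b) ε A₁ A₅ B A₂ A₄ →
      DualHypotheses μ H H' S L left pt (ENNReal.ofReal a) (ENNReal.ofReal b) A₁ A₅ A₂ A₄ →
        HasBlockDecay μ H H' L left (ENNReal.ofReal a) (blockSize k L A₅) p D η := by
  have hb0 : 0 < b := by linarith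
  have ha0 : 0 < a := by linarith
  have hp0 : 0 < p := by linarith
  have hpinv : p⁻¹ ≤ 2⁻¹ := inv_anti₀ two_pos hp2
  have habs : |p⁻¹ - 2⁻¹| = 2⁻¹ - p⁻¹ := by
    rw [abs_of_nonpos (by linarith)]
    ring
  obtain ⟨q, q', θ, hq, hqab, haq, hq2, hτθ, hθ1, hθ⟩ :=
    exists_interpolation_exponents (p := p) ha hab hb (by
      rw [habs]
      linarith [inv_anti₀ hp0 hpb, hbb.inv_add_inv_eq_one])
  rw [habs] at hθ
  have hqq := hq.inv_add_inv_eq_one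
  have hτ0 : 0 < (b - a) / (2 - a) := div_pos (by linarith) (by linarith)
  set A := blockSize k L A₅ with hA
  have hA0 : A ≠ 0 := by simp [hA, blockSize]
  set V : ℝ≥0 := (2 * A) ^ (a / 2) * (Fintype.card (Finset (Fin k)) * A₁) ^ (1 - a / 2) with hV
  refine ⟨(V * A₄ (ENNReal.ofReal q')) ^ (1 - θ) *
    ((Fintype.card (Finset (Fin k)) : ℝ≥0) ^ (1 / 2 - ε) * (A * A₄ 2) ^ (1 / 2 + ε)) ^ θ *
      B ^ (θ / ((b - a) / (2 - a))), ε * θ, mul_pos hε.1 (hτ0.trans_le hτθ), ?_⟩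
  intro X _ μ H H' S left pt c hyp hd M _ _ σ t hT hT' f hf
  have e2 : ENNReal.ofReal 2 = 2 := by simp
  have ha2 : ENNReal.ofReal a < 2 := by
    rw [← e2]
    exact (ENNReal.ofReal_lt_ofReal_iff two_pos).2 (by linarith)
  have hH := isL2Operator_of_cancellation hyp.linear hyp.left_pos (hyp.cancellation 2 (Or.inr rfl))
  have hH' := isL2Operator_of_cancellation hd.linear_adjoint hyp.left_pos
    (hd.cancellation 2 (Or.inr rfl))
  have hnode : ∀ g m u, t g m u ∈ posOrthant k := fun g m u =>
    cube_subset_posOrthant (hyp.left_pos g) (hT.mem_cube g m u)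
  have hnode' : ∀ g m u, t g m u ∈ ⋃ g, cube L (left g) := fun g m u =>
    Set.mem_iUnion.2 ⟨g, hT.mem_cube g m u⟩
  have hpp : p.HolderConjugate p.conjExponent :=
    Real.HolderConjugate.conjExponent (show 1 < p by linarith)
  have hadj := hd.adjointOn hbb hb hpp hp2 hpb hyp.left_pos
  have hadj2 := hd.adjointOn hbb hb Real.HolderConjugate.two_two le_rfl (hp2.trans hpb)
    hyp.left_pos
  have hq'2 : 2 ≤ q' := by
    rw [← inv_le_inv₀ hq.symm.pos two_pos]
    linarith [inv_anti₀ hq.pos hq2]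
  have hLPq : LittlewoodPaleyEstimate μ S (ENNReal.ofReal q') (A₄ (ENNReal.ofReal q')) := by
    refine hd.square _ ⟨?_, ?_⟩
    · rw [← e2]
      exact ENNReal.ofReal_le_ofReal hq'2
    · rcases ha.eq_or_lt with rfl | ha1
      · simp [ENNReal.conjExponent]
      · have haa := Real.HolderConjugate.conjExponent ha1
        rw [conjExponent_ofReal haa, ENNReal.ofReal_lt_ofReal_iff haa.symm.pos,
          ← inv_lt_inv₀ haa.symm.pos hq.symm.pos]
        linarith [haa.inv_add_inv_eq_one, inv_strictAnti₀ ha0 haq]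
  refine eLpNorm_tsum_sum_le (fun g m => Finset.aestronglyMeasurable_fun_sum _ fun u _ =>
    (hadj.memLp _ (hnode' g m u) f hf).1.const_mul _) hp0 fun Γ => ?_
  refine hadj.eLpNorm_toVec_le (B := Γ × M) (σ := fun b => σ b.1 b.2) (t := fun b => t b.1 b.2)
    hpp (fun b u => hnode' _ _ _) ?_ hf
  intro f hf2 hfp
  refine hT.eLpNorm_toVec_le ha2 hH hε hyp.littlewoodPaley hq.symm hpp ?_ hτ0 hτθ hθ1 ?_ hLPq Γ
    (fun F hF2 hFq => ?_) hf2 hfp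
  · rw [ENNReal.toReal_ofReal (by linarith), ENNReal.toReal_ofReal (by linarith)]
  · have : q'⁻¹ = 1 - q⁻¹ := by linarith
    rw [this]
    linarith
  · -- For a fixed block the adjoint operators have norm at most `A / N` on `L^{p₀}`, which gives the
    -- factor `N^{-p₀/2}`. This pays for the sum over the blocks, which costs `N^{1/2}` in `L^{q'}`.
    set N : ℝ≥0 := (Fintype.card M : ℝ≥0) with hN
    have hN0 : N ≠ 0 := by simp [hN]
    have hN1 : 1 ≤ N := by
      rw [hN]
      exact_mod_cast Fintype.card_pos
    have hcol : ∀ m, eLpNorm (toVec fun g : Γ => comb H (σ g m) (t g m) fun x => F x g)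
        (ENNReal.ofReal q') μ ≤ ((2 * (A / N)) ^ (a / 2) *
          (Fintype.card (Finset (Fin k)) * A₁) ^ (1 - a / 2) : ℝ≥0) *
            eLpNorm F (ENNReal.ofReal q') μ := by
      intro m
      refine hadj2.eLpNorm_applyVec_le (B := Γ) (σ := fun g => σ g m) (t := fun g => t g m) hq
        (fun g u => hnode' _ _ _) (fun G hG2 hGq => ?_) hF2 hFq
      exact eLpNorm_applyVec_comb_le (σ := fun g : Γ => σ g m) (t := fun g : Γ => t g m) (n := 1)
        (δ := A / N) (fun g => hT'.isL2Operator hH' _ _) (fun g u => hT.abs_le _ _ _)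
        (fun g u => hnode _ _ _) ha (by linarith) (by linarith) hq hqab hd.maximal id
        (fun g => Finset.card_le_one.2 fun g₁ h₁ g₂ h₂ =>
          ((Finset.mem_filter.1 h₁).2.trans (Finset.mem_filter.1 h₂).2.symm))
        (div_ne_zero hA0 hN0) (by simp) (fun g f hf => hT'.bound _ (Or.inl rfl) _ _ f hf) hG2 hGq
    have hm : ∀ b : Γ × M, AEStronglyMeasurable
        (comb H (σ b.1 b.2) (t b.1 b.2) fun x => F x b.1) μ := fun b =>
      ((hT.isL2Operator hH b.1 b.2).memLp _ (MemLp.apply_euclidean hF2 b.1)).1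
    refine (eLpNorm_toVec_prod_le hq'2
      (F := fun b : Γ × M => comb H (σ b.1 b.2) (t b.1 b.2) fun x => F x b.1) hm hcol).trans ?_
    rw [← mul_assoc]
    gcongr
    have e3 : ((Fintype.card M : ℕ) : ℝ≥0∞) ^ (1 / 2 : ℝ) = ((N ^ (1 / 2 : ℝ) : ℝ≥0) : ℝ≥0∞) := by
      rw [ENNReal.coe_rpow_of_nonneg _ (by norm_num)]
      rfl
    rw [e3, ← ENNReal.coe_mul, ENNReal.coe_le_coe, hV, ← mul_assoc]
    gcongr
    rw [← mul_div_assoc, NNReal.div_rpow, ← mul_div_assoc, mul_comm, mul_div_assoc]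
    refine mul_le_of_le_one_right zero_le ?_
    rw [div_le_one (NNReal.rpow_pos (zero_lt_one.trans_le hN1))]
    exact NNReal.rpow_le_rpow_of_exponent_le hN1 (by linarith)

end BlocksAboveTwo

end MultiparamVariation

end

theorem theorem3p1 (k r L : ℕ) (hk : 0 < k) (hr : 0 < r) (hL : 0 < L)
    (p₀ p₁ : ℝ≥0∞) (hp₀ : 1 ≤ p₀) (hp₀₁ : p₀ < p₁) (hp₁ : p₁ ≤ 2)
    (ε : ℝ) (hε : ε ∈ Set.Ioo (0 : ℝ) (1 / 2))
    (A₁ A₅ B : ℝ≥0) (A₂ A₄ : ℝ≥0∞ → ℝ≥0) :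
    (∃ C : ℝ≥0, ∀ (X : Type*) [MeasurableSpace X] (μ : Measure X) [SigmaFinite μ]
      (H : (Fin k → ℝ) → (X → ℂ) → X → ℂ) (S : (Fin r → ℤ) → (X → ℂ) → X → ℂ)
      (left pt : (Fin r → ℤ) → Fin k → ℝ) (c : (Fin r → ℤ) → ℝ),
      Hypotheses μ H S L left pt c p₀ p₁ ε A₁ A₅ B A₂ A₄ →
        VariationOscillationBound μ H p₁ C) ∧
    (∀ p ∈ Set.Icc p₁ p₁.conjExponent,
      ∃ C : ℝ≥0, ∀ (X : Type*) [MeasurableSpace X] (μ : Measure X) [SigmaFinite μ]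
        (H H' : (Fin k → ℝ) → (X → ℂ) → X → ℂ) (S : (Fin r → ℤ) → (X → ℂ) → X → ℂ)
        (left pt : (Fin r → ℤ) → Fin k → ℝ) (c : (Fin r → ℤ) → ℝ),
        Hypotheses μ H S L left pt c p₀ p₁ ε A₁ A₅ B A₂ A₄ →
        DualHypotheses μ H H' S L left pt p₀ p₁ A₁ A₅ A₂ A₄ →
          VariationOscillationBound μ H p C) := by
  have h2 : ENNReal.ofReal 2 = 2 := by simp
  have hp₁t : p₁ ≠ ∞ := ne_top_of_le_ne_top ENNReal.ofNat_ne_top hp₁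
  obtain ⟨a, rfl⟩ : ∃ a, p₀ = ENNReal.ofReal a :=
    ⟨p₀.toReal, (ENNReal.ofReal_toReal (ne_top_of_lt hp₀₁)).symm⟩
  obtain ⟨b, rfl⟩ : ∃ b, p₁ = ENNReal.ofReal b :=
    ⟨p₁.toReal, (ENNReal.ofReal_toReal hp₁t).symm⟩
  have ha : 1 ≤ a := ENNReal.one_le_ofReal.1 hp₀
  have hb0 : 0 < b := ENNReal.ofReal_pos.1 (zero_le.trans_lt hp₀₁)
  have hab : a < b := (ENNReal.ofReal_lt_ofReal_iff hb0).1 hp₀₁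
  have hb : b ≤ 2 := (ENNReal.ofReal_le_ofReal_iff two_pos.le).1 (h2.symm ▸ hp₁)
  have hbb : b.HolderConjugate b.conjExponent := Real.HolderConjugate.conjExponent (by linarith)
  refine ⟨?_, fun p hp => ?_⟩
  · obtain ⟨D, η, hη, hD⟩ := hasBlockDecay_of_le_two k r L ha hab hb le_rfl hb hε A₁ A₅ B A₂ A₄
    refine ⟨variationConst k (A₂ (ENNReal.ofReal b)) D η, fun X _ μ _ H S left pt c hyp => ?_⟩
    exact (hD X μ H H S left pt c hyp).variationOscillationBound hr (by linarith) hη hp₀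
      hyp.cancellation hyp.cancellation hyp.left_pos hyp.linear hyp.linear hyp.pt_mem
      (fun s hs f hf => (hyp.linear s hs).aestronglyMeasurable f
        (h2 ▸ lpFun_subset_sumLpFun (by linarith) hab.le hb hf))
      hyp.splitting hyp.continuity
  · obtain ⟨P, rfl⟩ : ∃ P, p = ENNReal.ofReal P := by
      refine ⟨p.toReal, (ENNReal.ofReal_toReal ?_).symm⟩
      rw [conjExponent_ofReal hbb] at hp
      exact ne_top_of_le_ne_top ENNReal.ofReal_ne_top hp.2
    have hbP : b ≤ P := (ENNReal.ofReal_le_ofReal_iff'.1 hp.1).resolve_right (not_le.2 hb0)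
    have hPb : P ≤ b.conjExponent := by
      rw [conjExponent_ofReal hbb] at hp
      exact (ENNReal.ofReal_le_ofReal_iff hbb.symm.nonneg).1 hp.2
    rcases le_total P 2 with hP2 | hP2
    · obtain ⟨D, η, hη, hD⟩ := hasBlockDecay_of_le_two k r L ha hab hb hbP hP2 hε A₁ A₅ B A₂ A₄
      refine ⟨variationConst k (A₂ (ENNReal.ofReal P)) D η,
        fun X _ μ _ H H' S left pt c hyp hd => ?_⟩
      exact (hD X μ H H S left pt c hyp).variationOscillationBound hr (by linarith) hη hp₀
        hyp.cancellation hyp.cancellation hyp.left_pos hyp.linear hyp.linear hyp.pt_mem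
        (fun s hs f hf => ((hd.extension _ hp s hs).2 f hf).1)
        (hd.splitting _ hp) (hd.continuity _ hp)
    · obtain ⟨D, η, hη, hD⟩ :=
        hasBlockDecay_of_two_le k r L ha hab hb hbb hP2 hPb hε A₁ A₅ B A₂ A₄
      refine ⟨variationConst k (A₂ (ENNReal.ofReal P)) D η,
        fun X _ μ _ H H' S left pt c hyp hd => ?_⟩
      exact (hD X μ H H' S left pt c hyp hd).variationOscillationBound hr (by linarith) hη hp₀
        hyp.cancellation hd.cancellation hyp.left_pos hyp.linear hd.linear_adjoint hyp.pt_mem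
        (fun s hs f hf => ((hd.extension _ hp s hs).2 f hf).1)
        (hd.splitting _ hp) (hd.continuity _ hp)
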